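/- **Setting.** Let $R_0\subset V_0$ be a finite crystallographic reduced irreducible root system in a Euclidean space $(V_0,\langle\cdot,\cdot\rangle)$, normalized so that long roots have squared length $2$, with basis $\alpha_1,\dots,\alpha_n$, highest root $\varphi$, coroots $\alpha^\vee=2\alpha/\|\alpha\|^2$, Weyl group $W_0$ and coweight lattice $P^\vee=\{\lambda\in V_0 : \langle\lambda,\alpha\rangle\in\mathbb Z\ \forall\alpha\in R_0\}$. On $V=\mathbb Rc\oplus V_0$ let $W_0$ act by fixing $c$, and let $\tau(v)(rc+v')=(r-\langle v,v'\rangle)c+v'$ for $v\in V_0$. Let $W=W_0\ltimes\tau(P^\vee)$ be the extended affine Weyl group and $R=\{a^\vee : a\in\mathbb Zc+R_0\}$, where $a^\vee=2a/\|\alpha\|^2$ for $a=rc+\alpha$; $R$ is $W$-stable. The simple affine roots are $a_0=c-\varphi^\vee$ and $a_i=\alpha_i^\vee$ $(1\le i\le n)$; the simple reflections are $s_0=s_\varphi\tau(-\varphi^\vee)$ and $s_i=s_{\alpha_i}$. Let $R^+$ be the set of roots in $R$ that are nonnegative combinations of the $a_j$, $R^-=-R^+$, $\ell(w)=\#(R^+\cap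 w^{-1}R^-)$ and $\Omega=\{w\in W:\ell(w)=0\}$, a group which permutes the simple affine roots, $\omega(a_j)=a_{\omega(j)}$. Let $k:R\to\mathbb C^\times$ be a $W$-invariant function, $k_j=k_{a_j}$, and let $k^{-1}$ be the function $a\mapsto k_a^{-1}$. The extended affine Hecke algebra $H(k)$ is the unital associative $\mathbb C$-algebra generated by $T_0,\dots,T_n$ and $T_\omega$ $(\omega\in\Omega)$ with relations: the braid relations $T_iT_jT_i\cdots=T_jT_iT_j\cdots$ ($m_{ij}$ factors on each side) for $i\ne j$ with $s_is_j$ of finite order $m_{ij}$; $(T_j-k_j)(T_j+k_j^{-1})=0$; $T_1=1$ for the unit $1\in\Omega$, $T_{\omega\omega'}=T_\omega T_{\omega'}$, and $T_\omega T_j=T_{\omega(j)}T_\omega$. Let $H_0(k)$ be the subalgebra generated by $T_1,\dots,T_n$. Let $\epsilon_+^k:H(k)\to\mathbb C$ be the character with $T_j\mapsto k_j$, $T_\omega\mapsto1$, and $J_k:H(k^{-1})\to H(k)$ the unital algebra anti-homomorphism with $J_k(T_j)=T_j^{-1}$, $J_k(T_\omega)=T_{\omega^{-1}}$. Let $m$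 be the positive integer such that $m\langle P^\vee,P^\vee\rangle$ generates the group $\mathbb Z$, fix an arbitrary $q^{1/m}\in\mathbb C^\times$ (possibly a root of unity), and put $q^r=(q^{1/m})^{mr}$ for $r\in\frac1m\mathbb Z$. Let $T=\mathrm{Hom}(P^\vee,\mathbb C^\times)$, so that $\mathbb C[T]$ is the group algebra of $P^\vee$ with basis $e^\lambda$ $(\lambda\in P^\vee)$, and let $\mathbb C(T)$ be its field of fractions. Put $e_q^{rc+\lambda}=q^re^\lambda$. The group $W$ acts on $\mathbb C(T)$ by field automorphisms with $w_q(e_q^{x})=e_q^{wx}$; let $\mathbb C(T)\#_qW$ be the smash product. For $a\in R$ put $c_a=c_a^{k,q}=\dfrac{k_a^{-1}-k_ae_q^a}{1-e_q^a}$, and $c_j=c_{a_j}$. Let $\mathcal A=(\mathbb C(T)\#_qW)\otimes_{\mathbb C}H(k)$, in which $\mathbb C(T)\#_qW$ and $H(k)$ are regarded as commuting subalgebras. There are unique unital algebra homomorphisms * $\pi^{k,q}:H(k)\to\mathbb C(T)\#_qW$ with $T_j\mapsto k_j+c_j(s_j-1)$, $T_\omega\mapsto\omega$ (and similarly $\pi^{k^{-1},q}:H(k^{-1})\to\mathbb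 C(T)\#_qW$ with $k$ replaced by $k^{-1}$ throughout); * $\sigma^{k,q}:H(k)\to\mathcal A$ with $T_j\mapsto s_jT_j+(c_j-k_j)(s_j-1)$, $T_\omega\mapsto\omega T_\omega$; * $\nabla^{k,q}:\mathbb C(T)\#_qW\to\mathcal A$ with $f\mapsto f$ $(f\in\mathbb C(T))$, $s_j\mapsto c_j^{-1}s_jT_j+\dfrac{c_j-k_j}{c_j}s_j$, $\omega\mapsto\omega T_\omega$ $(0\le j\le n,\ \omega\in\Omega)$. Let $\mathbb C_\sigma[T]$, resp. $\mathbb C_\nabla[T]$, be the subalgebra of $\mathbb C(T)$ generated by $\mathbb C[T]$ and the elements $(1-e_q^a)^{-1}$, resp. $(k_a^{-1}-k_ae_q^a)^{-1}$, for all $a\in R$. Let $\mathcal A_\sigma=(\mathbb C_\sigma[T]\#_qW)\otimes H(k)$ and $\mathcal A_\nabla=(\mathbb C_\nabla[T]\#_qW)\otimes H(k)$, and let $\mathcal A_{\sigma,\nabla}^{k,q}$ be the subalgebra of $\mathcal A$ generated by $\mathcal A_\sigma$ and $\mathcal A_\nabla$. It contains $\sigma^{k,q}(H(k))$, $\nabla^{k,q}(W)$,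 $\pi^{k^{-1},q}(H(k^{-1}))$ and $H(k)$. For a left $\mathcal A_{\sigma,\nabla}^{k,q}$-module $M$, a subalgebra $A\subseteq H(k)$ and a subgroup $G\subseteq W$ put $$M_\sigma^A=\{m\in M:\sigma^{k,q}(h)m=\epsilon_+^k(h)m\ \ \forall h\in A\},\qquad M_\nabla^G=\{m\in M:\nabla^{k,q}(g)m=m\ \ \forall g\in G\}.$$ **Proposition.** Let $M$ be a left $\mathcal A_{\sigma,\nabla}^{k,q}$-module. Then (i) $M_\sigma^{H_0(k)}=M_\nabla^{W_0}=\{m\in M:\pi^{k^{-1},q}(h)m=J_k(h)m\ \ \forall h\in H_0(k^{-1})\}$; (ii) $M_\sigma^{H(k)}=M_\nabla^{W}=\{m\in M:\pi^{k^{-1},q}(h)m=J_k(h)m\ \ \forall h\in H(k^{-1})\}$. -/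

import Mathlib

open scoped RealInnerProductSpace TensorProduct

section
set_option linter.unusedSimpArgs false


/-- The alternating product `a * b * a * ⋯` with `n` factors. -/
def altProd {M : Type*} [Monoid M] (a b : M) : ℕ → M
  | 0 => 1
  | n + 1 => a * altProd b a n


theorem braid_demazure_3 {K A : Type*} [CommRing K] [Ring A] [Module K A] [IsScalarTower K A A]
    (s t : K →+* K) (σ τ : A) (a b c h : K)
    (hσ : ∀ (f : K) (x : A), σ * (f • x) = s f • (σ * x))
    (hτ : ∀ (f : K) (x : A), τ * (f • x) = t f • (τ * x))
    (sh : s h = h) (th : t h = h)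
    (sa : s a = 1 - a) (sb : s b = c) (sc : s c = b) (tb : t b = 1 - b) (ta : t a = c)
    (tc : t c = a)
    (r1 : a * b = c * (a + b - 1))
    (hσσ : ∀ x, σ * (σ * x) = (1 + h ^ 2 * (a * (1 - a))) • x)
    (hττ : ∀ x, τ * (τ * x) = (1 + h ^ 2 * (b * (1 - b))) • x)
    (br : altProd σ τ 3 = altProd τ σ 3) :
    altProd ((h * a) • 1 + σ) ((h * b) • 1 + τ) 3 =
      altProd ((h * b) • 1 + τ) ((h * a) • 1 + σ) 3 := by
  have hσσ1 : σ * σ = (1 + h ^ 2 * (a * (1 - a))) • 1 := by simpa using hσσ 1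
  have hττ1 : τ * τ = (1 + h ^ 2 * (b * (1 - b))) • 1 := by simpa using hττ 1
  simp only [altProd, mul_one] at br ⊢
  simp only [mul_add, add_mul, smul_mul_assoc, one_mul, hσ, hτ, smul_add, smul_smul, map_mul,
    map_sub, map_one, map_pow, map_add, sh, th, sa, sb, sc, tb, ta, tc,
    hσσ1, hττ1, mul_one, hσσ, hττ, br]
  match_scalars
  all_goals
    first
      | ring1
      | linear_combination (h^2) * r1
      | linear_combination ((-1)*h^2) * r1
      | linear_combination (h^3*a + (-1)*h^3*b) * r1


theorem yangBaxter_3 {K B : Type*} [CommRing K] [Ring B] [Algebra K B]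
    (T U : B) (a b c h : K)
    (r1 : a * b = c * (a + b - 1))
    (hT : T * T = h • T + 1) (hU : U * U = h • U + 1)
    (br : altProd T U 3 = altProd U T 3) :
    (T - (h * a) • 1) * (U - (h * c) • 1) * (T - (h * b) • 1) =
    (U - (h * b) • 1) * (T - (h * c) • 1) * (U - (h * a) • 1) := by
  have hT' : ∀ x, T * (T * x) = h • (T * x) + x := fun x => by
    rw [← mul_assoc, hT, add_mul, smul_mul_assoc, one_mul]
  have hU' : ∀ x, U * (U * x) = h • (U * x) + x := fun x => by
    rw [← mul_assoc, hU, add_mul, smul_mul_assoc, one_mul]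
  simp only [altProd, mul_one] at br
  simp only [sub_eq_add_neg, ← neg_smul, mul_assoc]
  simp only [mul_add, add_mul, smul_mul_assoc, mul_smul_comm, one_mul, smul_add, smul_smul,
    mul_one, hT, hU, hT', hU', br]
  match_scalars
  all_goals
    first
      | ring1
      | linear_combination (h^2) * r1
      | linear_combination ((-1)*h^2) * r1


theorem braid_demazure_4 {K A : Type*} [CommRing K] [Ring A] [Module K A] [IsScalarTower K A A]
    (s t : K →+* K) (σ τ : A) (a b c d h j : K)
    (hσ : ∀ (f : K) (x : A), σ * (f • x) = s f • (σ * x))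
    (hτ : ∀ (f : K) (x : A), τ * (f • x) = t f • (τ * x))
    (sh : s h = h) (th : t h = h) (sj : s j = j) (tj : t j = j)
    (sa : s a = 1 - a) (sb : s b = c) (sc : s c = b) (sd : s d = d) (tb : t b = 1 - b)
    (ta : t a = d) (td : t d = a) (tc : t c = c)
    (r1 : a * b = c * (a + b - 1)) (r2 : c * b = d * (c + b - 1))
    (hσσ : ∀ x, σ * (σ * x) = (1 + h ^ 2 * (a * (1 - a))) • x)
    (hττ : ∀ x, τ * (τ * x) = (1 + j ^ 2 * (b * (1 - b))) • x)
    (br : altProd σ τ 4 = altProd τ σ 4) :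
    altProd ((h * a) • 1 + σ) ((j * b) • 1 + τ) 4 =
      altProd ((j * b) • 1 + τ) ((h * a) • 1 + σ) 4 := by
  have hσσ1 : σ * σ = (1 + h ^ 2 * (a * (1 - a))) • 1 := by simpa using hσσ 1
  have hττ1 : τ * τ = (1 + j ^ 2 * (b * (1 - b))) • 1 := by simpa using hττ 1
  simp only [altProd, mul_one] at br ⊢
  simp only [mul_add, add_mul, smul_mul_assoc, one_mul, hσ, hτ, smul_add, smul_smul, map_mul,
    map_sub, map_one, map_pow, map_add, sh, th, sj, tj, sa, sb, sc, sd, tb, ta, td, tc,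
    hσσ1, hττ1, mul_one, hσσ, hττ, br]
  match_scalars
  all_goals
    first
      | ring1
      | linear_combination (h*j) * r1 + (h*j) * r2
      | linear_combination ((-1)*h*j) * r1 + ((-1)*h*j) * r2
      | linear_combination (h^2*j*a + (-1)*h^2*j*d) * r1 + (h^2*j*a + (-1)*h^2*j*d) * r2
      | linear_combination ((-1)*h*j^2*b + h*j^2*c) * r1 + ((-1)*h*j^2*b + h*j^2*c) * r2


theorem yangBaxter_4 {K B : Type*} [CommRing K] [Ring B] [Algebra K B]
    (T U : B) (a b c d h j : K)
    (r1 : a * b = c * (a + b - 1)) (r2 : c * b = d * (c + b - 1))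
    (hT : T * T = h • T + 1) (hU : U * U = j • U + 1)
    (br : altProd T U 4 = altProd U T 4) :
    (T - (h * a) • 1) * (U - (j * c) • 1) * (T - (h * d) • 1) *
      (U - (j * b) • 1) =
    (U - (j * b) • 1) * (T - (h * d) • 1) * (U - (j * c) • 1) *
      (T - (h * a) • 1) := by
  have hT' : ∀ x, T * (T * x) = h • (T * x) + x := fun x => by
    rw [← mul_assoc, hT, add_mul, smul_mul_assoc, one_mul]
  have hU' : ∀ x, U * (U * x) = j • (U * x) + x := fun x => by
    rw [← mul_assoc, hU, add_mul, smul_mul_assoc, one_mul]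
  simp only [altProd, mul_one] at br
  simp only [sub_eq_add_neg, ← neg_smul, mul_assoc]
  simp only [mul_add, add_mul, smul_mul_assoc, mul_smul_comm, one_mul, smul_add, smul_smul,
    mul_one, hT, hU, hT', hU', br]
  match_scalars
  all_goals
    first
      | ring1
      | linear_combination (h*j) * r1 + (h*j) * r2
      | linear_combination ((-1)*h*j) * r1 + ((-1)*h*j) * r2


set_option maxHeartbeats 4000000 in
theorem braid_demazure_6 {K A : Type*} [CommRing K] [Ring A] [Module K A] [IsScalarTower K A A]
    (s t : K →+* K) (σ τ : A) (a b c d e f h j : K)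
    (hσ : ∀ (f : K) (x : A), σ * (f • x) = s f • (σ * x))
    (hτ : ∀ (f : K) (x : A), τ * (f • x) = t f • (τ * x))
    (sh : s h = h) (th : t h = h) (sj : s j = j) (tj : t j = j)
    (sa : s a = 1 - a) (sb : s b = c) (sc : s c = b) (sd : s d = d) (se : s e = f)
    (sf : s f = e) (tb : t b = 1 - b) (ta : t a = e) (te : t e = a) (tc : t c = d)
    (td : t d = c) (tf : t f = f)
    (r1 : a * b = c * (a + b - 1)) (r2 : c * b = d * (c + b - 1))
    (r3 : d * b = e * (d + b - 1)) (r4 : e * a = f * (e + a - 1))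
    (r5 : c * d = f * (c + d - 1))
    (hσσ : ∀ x, σ * (σ * x) = (1 + h ^ 2 * (a * (1 - a))) • x)
    (hττ : ∀ x, τ * (τ * x) = (1 + j ^ 2 * (b * (1 - b))) • x)
    (br : altProd σ τ 6 = altProd τ σ 6) :
    altProd ((h * a) • 1 + σ) ((j * b) • 1 + τ) 6 =
      altProd ((j * b) • 1 + τ) ((h * a) • 1 + σ) 6 := by
  have hσσ1 : σ * σ = (1 + h ^ 2 * (a * (1 - a))) • 1 := by simpa using hσσ 1
  have hττ1 : τ * τ = (1 + j ^ 2 * (b * (1 - b))) • 1 := by simpa using hττ 1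
  simp only [altProd, mul_one] at br ⊢
  simp only [mul_add, add_mul, smul_mul_assoc, one_mul, hσ, hτ, smul_add, smul_smul, map_mul,
    map_sub, map_one, map_pow, map_add, sh, th, sj, tj, sa, sb, sc, sd, se, sf, tb, ta, te, tc, td, tf,
    hσσ1, hττ1, mul_one, hσσ, hττ, br]
  match_scalars
  all_goals
    first
      | ring1
      | linear_combination (h*j) * r1 + (h*j) * r2 + (h*j) * r3 + (h*j) * r5
      | linear_combination ((-1)*h*j) * r1 + ((-1)*h*j) * r2 + ((-1)*h*j) * r3 + ((-1)*h*j) * r5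
      | linear_combination (h^2*j*a + (-1)*h^2*j*f) * r1 + (h^2*j*a + (-1)*h^2*j*f) * r2 + (h^2*j*a +
          (-1)*h^2*j*f) * r3 + (h^2*j*a + (-1)*h^2*j*f) * r5
      | linear_combination ((-1)*h*j^2*b + (2)*h*j^2*d + (-1)*h*j^2*f) * r1 + ((-1)*h*j^2*b + h*j^2*d)
          * r2 + ((-1)*h*j^2*a + (-1)*h*j^2*b + h*j^2*d + h*j^2*f) * r3 + ((-1)*h*j^2*b + (-1)*h*j^2*d +
          h*j^2) * r4 + (h*j^2*a + h*j^2*d + (-1)*h*j^2) * r5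
      | linear_combination (h^2*j^2*a*b + (-1)*h^2*j^2*a*c + (-1)*h^2*j^2*b*c + (2)*h^2*j^2*b*d +
          (-1)*h^2*j^2*b*e + (-1)*h^2*j^2*b*f + (-3)*h^2*j^2*c*d + (3)*h^2*j^2*c*f + h^2*j^2*d*e +
          (2)*h^2*j^2*d*f + h^2*j^2*f^2 + h^2*j^2*c + (-1)*h^2*j^2*d + (-3)*h^2*j^2*f) * r1 +
          ((2)*h^2*j^2*a*b + (-2)*h^2*j^2*a*c + (-1)*h^2*j^2*b*c + h^2*j^2*b*d + (-1)*h^2*j^2*b*e +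
          (-1)*h^2*j^2*b*f + (-2)*h^2*j^2*c*d + h^2*j^2*c*f + (-1)*h^2*j^2*d*e + (2)*h^2*j^2*d*f +
          (2)*h^2*j^2*c + h^2*j^2*e + (-1)*h^2*j^2*f + j^2) * r2 + (h^2*j^2*a*c + (-1)*h^2*j^2*a*e +
          (2)*h^2*j^2*a*f + h^2*j^2*b*d + (-1)*h^2*j^2*b*f + (-1)*h^2*j^2*c*d + (2)*h^2*j^2*d*f +
          h^2*j^2*e*f + (-1)*h^2*j^2*f^2 + (-1)*h^2*j^2*a + (-1)*h^2*j^2*d + (-1)*h^2*j^2*f) * r3 +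
          ((-1)*h^2*j^2*b*e + h^2*j^2*b*f + h^2*j^2*c*d + h^2*j^2*c*f + (-1)*h^2*j^2*d*e + (2)*h^2*j^2*d*f
          + (-1)*h^2*j^2*c + (-1)*h^2*j^2*d + h^2*j^2*e + (-2)*h^2*j^2*f + h^2*j^2 + h^2) * r4 +
          ((4)*h^2*j^2*a*b + (-5)*h^2*j^2*a*c + h^2*j^2*a*e + (-2)*h^2*j^2*a*f + (-2)*h^2*j^2*b*c +
          (-2)*h^2*j^2*b*f + (-2)*h^2*j^2*c*d + (-1)*h^2*j^2*c*f + (-2)*h^2*j^2*d*e + (-1)*h^2*j^2*e*f +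
          h^2*j^2*a + (5)*h^2*j^2*c + (2)*h^2*j^2*d + h^2*j^2*e + (3)*h^2*j^2*f + (-1)*h^2*j^2) * r5
      | linear_combination ((-1)*h^2*j^2*a*b + h^2*j^2*a*d + h^2*j^2*b*c + (-2)*h^2*j^2*b*d +
          (2)*h^2*j^2*b*e + (3)*h^2*j^2*c*d + (-4)*h^2*j^2*c*f + h^2*j^2*d^2 + (-2)*h^2*j^2*d*e +
          (-2)*h^2*j^2*f^2 + (-1)*h^2*j^2*d + (4)*h^2*j^2*f) * r1 + ((-2)*h^2*j^2*a*b + h^2*j^2*a*c +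
          h^2*j^2*a*d + h^2*j^2*b*c + (-1)*h^2*j^2*b*d + (2)*h^2*j^2*b*e + (2)*h^2*j^2*c*d +
          (-2)*h^2*j^2*c*f + (2)*h^2*j^2*d*e + (-2)*h^2*j^2*d*f + (-1)*h^2*j^2*c + (-1)*h^2*j^2*d +
          (-2)*h^2*j^2*e + (2)*h^2*j^2*f + (-1)*j^2) * r2 + ((-2)*h^2*j^2*a*c + (2)*h^2*j^2*a*e +
          (-4)*h^2*j^2*a*f + (-1)*h^2*j^2*b*d + h^2*j^2*b*e + (2)*h^2*j^2*c*d + h^2*j^2*d*e +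
          (-2)*h^2*j^2*d*f + (-2)*h^2*j^2*e*f + (2)*h^2*j^2*f^2 + (2)*h^2*j^2*a + (-1)*h^2*j^2*e +
          (2)*h^2*j^2*f) * r3 + ((2)*h^2*j^2*b*e + (-2)*h^2*j^2*b*f + (-2)*h^2*j^2*c*d + (-2)*h^2*j^2*c*f
          + (-1)*h^2*j^2*d^2 + (2)*h^2*j^2*d*e + (-4)*h^2*j^2*d*f + (2)*h^2*j^2*c + (3)*h^2*j^2*d +
          (-2)*h^2*j^2*e + (4)*h^2*j^2*f + (-2)*h^2*j^2 + (-1)*h^2) * r4 + ((-4)*h^2*j^2*a*b +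
          (4)*h^2*j^2*a*c + (2)*h^2*j^2*a*d + (-2)*h^2*j^2*a*e + (4)*h^2*j^2*a*f + (2)*h^2*j^2*b*c +
          (2)*h^2*j^2*b*f + (2)*h^2*j^2*c*d + (4)*h^2*j^2*d*e + (2)*h^2*j^2*e*f + (-2)*h^2*j^2*a +
          (-4)*h^2*j^2*c + (-4)*h^2*j^2*d + (-2)*h^2*j^2*e + (-4)*h^2*j^2*f + (2)*h^2*j^2) * r5
      | linear_combination ((-1)*h^2*j^3*a*b^2 + (2)*h^2*j^3*a*b*c + (-1)*h^2*j^3*a*c^2 +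
          (-1)*h^2*j^3*b^2*c + (2)*h^2*j^3*b^2*e + h^2*j^3*b*c^2 + (-1)*h^2*j^3*b*c*e + h^2*j^3*b*c*f +
          h^2*j^3*b*d*e + (-1)*h^2*j^3*b*d*f + (-2)*h^2*j^3*c^2*f + (-1)*h^2*j^3*c*d*e + h^2*j^3*c*d*f +
          (2)*h^2*j^3*c*e*f + (-2)*h^2*j^3*c*f^2 + h^2*j^3*e*f^2 + (-1)*h^2*j^3*f^3 + (-1)*h^2*j^3*b*c +
          (-2)*h^2*j^3*b*e + h^2*j^3*c^2 + (2)*h^2*j^3*c*f + (-2)*h^2*j^3*e*f + (2)*h^2*j^3*f^2 +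
          (-1)*h^2*j*e + h^2*j*f) * r1 + (h^2*j^3*a*b*e + (-1)*h^2*j^3*a*b*f + (-1)*h^2*j^3*a*c*e +
          h^2*j^3*a*c*f + (-1)*h^2*j^3*b^2*c + (-1)*h^2*j^3*b^2*d + (2)*h^2*j^3*b^2*e + h^2*j^3*b*c^2 +
          (-1)*h^2*j^3*b*c*e + h^2*j^3*b*c*f + (-1)*h^2*j^3*b*d^2 + (2)*h^2*j^3*b*d*e + h^2*j^3*c^2*d +
          (-2)*h^2*j^3*c^2*f + h^2*j^3*c*d^2 + (-1)*h^2*j^3*c*d*e + (-1)*h^2*j^3*c*d*f + h^2*j^3*c*e*f +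
          (-1)*h^2*j^3*c*f^2 + h^2*j^3*d^2*e + (-1)*h^2*j^3*d^2*f + h^2*j^3*d*e*f + (-1)*h^2*j^3*d*f^2 +
          h^2*j^3*b*d + (-3)*h^2*j^3*b*e + (-1)*h^2*j^3*c*d + h^2*j^3*c*e + (2)*h^2*j^3*c*f +
          (-2)*h^2*j^3*d*e + (2)*h^2*j^3*d*f + (-1)*h^2*j^3*e*f + h^2*j^3*f^2 + (-1)*j^3*b + j^3*c +
          h^2*j^3*e + (-1)*h^2*j*e + (-1)*h^2*j^3*f + h^2*j*f) * r2 + ((2)*h^2*j^3*a*e*f +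
          (-2)*h^2*j^3*a*f^2 + (-1)*h^2*j^3*b^2*d + h^2*j^3*b^2*e + (-1)*h^2*j^3*b*d^2 +
          (-1)*h^2*j^3*d^2*f + (-1)*h^2*j^3*d*f^2 + (-2)*h^2*j^3*e*f^2 + h^2*j^3*f^3 + (-1)*h^2*j^3*a*e +
          h^2*j^3*a*f + (2)*h^2*j^3*b*d + (-1)*h^2*j^3*b*e + h^2*j^3*d^2 + (2)*h^2*j^3*d*f + h^2*j^3*e*f +
          h^2*j^3*f^2 + (-1)*h^2*j^3*d + (-1)*h^2*j*e + (-1)*h^2*j^3*f + h^2*j*f) * r3 +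
          ((2)*h^2*j^3*b*e*f + (-1)*h^2*j^3*b*f^2 + (-1)*h^2*j^3*c*f^2 + (2)*h^2*j^3*d*e*f +
          (-2)*h^2*j^3*d*f^2 + (-1)*h^2*j^3*b*e + h^2*j^3*c*f + (-1)*h^2*j^3*d*e + h^2*j^3*d*f +
          (-2)*h^2*j^3*e*f + (2)*h^2*j^3*f^2 + (-1)*h^2*j*b + h^2*j*c + h^2*j^3*e + (-1)*h^2*j^3*f) * r4 +
          ((2)*h^2*j^3*a*b*e + (-2)*h^2*j^3*a*b*f + (-2)*h^2*j^3*a*c*e + (2)*h^2*j^3*a*c*f +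
          (-2)*h^2*j^3*a*e*f + (2)*h^2*j^3*a*f^2 + (-1)*h^2*j^3*b*c*e + h^2*j^3*b*c*f + (-1)*h^2*j^3*b*e*f
          + h^2*j^3*b*f^2 + h^2*j^3*c^2*d + (-1)*h^2*j^3*c^2*f + h^2*j^3*c*d^2 + (-1)*h^2*j^3*c*d*e +
          h^2*j^3*c*d*f + h^2*j^3*d^2*e + h^2*j^3*d*e*f + h^2*j^3*e*f^2 + h^2*j^3*a*e + (-1)*h^2*j^3*a*f +
          (-2)*h^2*j^3*c*d + (2)*h^2*j^3*c*e + (-1)*h^2*j^3*c*f + (-1)*h^2*j^3*d^2 + (-1)*h^2*j^3*d*e +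
          (-1)*h^2*j^3*d*f + (-2)*h^2*j^3*f^2 + h^2*j^3*d + (-1)*h^2*j*e + h^2*j^3*f + h^2*j*f) * r5
      | linear_combination (h^3*j^2*a^2*b + (-1)*h^3*j^2*a^2*c + h^3*j^2*a*b*c + (-3)*h^3*j^2*a*b*e +
          (-1)*h^3*j^2*a*c*e + h^3*j^2*b*c^2 + (-4)*h^3*j^2*b*c*d + (2)*h^3*j^2*b*c*e + (-7)*h^3*j^2*b*c*f
          + (4)*h^3*j^2*b*d^2 + (-5)*h^3*j^2*b*d*e + (7)*h^3*j^2*b*d*f + (3)*h^3*j^2*b*e^2 +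
          (-3)*h^3*j^2*c^2*d + (2)*h^3*j^2*c^2*f + (-4)*h^3*j^2*c*d^2 + (8)*h^3*j^2*c*d*e +
          (-2)*h^3*j^2*c*d*f + (-9)*h^3*j^2*c*e*f + (14)*h^3*j^2*c*f^2 + (4)*h^3*j^2*d^2*e +
          (4)*h^3*j^2*d^2*f + (-3)*h^3*j^2*d*e^2 + (3)*h^3*j^2*d*e*f + (4)*h^3*j^2*d*f^2 +
          (-5)*h^3*j^2*e*f^2 + (7)*h^3*j^2*f^3 + h^3*j^2*a*c + (2)*h^3*j^2*a*e + (3)*h^3*j^2*b*c +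
          (-3)*h^3*j^2*b*d + (6)*h^3*j^2*c*d + (-7)*h^3*j^2*c*f + (-4)*h^3*j^2*d^2 + (-4)*h^3*j^2*d*e +
          (-12)*h^3*j^2*d*f + (8)*h^3*j^2*e*f + (-17)*h^3*j^2*f^2 + h*j^2*c + (3)*h^3*j^2*d + (-2)*h*j^2*d
          + h*j^2*e + (6)*h^3*j^2*f) * r1 + ((4)*h^3*j^2*a*b*d + (-5)*h^3*j^2*a*b*e + (7)*h^3*j^2*a*b*f +
          h^3*j^2*a*c^2 + (-4)*h^3*j^2*a*c*d + (5)*h^3*j^2*a*c*e + (-9)*h^3*j^2*a*c*f + h^3*j^2*b*c^2 +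
          (-3)*h^3*j^2*b*c*d + (2)*h^3*j^2*b*c*e + (-7)*h^3*j^2*b*c*f + h^3*j^2*b*d^2 + (-3)*h^3*j^2*b*d*e
          + (3)*h^3*j^2*b*e^2 + (-2)*h^3*j^2*c^2*d + (2)*h^3*j^2*c^2*f + (-1)*h^3*j^2*c*d^2 +
          h^3*j^2*c*d*e + (-4)*h^3*j^2*c*d*f + (-4)*h^3*j^2*c*e*f + (7)*h^3*j^2*c*f^2 + (-1)*h^3*j^2*d^2*e
          + h^3*j^2*d^2*f + (3)*h^3*j^2*d*e^2 + (-2)*h^3*j^2*d*e*f + (7)*h^3*j^2*d*f^2 + (-3)*h^3*j^2*a*b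
          + (3)*h^3*j^2*a*c + h^3*j^2*a*f + (3)*h^3*j^2*b*c + (-1)*h^3*j^2*c^2 + (8)*h^3*j^2*c*d +
          (-2)*h^3*j^2*c*e + (3)*h^3*j^2*c*f + (-5)*h^3*j^2*d*f + (-3)*h^3*j^2*e^2 + (3)*h^3*j^2*e*f +
          (-7)*h^3*j^2*f^2 + h*j^2*a + (-3)*h^3*j^2*c + h*j^2*c + (-1)*h*j^2*d + (-1)*h*j^2*e +
          (3)*h^3*j^2*f) * r2 + ((4)*h^3*j^2*a*c^2 + (-3)*h^3*j^2*a*c*e + h^3*j^2*a*c*f +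
          (-4)*h^3*j^2*a*d*e + (4)*h^3*j^2*a*d*f + (5)*h^3*j^2*a*e^2 + (-17)*h^3*j^2*a*e*f +
          (14)*h^3*j^2*a*f^2 + h^3*j^2*b*d^2 + (-2)*h^3*j^2*b*d*e + h^3*j^2*b*e^2 + (-4)*h^3*j^2*c^2*d +
          (3)*h^3*j^2*c*d*e + (-1)*h^3*j^2*c*d*f + h^3*j^2*d^2*f + h^3*j^2*d*e^2 + (-1)*h^3*j^2*d*e*f +
          (3)*h^3*j^2*d*f^2 + (-5)*h^3*j^2*e^2*f + (12)*h^3*j^2*e*f^2 + (-7)*h^3*j^2*f^3 +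
          (-3)*h^3*j^2*a*c + (7)*h^3*j^2*a*e + (-8)*h^3*j^2*a*f + (3)*h^3*j^2*c*d + (-1)*h^3*j^2*d^2 +
          h^3*j^2*d*e + (-5)*h^3*j^2*d*f + (-1)*h^3*j^2*e^2 + (2)*h^3*j^2*e*f + (-4)*h^3*j^2*f^2 + h*j^2*a
          + (-1)*h*j^2*d + (3)*h^3*j^2*f) * r3 + ((-1)*h^3*j^2*a*c^2 + (-4)*h^3*j^2*b*d*e +
          (4)*h^3*j^2*b*d*f + (5)*h^3*j^2*b*e^2 + (-12)*h^3*j^2*b*e*f + (7)*h^3*j^2*b*f^2 +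
          (4)*h^3*j^2*c^2*d + (3)*h^3*j^2*c^2*f + (-1)*h^3*j^2*c*d*e + (3)*h^3*j^2*c*d*f +
          (-5)*h^3*j^2*c*e*f + (7)*h^3*j^2*c*f^2 + (-4)*h^3*j^2*d^2*e + (4)*h^3*j^2*d^2*f +
          (5)*h^3*j^2*d*e^2 + (-17)*h^3*j^2*d*e*f + (14)*h^3*j^2*d*f^2 + h^3*j^2*a*c + (3)*h^3*j^2*b*e +
          (-3)*h^3*j^2*b*f + (-3)*h^3*j^2*c^2 + (-5)*h^3*j^2*c*d + (3)*h^3*j^2*c*e + (-9)*h^3*j^2*c*f +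
          (10)*h^3*j^2*d*e + (-13)*h^3*j^2*d*f + (-5)*h^3*j^2*e^2 + (17)*h^3*j^2*e*f + (-14)*h^3*j^2*f^2 +
          h^3*a + (2)*h^3*j^2*c + h*j^2*c + h^3*j^2*d + h*j^2*d + (-6)*h^3*j^2*e + (-1)*h^3*e +
          (9)*h^3*j^2*f + (-1)*h*j^2) * r4 + ((8)*h^3*j^2*a*b*d + (-10)*h^3*j^2*a*b*e + (14)*h^3*j^2*a*b*f
          + (-2)*h^3*j^2*a*c^2 + (-8)*h^3*j^2*a*c*d + (13)*h^3*j^2*a*c*e + (-17)*h^3*j^2*a*c*f +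
          (4)*h^3*j^2*a*d*e + (-4)*h^3*j^2*a*d*f + (-5)*h^3*j^2*a*e^2 + (17)*h^3*j^2*a*e*f +
          (-14)*h^3*j^2*a*f^2 + (-4)*h^3*j^2*b*c*d + (5)*h^3*j^2*b*c*e + (-7)*h^3*j^2*b*c*f +
          (-4)*h^3*j^2*b*d*f + (5)*h^3*j^2*b*e*f + (-7)*h^3*j^2*b*f^2 + (-2)*h^3*j^2*c^2*d +
          (-1)*h^3*j^2*c*d^2 + (-3)*h^3*j^2*c*d*e + (-7)*h^3*j^2*c*d*f + (-3)*h^3*j^2*c*e*f +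
          (-1)*h^3*j^2*d^2*e + (6)*h^3*j^2*d*e^2 + (-7)*h^3*j^2*d*e*f + (5)*h^3*j^2*e^2*f +
          (-7)*h^3*j^2*e*f^2 + (-6)*h^3*j^2*a*b + (8)*h^3*j^2*a*c + (-7)*h^3*j^2*a*e + (9)*h^3*j^2*a*f +
          (3)*h^3*j^2*b*c + (3)*h^3*j^2*b*f + (2)*h^3*j^2*c^2 + (14)*h^3*j^2*c*d + (-6)*h^3*j^2*c*e +
          (17)*h^3*j^2*c*f + h^3*j^2*d^2 + (-2)*h^3*j^2*d*e + (11)*h^3*j^2*d*f + (-3)*h^3*j^2*e^2 +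
          (-4)*h^3*j^2*e*f + (14)*h^3*j^2*f^2 + (-1)*h*j^2*a + (-8)*h^3*j^2*c + h*j^2*c + (-4)*h^3*j^2*d +
          (-1)*h*j^2*d + (3)*h^3*j^2*e + (-1)*h*j^2*e + (-9)*h^3*j^2*f + h*j^2) * r5


theorem yangBaxter_6 {K B : Type*} [CommRing K] [Ring B] [Algebra K B]
    (T U : B) (a b c d e f h j : K)
    (r1 : a * b = c * (a + b - 1)) (r2 : c * b = d * (c + b - 1))
    (r3 : d * b = e * (d + b - 1)) (r4 : e * a = f * (e + a - 1))
    (r5 : c * d = f * (c + d - 1))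
    (hT : T * T = h • T + 1) (hU : U * U = j • U + 1)
    (br : altProd T U 6 = altProd U T 6) :
    (T - (h * a) • 1) * (U - (j * c) • 1) * (T - (h * f) • 1) *
      (U - (j * d) • 1) * (T - (h * e) • 1) * (U - (j * b) • 1) =
    (U - (j * b) • 1) * (T - (h * e) • 1) * (U - (j * d) • 1) *
      (T - (h * f) • 1) * (U - (j * c) • 1) * (T - (h * a) • 1) := by
  have hT' : ∀ x, T * (T * x) = h • (T * x) + x := fun x => by
    rw [← mul_assoc, hT, add_mul, smul_mul_assoc, one_mul]
  have hU' : ∀ x, U * (U * x) = j • (U * x) + x := fun x => by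
    rw [← mul_assoc, hU, add_mul, smul_mul_assoc, one_mul]
  simp only [altProd, mul_one] at br
  simp only [sub_eq_add_neg, ← neg_smul, mul_assoc]
  simp only [mul_add, add_mul, smul_mul_assoc, mul_smul_comm, one_mul, smul_add, smul_smul,
    mul_one, hT, hU, hT', hU', br]
  match_scalars
  all_goals
    first
      | ring1
      | linear_combination (h*j) * r1 + (h*j) * r2 + (h*j) * r3 + (h*j) * r5
      | linear_combination ((-1)*h*j) * r1 + ((-1)*h*j) * r2 + ((-1)*h*j) * r3 + ((-1)*h*j) * r5
      | linear_combination ((-1)*h^2*j^2*c*d + h^2*j^2*c*f + h^2*j^2*d*e + h^2*j^2*e*f +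
          (-1)*h^2*j^2*e + (-1)*h^2*j^2*f) * r1 + ((-1)*h^2*j^2*c*d + h^2*j^2*c*f + h^2*j^2*d*f +
          (-1)*h^2*j^2*f + j^2) * r2 + (h^2*j^2*a*c + h^2*j^2*a*f + (-1)*h^2*j^2*c*d + h^2*j^2*d*f +
          (-1)*h^2*j^2*a + (-1)*h^2*j^2*f) * r3 + (h^2*j^2*c*d + h^2*j^2*c*f + h^2*j^2*d*f +
          (-1)*h^2*j^2*c + (-1)*h^2*j^2*d + (-1)*h^2*j^2*f + h^2*j^2 + h^2) * r4 + ((-1)*h^2*j^2*a*c +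
          (-1)*h^2*j^2*a*f + (-1)*h^2*j^2*c*d + (-1)*h^2*j^2*d*e + (-1)*h^2*j^2*e*f + h^2*j^2*a +
          h^2*j^2*c + h^2*j^2*d + h^2*j^2*e + h^2*j^2*f + (-1)*h^2*j^2) * r5
      | linear_combination (h^2*j^2*c*d + (-1)*h^2*j^2*c*f + (-1)*h^2*j^2*d*e + (-1)*h^2*j^2*e*f +
          h^2*j^2*e + h^2*j^2*f) * r1 + (h^2*j^2*c*d + (-1)*h^2*j^2*c*f + (-1)*h^2*j^2*d*f + h^2*j^2*f +
          (-1)*j^2) * r2 + ((-1)*h^2*j^2*a*c + (-1)*h^2*j^2*a*f + h^2*j^2*c*d + (-1)*h^2*j^2*d*f +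
          h^2*j^2*a + h^2*j^2*f) * r3 + ((-1)*h^2*j^2*c*d + (-1)*h^2*j^2*c*f + (-1)*h^2*j^2*d*f +
          h^2*j^2*c + h^2*j^2*d + h^2*j^2*f + (-1)*h^2*j^2 + (-1)*h^2) * r4 + (h^2*j^2*a*c + h^2*j^2*a*f +
          h^2*j^2*c*d + h^2*j^2*d*e + h^2*j^2*e*f + (-1)*h^2*j^2*a + (-1)*h^2*j^2*c + (-1)*h^2*j^2*d +
          (-1)*h^2*j^2*e + (-1)*h^2*j^2*f + h^2*j^2) * r5

end

namespace DoubleAffine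

/-- The coweight lattice `P^∨` of a root system in a Euclidean space. -/
def coweightLattice {ι V : Type*} [NormedAddCommGroup V] [InnerProductSpace ℝ V]
    (P : RootPairing ι ℝ V V) : AddSubgroup V where
  carrier := {v | ∀ i, ∃ r : ℤ, ⟪v, P.root i⟫ = r}
  zero_mem' := fun i => ⟨0, by simp⟩
  add_mem' := fun {x y} hx hy i => by
    obtain ⟨r, hr⟩ := hx i
    obtain ⟨s, hs⟩ := hy i
    exact ⟨r + s, by rw [inner_add_left, hr, hs]; push_cast; ring⟩
  neg_mem' := fun {x} hx i => by
    obtain ⟨r, hr⟩ := hx i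
    exact ⟨-r, by rw [inner_neg_left, hr]; push_cast; ring⟩

/-- A finite crystallographic reduced irreducible root system in the Euclidean space `V`, whose
long roots have squared length `2`, with a chosen basis. -/
structure RootData (ι V : Type*) [Finite ι] [NormedAddCommGroup V] [InnerProductSpace ℝ V] where
  /-- the roots and the coroots `α^∨ = 2 α / ‖α‖²`, where the dual of `V` is identified with `V`
  by means of the inner product -/
  P : RootPairing ι ℝ V V
  pairing_eq_inner : ∀ x y : V, P.toLinearMap x y = ⟪x, y⟫
  coroot_eq : ∀ i, P.coroot i = (2 / ⟪P.root i, P.root i⟫) • P.root i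
  isRootSystem : P.IsRootSystem
  isCrystallographic : P.IsCrystallographic
  isReduced : P.IsReduced
  isIrreducible : P.IsIrreducible
  norm_le : ∀ i, ⟪P.root i, P.root i⟫ ≤ 2
  exists_norm_eq : ∃ i, ⟪P.root i, P.root i⟫ = 2
  base : P.Base

namespace RootData

attribute [instance] RootData.isRootSystem RootData.isCrystallographic
  RootData.isReduced RootData.isIrreducible

variable {ι V : Type*} [Finite ι] [NormedAddCommGroup V] [InnerProductSpace ℝ V] (D : RootData ι V)

section finiteRoots

theorem pairing_eq (i j : ι) : D.P.pairing i j = ⟪D.P.root i, D.P.coroot j⟫ :=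
  D.pairing_eq_inner _ _

theorem root_sq_pos (i : ι) : 0 < ⟪D.P.root i, D.P.root i⟫ :=
  real_inner_self_pos.2 (D.P.ne_zero i)

theorem reflection_eq (i : ι) (x : V) :
    D.P.reflection i x = x - ⟪x, D.P.coroot i⟫ • D.P.root i := by
  rw [RootPairing.reflection_apply, ← D.pairing_eq_inner]; rfl

theorem reflection_eq' (i : ι) (x : V) :
    D.P.reflection i x = x - (2 * ⟪x, D.P.root i⟫ / ⟪D.P.root i, D.P.root i⟫) • D.P.root i := by
  rw [reflection_eq, coroot_eq, inner_smul_right]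
  congr 2; ring

theorem inner_reflection (i : ι) (x y : V) :
    ⟪D.P.reflection i x, D.P.reflection i y⟫ = ⟪x, y⟫ := by
  have h := (D.root_sq_pos i).ne'
  simp only [reflection_eq', inner_sub_left, inner_sub_right, inner_smul_left, inner_smul_right,
    real_inner_comm (D.P.root i) y, RCLike.conj_to_real]
  field_simp
  ring

theorem exists_highest : ∃ i : ι, ∀ j, D.base.height j ≤ D.base.height i :=
  have : Nonempty ι := ⟨D.exists_norm_eq.choose⟩
  Finite.exists_max D.base.height

/-- The index of the highest root `φ`, the root of largest height. -/
noncomputable def hi : ι := D.exists_highest.choose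

theorem height_le_hi (j : ι) : D.base.height j ≤ D.base.height D.hi :=
  D.exists_highest.choose_spec j

/-- Coordinates of a vector with respect to the simple roots. -/
noncomputable def rco (i : D.base.support) (x : V) : ℝ := D.base.toWeightBasis.repr x i

theorem rco_sum (x : V) : x = ∑ i, D.rco i x • D.P.root i := by
  conv_lhs => rw [← D.base.toWeightBasis.sum_repr x]
  simp [rco]

theorem inner_rco (x y : V) : ⟪x, y⟫ = ∑ i, D.rco i x * ⟪D.P.root i, y⟫ := by
  conv_lhs => rw [D.rco_sum x]
  simp [sum_inner, inner_smul_left]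

theorem rco_add (i) (x y : V) : D.rco i (x + y) = D.rco i x + D.rco i y := by simp [rco]

theorem rco_neg (i) (x : V) : D.rco i (-x) = - D.rco i x := by simp [rco]

theorem rco_smul (i) (r : ℝ) (x : V) : D.rco i (r • x) = r * D.rco i x := by simp [rco]

open Classical in
theorem rco_root (i j : D.base.support) : D.rco i (D.P.root j) = if j = i then 1 else 0 := by
  simp [rco, Finsupp.single_apply]

open Classical in
theorem rco_root_nonneg_or (k : ι) :
    (0 < D.base.height k ∧ ∀ i, 0 ≤ D.rco i (D.P.root k)) ∨
    (D.base.height k < 0 ∧ ∀ i, D.rco i (D.P.root k) ≤ 0) := by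
  obtain ⟨f, -, hf, h⟩ := D.base.exists_root_eq_sum_int k
  have hr : ∀ i : D.base.support, D.rco i (D.P.root k) = f i := by
    intro i
    rw [h, Finset.sum_subtype D.base.support (p := (· ∈ D.base.support)) (by simp)
      (F := inferInstance)]
    simp only [rco, map_sum, Finsupp.finsetSum_apply, ← Int.cast_smul_eq_zsmul ℝ,
      map_smul, RootPairing.Base.toWeightBasis_repr_root, Finsupp.smul_single, smul_eq_mul, mul_one,
      Finsupp.single_apply]
    simp
  have hh := D.base.height_ne_zero k
  have hs := RootPairing.Base.height_eq_sum h
  rcases hf with hf | hf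
  · left
    refine ⟨lt_of_le_of_ne ?_ hh.symm, fun i => by rw [hr]; exact_mod_cast hf.le i⟩
    rw [hs]; exact Finset.sum_nonneg fun i _ => hf.le i
  · right
    refine ⟨lt_of_le_of_ne ?_ hh, fun i => by rw [hr]; exact_mod_cast hf.le i⟩
    rw [hs]; exact Finset.sum_nonpos fun i _ => hf.le i

theorem pairingIn_cast (i j : ι) : ((D.P.pairingIn ℤ i j : ℤ) : ℝ) = D.P.pairing i j := by
  have := D.P.algebraMap_pairingIn ℤ i j
  simpa using this

theorem pairing_pos_iff (i j : ι) :
    0 < D.P.pairingIn ℤ i j ↔ 0 < ⟪D.P.root i, D.P.root j⟫ := by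
  rw [← Int.cast_pos (R := ℝ), pairingIn_cast, pairing_eq, coroot_eq, inner_smul_right]
  exact mul_pos_iff_of_pos_left (div_pos two_pos (D.root_sq_pos j))

theorem height_reflectionPerm (i j : ι) (hj : j ∈ D.base.support) :
    D.base.height (D.P.reflectionPerm j i) = D.base.height i - D.P.pairingIn ℤ i j := by
  have h : D.P.root (D.P.reflectionPerm j i) = D.P.root i + (-D.P.pairingIn ℤ i j) • D.P.root j := by
    rw [RootPairing.root_reflectionPerm, RootPairing.reflection_apply_root, ← pairingIn_cast,
      neg_smul, Int.cast_smul_eq_zsmul, sub_eq_add_neg]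
  rw [D.base.height_add_zsmul h, RootPairing.Base.height_one_of_mem_support hj]
  simp [sub_eq_add_neg]

theorem exists_dominant (Q : ι → Prop) (i₀ : ι) (h₀ : Q i₀)
    (hQ : ∀ i, ∀ j ∈ D.base.support, Q i → D.P.pairingIn ℤ i j < 0 → Q (D.P.reflectionPerm j i)) :
    ∃ i, Q i ∧ ∀ j ∈ D.base.support, 0 ≤ ⟪D.P.root j, D.P.root i⟫ := by
  have : Nonempty {i // Q i} := ⟨⟨i₀, h₀⟩⟩
  obtain ⟨⟨i, hi⟩, hmax⟩ := Finite.exists_max (fun i : {i // Q i} => D.base.height i)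
  refine ⟨i, hi, fun j hj => ?_⟩
  by_contra hneg
  have h1 : D.P.pairingIn ℤ i j < 0 := by
    by_contra h2
    apply hneg
    rcases (not_lt.1 h2).eq_or_lt with h3 | h3
    · have h4 := D.pairingIn_cast i j
      rw [← h3, pairing_eq, coroot_eq, inner_smul_right, real_inner_comm] at h4
      have h5 := (div_pos two_pos (D.root_sq_pos j)).ne'
      rw [Int.cast_zero] at h4
      have := (mul_eq_zero.1 h4.symm).resolve_left h5
      rw [real_inner_comm]; exact this.ge
    · rw [real_inner_comm]; exact ((D.pairing_pos_iff i j).1 h3).le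
  have := hmax ⟨_, hQ i j hj hi h1⟩
  simp only [D.height_reflectionPerm i j hj] at this
  omega

theorem hi_dominant (j : ι) (hj : j ∈ D.base.support) :
    0 ≤ ⟪D.P.root j, D.P.root D.hi⟫ := by
  obtain ⟨i, rfl, h⟩ := D.exists_dominant (fun i => i = D.hi) D.hi rfl (by
    rintro i j hj rfl hlt
    have := D.height_reflectionPerm D.hi j hj
    have := D.height_le_hi (D.P.reflectionPerm j D.hi)
    omega)
  exact h j hj

theorem rco_hi_nonneg (i) : 0 ≤ D.rco i (D.P.root D.hi) := by
  rcases D.rco_root_nonneg_or D.hi with h | h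
  · exact h.2 i
  · exfalso
    have h1 := D.height_le_hi (i : ι)
    rw [RootPairing.Base.height_one_of_mem_support i.2] at h1
    omega

theorem inner_base_nonpos (i j : D.base.support) (h : i ≠ j) :
    ⟪D.P.root i, D.P.root j⟫ ≤ 0 := by
  have := D.base.pairingIn_le_zero_of_ne (fun h' => h (Subtype.ext h')) i.2 j.2
  by_contra h'
  have := (D.pairing_pos_iff i j).2 (not_le.1 h')
  omega

theorem rco_hi_pos (i) : 0 < D.rco i (D.P.root D.hi) := by
  classical
  refine lt_of_le_of_ne (D.rco_hi_nonneg i) fun hi0 => ?_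
  let U : Submodule ℝ V :=
    Submodule.span ℝ {x | ∃ j : D.base.support, D.rco j (D.P.root D.hi) ≠ 0 ∧ x = D.P.root j}
  have horth : ∀ j l : D.base.support, D.rco j (D.P.root D.hi) = 0 →
      D.rco l (D.P.root D.hi) ≠ 0 → ⟪D.P.root l, D.P.root j⟫ = 0 := by
    intro j l hj hl
    have h1 := D.hi_dominant j j.2
    rw [real_inner_comm, D.inner_rco] at h1
    have h2 : ∀ k ∈ Finset.univ, D.rco k (D.P.root D.hi) * ⟪D.P.root k, D.P.root j⟫ ≤ 0 := by
      intro k _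
      by_cases hk : k = j
      · subst hk; simp [hj]
      · exact mul_nonpos_of_nonneg_of_nonpos (D.rco_hi_nonneg k) (D.inner_base_nonpos k j hk)
    have h3 := (Finset.sum_eq_zero_iff_of_nonpos h2).1 (le_antisymm (Finset.sum_nonpos h2) h1) l
      (Finset.mem_univ _)
    exact (mul_eq_zero.1 h3).resolve_left hl
  have hU : ∀ k, U ∈ Module.End.invtSubmodule (D.P.reflection k : V →ₗ[ℝ] V) := by
    refine (D.base.forall_mem_support_invtSubmodule_iff U).1 fun k hk => ?_
    rw [Module.End.mem_invtSubmodule]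
    refine Submodule.span_le.2 ?_
    rintro _ ⟨l, hl, rfl⟩
    simp only [Submodule.comap_coe, Set.mem_preimage, LinearEquiv.coe_coe, SetLike.mem_coe]
    rw [reflection_eq']
    by_cases hk0 : D.rco ⟨k, hk⟩ (D.P.root D.hi) = 0
    · rw [horth ⟨k, hk⟩ l hk0 hl]
      rw [mul_zero, zero_div, zero_smul, sub_zero]
      exact Submodule.subset_span ⟨l, hl, rfl⟩
    · exact U.sub_mem (Submodule.subset_span ⟨l, hl, rfl⟩)
        (U.smul_mem _ (Submodule.subset_span ⟨⟨k, hk⟩, hk0, rfl⟩))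
  have hbot : U ≠ ⊥ := by
    intro hb
    apply D.P.ne_zero D.hi
    rw [D.rco_sum (D.P.root D.hi)]
    refine Finset.sum_eq_zero fun j _ => ?_
    by_cases hj : D.rco j (D.P.root D.hi) = 0
    · simp [hj]
    · have : D.P.root j ∈ U := Submodule.subset_span ⟨j, hj, rfl⟩
      rw [hb, Submodule.mem_bot] at this
      exact absurd this (D.P.ne_zero _)
  have htop := RootPairing.IsIrreducible.eq_top_of_invtSubmodule_reflection U hU hbot
  have h0 : ∀ x ∈ U, D.rco i x = 0 := by
    intro x hx
    refine Submodule.span_induction ?_ ?_ ?_ ?_ hx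
    · rintro _ ⟨j, hj, rfl⟩
      rw [rco_root, if_neg]
      rintro rfl
      exact hj hi0.symm
    · simp [rco]
    · intro x y _ _ h1 h2; rw [rco_add, h1, h2, add_zero]
    · intro r x _ h1; rw [rco_smul, h1, mul_zero]
  have h1 := h0 (D.P.root i) (by rw [htop]; trivial)
  rw [rco_root] at h1
  simp at h1

theorem rco_hi_sub_nonneg (k : ι) (i) : 0 ≤ D.rco i (D.P.root D.hi - D.P.root k) := by
  obtain ⟨l, hl, hd⟩ := D.exists_dominant (fun l => ∀ i, D.rco i (D.P.root k) ≤ D.rco i (D.P.root l))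
    k (fun _ => le_rfl) (by
      intro l j hj hl hlt i
      rw [RootPairing.root_reflectionPerm, RootPairing.reflection_apply_root, ← pairingIn_cast,
        sub_eq_add_neg, rco_add, rco_neg, rco_smul, D.rco_root i ⟨j, hj⟩]
      have h1 := hl i
      have h2 : (D.P.pairingIn ℤ l j : ℝ) < 0 := by exact_mod_cast hlt
      split_ifs <;> linarith)
  suffices h : 0 ≤ D.rco i (D.P.root D.hi - D.P.root l) by
    rw [sub_eq_add_neg, rco_add, rco_neg] at h ⊢
    linarith [hl i]
  by_cases hlh : D.hi = l
  · subst hlh; simp [rco]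
  have hpos : 0 < ⟪D.P.root D.hi, D.P.root l⟫ := by
    have h0 : ∀ j ∈ Finset.univ, 0 ≤ D.rco j (D.P.root D.hi) * ⟪D.P.root j, D.P.root l⟫ :=
      fun j _ => mul_nonneg (D.rco_hi_nonneg j) (hd j j.2)
    rw [D.inner_rco]
    refine lt_of_le_of_ne (Finset.sum_nonneg h0) fun h1 => ?_
    have h2 := (Finset.sum_eq_zero_iff_of_nonneg h0).1 h1.symm
    have h3 : ⟪D.P.root l, D.P.root l⟫ = 0 := by
      rw [D.inner_rco]
      refine Finset.sum_eq_zero fun j hj => ?_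
      rw [(mul_eq_zero.1 (h2 j hj)).resolve_left (D.rco_hi_pos j).ne', mul_zero]
    exact (D.root_sq_pos l).ne' h3
  obtain ⟨n, hn⟩ := D.P.root_sub_root_mem_of_pairingIn_pos ((D.pairing_pos_iff _ _).2 hpos) hlh
  rw [← hn]
  rcases D.rco_root_nonneg_or n with h | h
  · exact h.2 i
  · have h1 := D.base.height_sub hn
    have h2 := D.height_le_hi l
    omega

theorem hi_sq : ⟪D.P.root D.hi, D.P.root D.hi⟫ = 2 := by
  obtain ⟨k, hk⟩ := D.exists_norm_eq
  obtain ⟨l, hl, hd⟩ := D.exists_dominant (fun l => ⟪D.P.root l, D.P.root l⟫ = 2) k hk (by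
    intro i j _ h _
    rw [RootPairing.root_reflectionPerm, inner_reflection, h])
  refine le_antisymm (D.norm_le _) ?_
  have h : ∀ x, (∀ j : D.base.support, 0 ≤ ⟪D.P.root j, x⟫) →
      0 ≤ ⟪D.P.root D.hi - D.P.root l, x⟫ := by
    intro x hx
    rw [D.inner_rco]
    exact Finset.sum_nonneg fun j _ => mul_nonneg (D.rco_hi_sub_nonneg l j) (hx j)
  have h1 := h (D.P.root l) fun j => hd j j.2
  have h2 := h (D.P.root D.hi) fun j => D.hi_dominant j j.2
  rw [inner_sub_left] at h1 h2
  rw [real_inner_comm (D.P.root D.hi) (D.P.root l)] at h2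
  linarith

/-- Since `φ` is long, `φ^∨ = φ`. -/
theorem coroot_hi : D.P.coroot D.hi = D.P.root D.hi := by
  rw [coroot_eq, hi_sq]; norm_num

end finiteRoots

end RootData
end DoubleAffine

namespace DoubleAffine
namespace RootData
variable {ι V : Type*} [Finite ι] [NormedAddCommGroup V] [InnerProductSpace ℝ V] (D : RootData ι V)

section affine

/-- The reflection `s_α` for `α` a root of the finite root system, acting on the space
`ℝ c ⊕ V₀` of affine linear functionals on `V₀`; the pair `(r, v)` stands for `r c + v`. -/
noncomputable def finRefl (i : ι) : (ℝ × V) ≃ₗ[ℝ] (ℝ × V) :=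
  (LinearEquiv.refl ℝ ℝ).prodCongr (D.P.reflection i)

/-- The translation `τ(v) : r c + v' ↦ (r - ⟨v, v'⟩) c + v'`. -/
noncomputable def transl {V : Type*} [NormedAddCommGroup V] [InnerProductSpace ℝ V] (v : V) :
    (ℝ × V) ≃ₗ[ℝ] (ℝ × V) where
  toFun x := (x.1 - ⟪v, x.2⟫, x.2)
  invFun x := (x.1 + ⟪v, x.2⟫, x.2)
  map_add' x y := by ext <;> simp [inner_add_right]; ring
  map_smul' r x := by ext <;> simp [inner_smul_right]; ring
  left_inv x := by simp
  right_inv x := by simp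

theorem finRefl_apply (i : ι) (x : ℝ × V) : D.finRefl i x = (x.1, D.P.reflection i x.2) := rfl

theorem transl_apply (v : V) (x : ℝ × V) : transl v x = (x.1 - ⟪v, x.2⟫, x.2) := rfl

/-- The extended affine Weyl group `W`, generated by the finite Weyl group `W₀` and the translations
over elements of the coweight lattice `P^∨`. -/
noncomputable def W : Subgroup ((ℝ × V) ≃ₗ[ℝ] (ℝ × V)) :=
  Subgroup.closure (Set.range D.finRefl ∪ transl '' (coweightLattice D.P : Set V))

/-- The finite Weyl group `W₀`, as a subgroup of `W`. -/
noncomputable def W₀ : Subgroup D.W := (Subgroup.closure (Set.range D.finRefl)).subgroupOf D.W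

theorem finRefl_mem (i : ι) : D.finRefl i ∈ D.W :=
  Subgroup.subset_closure (Or.inl ⟨i, rfl⟩)

theorem transl_mem {v : V} (hv : v ∈ coweightLattice D.P) : transl v ∈ D.W :=
  Subgroup.subset_closure (Or.inr ⟨v, hv, rfl⟩)

theorem coroot_mem (i : ι) : D.P.coroot i ∈ coweightLattice D.P := fun j =>
  ⟨D.P.pairingIn ℤ j i, by rw [pairingIn_cast, pairing_eq, real_inner_comm]⟩

theorem neg_coroot_mem (i : ι) : -D.P.coroot i ∈ coweightLattice D.P :=
  neg_mem (D.coroot_mem i)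

/-- The twisted affine root system `R = {a^∨ | a ∈ ℤ c + R₀}`, where `a^∨ = 2 a / ‖a‖²` and
`‖r c + v‖ = ‖v‖`. -/
def R : Set (ℝ × V) :=
  {x | ∃ (r : ℤ) (i : ι), x = (2 / ⟪D.P.root i, D.P.root i⟫) • ((r : ℝ), D.P.root i)}

/-- The simple affine roots `a₀ = c - φ^∨` and `a_i = α_i^∨`; the index `0` is `none`. -/
noncomputable def sa : Option D.base.support → ℝ × V
  | none => (1, -D.P.coroot D.hi)
  | some i => (0, D.P.coroot i)

/-- The simple reflections `s₀ = s_φ τ(-φ^∨)` and `s_i`. -/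
noncomputable def sr : Option D.base.support → D.W
  | none => ⟨D.finRefl D.hi, D.finRefl_mem _⟩ *
      ⟨transl (-D.P.coroot D.hi), D.transl_mem (D.neg_coroot_mem _)⟩
  | some i => ⟨D.finRefl i, D.finRefl_mem _⟩

theorem W_induction {p : ((ℝ × V) ≃ₗ[ℝ] (ℝ × V)) → Prop} (h1 : ∀ i, p (D.finRefl i))
    (h2 : ∀ v ∈ coweightLattice D.P, p (transl v)) (h3 : p 1) (h4 : ∀ f g, p f → p g → p (f * g))
    (h5 : ∀ f, p f → p f⁻¹) (w : D.W) : p w.1 := by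
  refine Subgroup.closure_induction ?_ h3 (fun f g _ _ => h4 f g) (fun f _ => h5 f) w.2
  rintro _ (⟨i, rfl⟩ | ⟨v, hv, rfl⟩)
  exacts [h1 i, h2 v hv]

theorem W_inner (w : D.W) : ∀ x y : ℝ × V, ⟪(w.1 x).2, (w.1 y).2⟫ = ⟪x.2, y.2⟫ := by
  refine D.W_induction (p := fun w => ∀ x y : ℝ × V, ⟪(w x).2, (w y).2⟫ = ⟪x.2, y.2⟫)
    ?_ ?_ ?_ ?_ ?_ w
  · intro i x y; exact D.inner_reflection i _ _
  · intro v _ x y; rfl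
  · intro x y; rfl
  · intro f g hf hg x y; exact (hf _ _).trans (hg _ _)
  · intro f hf x y
    rw [← hf]
    change ⟪(f (f.symm x)).2, (f (f.symm y)).2⟫ = _
    simp

theorem W_const (w : D.W) (r : ℝ) : w.1 (r, 0) = (r, 0) := by
  refine D.W_induction (p := fun w => w (r, 0) = (r, 0)) ?_ ?_ ?_ ?_ ?_ w
  · intro i; rw [finRefl_apply]; simp
  · intro v _; rw [transl_apply]; simp
  · rfl
  · intro f g hf hg
    change f (g (r, 0)) = _
    rw [hg, hf]
  · intro f hf
    change f.symm (r, 0) = _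
    rw [LinearEquiv.symm_apply_eq, hf]

theorem W_eq (w : D.W) (x : ℝ × V) :
    w.1 x = (x.1 + (w.1 (0, x.2)).1, (w.1 (0, x.2)).2) := by
  have : x = (x.1, 0) + (0, x.2) := by ext <;> simp
  conv_lhs => rw [this, map_add, W_const]
  ext <;> simp

theorem finRefl_finRefl (i : ι) (x : ℝ × V) : D.finRefl i (D.finRefl i x) = x := by
  simp [finRefl_apply]

theorem R_finRefl {x : ℝ × V} (i : ι) (hx : x ∈ D.R) : D.finRefl i x ∈ D.R := by
  obtain ⟨r, j, rfl⟩ := hx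
  refine ⟨r, D.P.reflectionPerm i j, ?_⟩
  rw [RootPairing.root_reflectionPerm, inner_reflection, map_smul]
  rfl

theorem R_transl {x : ℝ × V} {v : V} (hv : v ∈ coweightLattice D.P) (hx : x ∈ D.R) :
    transl v x ∈ D.R := by
  obtain ⟨r, j, rfl⟩ := hx
  obtain ⟨s, hs⟩ := hv j
  refine ⟨r - s, j, ?_⟩
  rw [map_smul, transl_apply]
  simp [hs]

/-- The affine root system is `W`-invariant. -/
theorem W_mem_R (w : D.W) : ∀ x : ℝ × V, w.1 x ∈ D.R ↔ x ∈ D.R := by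
  refine D.W_induction (p := fun w => ∀ x : ℝ × V, w x ∈ D.R ↔ x ∈ D.R) ?_ ?_ ?_ ?_ ?_ w
  · intro i x
    refine ⟨fun h => ?_, D.R_finRefl i⟩
    have := D.R_finRefl i h
    rwa [finRefl_finRefl] at this
  · intro v hv x
    refine ⟨fun h => ?_, D.R_transl hv⟩
    have := D.R_transl (neg_mem hv) h
    simpa [transl_apply] using this
  · intro x; rfl
  · intro f g hf hg x; exact (hf _).trans (hg _)
  · intro f hf x
    rw [← hf]
    change f (f.symm x) ∈ _ ↔ _
    rw [LinearEquiv.apply_symm_apply]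

/-- The index of the finite root underlying a simple affine root. -/
noncomputable def gi : Option D.base.support → ι
  | none => D.P.reflectionPerm D.hi D.hi
  | some i => i

theorem sa_snd (j) : (D.sa j).2 = D.P.coroot (D.gi j) := by
  cases j with
  | none => simp [sa, gi, D.P.coreflection_apply_self]
  | some i => rfl

theorem sr_apply (j) (x : ℝ × V) :
    (D.sr j).1 x = x - ⟪x.2, D.P.root (D.gi j)⟫ • D.sa j := by
  cases j with
  | none =>
    change D.finRefl D.hi (transl (-D.P.coroot D.hi) x) = _
    rw [transl_apply, finRefl_apply, reflection_eq]
    simp only [gi, sa, coroot_hi, RootPairing.root_reflectionPerm,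
      RootPairing.reflection_apply_self, inner_neg_left, inner_neg_right]
    ext
    · simp [real_inner_comm]
    · simp
  | some i =>
    change D.finRefl i x = _
    rw [finRefl_apply, reflection_eq', gi, sa, coroot_eq]
    ext
    · simp
    · simp only [Prod.snd_sub, Prod.smul_snd, smul_smul]
      congr 2; ring

theorem sa_mem (j) : D.sa j ∈ D.R := by
  cases j with
  | none =>
    refine ⟨1, D.P.reflectionPerm D.hi D.hi, ?_⟩
    have h := D.hi_sq
    rw [real_inner_self_eq_norm_sq] at h
    simp [sa, coroot_hi, h]
  | some i => exact ⟨0, i, by simp [sa, coroot_eq]⟩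

theorem root_gi (j) : D.P.root (D.gi j) = (2 / ⟪(D.sa j).2, (D.sa j).2⟫) • (D.sa j).2 := by
  have h := (D.root_sq_pos (D.gi j)).ne'
  rw [sa_snd, coroot_eq, inner_smul_left, inner_smul_right, smul_smul]
  simp only [RCLike.conj_to_real]
  field_simp
  simp

/-- The simple reflection `s_j` is the orthogonal reflection in the affine root `a_j`. -/
theorem sr_apply' (j) (x : ℝ × V) :
    (D.sr j).1 x = x - (2 * ⟪x.2, (D.sa j).2⟫ / ⟪(D.sa j).2, (D.sa j).2⟫) • D.sa j := by
  rw [sr_apply, root_gi, inner_smul_right]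
  congr 2; ring

/-- Minus the Cartan integers of the affine root system. -/
noncomputable def cart (i j : Option D.base.support) : ℤ := -D.P.pairingIn ℤ (D.gi i) (D.gi j)

theorem cart_cast (i j) : (D.cart i j : ℝ) = - ⟪(D.sa j).2, D.P.root (D.gi i)⟫ := by
  rw [cart, Int.cast_neg, pairingIn_cast, pairing_eq, sa_snd, real_inner_comm]

theorem sr_sa (i j) : (D.sr i).1 (D.sa j) = D.sa j + (D.cart i j : ℝ) • D.sa i := by
  rw [sr_apply, cart_cast, neg_smul, sub_eq_add_neg]

theorem cart_self (i) : D.cart i i = -2 := by simp [cart]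

theorem sr_sa_self (i) : (D.sr i).1 (D.sa i) = - D.sa i := by
  rw [sr_sa, cart_self]; push_cast; module

theorem sr_sr_apply (i) (x : ℝ × V) : (D.sr i).1 ((D.sr i).1 x) = x := by
  conv_lhs => rw [D.sr_apply i x]
  rw [map_sub, map_smul, sr_sa_self, sr_apply]
  module

theorem W_ext {v w : D.W} (h : ∀ x, v.1 x = w.1 x) : v = w :=
  Subtype.ext (LinearEquiv.ext h)

theorem sr_mul_self (i) : D.sr i * D.sr i = 1 := D.W_ext (D.sr_sr_apply i)

theorem sr_inv (i) : (D.sr i)⁻¹ = D.sr i := inv_eq_of_mul_eq_one_left (D.sr_mul_self i)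

/-- Coordinates with respect to the simple affine roots. -/
noncomputable def co : Option D.base.support → (ℝ × V) → ℝ
  | none, x => x.1
  | some i, x => D.rco i (x.2 + x.1 • D.P.coroot D.hi) * (⟪D.P.root i, D.P.root i⟫ / 2)

theorem co_add (j) (x y) : D.co j (x + y) = D.co j x + D.co j y := by
  cases j with
  | none => rfl
  | some i => simp only [co, ← add_mul, ← rco_add]; congr 2; simp only [Prod.fst_add, Prod.snd_add]; module

theorem co_smul (j) (r : ℝ) (x) : D.co j (r • x) = r * D.co j x := by
  cases j with
  | none => rfl
  | some i =>
    simp only [co, ← mul_assoc, ← rco_smul]; congr 2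
    simp only [Prod.smul_fst, Prod.smul_snd, smul_eq_mul]; module

theorem co_neg (j) (x) : D.co j (-x) = - D.co j x := by
  rw [← neg_one_smul ℝ, co_smul]; ring

theorem co_sub (j) (x y) : D.co j (x - y) = D.co j x - D.co j y := by
  rw [sub_eq_add_neg, co_add, co_neg]; ring

theorem co_zero (j) : D.co j 0 = 0 := by
  have := D.co_smul j 0 0
  simpa using this

open Classical in
theorem co_sa (i j) : D.co i (D.sa j) = if j = i then 1 else 0 := by
  cases i with
  | none => cases j <;> simp [co, sa]
  | some i =>
    cases j with
    | none => simp [co, sa, rco]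
    | some j =>
      have h := (D.root_sq_pos i).ne'
      simp only [co, sa, zero_smul, add_zero, coroot_eq, rco_smul, rco_root, Option.some.injEq]
      split_ifs with hij
      · subst hij; field_simp
      · simp

theorem co_sum (x : ℝ × V) : x = ∑ j, D.co j x • D.sa j := by
  rw [Fintype.sum_option]
  have : ∀ i : D.base.support, D.co (some i) x • D.sa (some i) =
      (0, D.rco i (x.2 + x.1 • D.P.coroot D.hi) • D.P.root i) := by
    intro i
    have h := (D.root_sq_pos i).ne'
    simp only [co, sa, coroot_eq, Prod.smul_mk, smul_zero, smul_smul]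
    congr 2
    field_simp
  simp only [this]
  have h2 := D.rco_sum (x.2 + x.1 • D.P.coroot D.hi)
  ext
  · simp [co, sa, Prod.fst_sum]
  · rw [Prod.snd_add, Prod.snd_sum, ← h2]
    simp [co, sa]

theorem co_ext {x y : ℝ × V} (h : ∀ j, D.co j x = D.co j y) : x = y := by
  rw [D.co_sum x, D.co_sum y]
  simp only [h]

theorem R_pos_or {x : ℝ × V} (hx : x ∈ D.R) : (∀ j, 0 ≤ D.co j x) ∨ (∀ j, 0 ≤ D.co j (-x)) := by
  have key : ∀ (r : ℤ) (i : ι), 0 < r → ∀ j, 0 ≤ D.co j ((r : ℝ), D.P.root i) := by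
    intro r i hr j
    have hr1 : (1 : ℝ) ≤ r := by exact_mod_cast hr
    cases j with
    | none => simp only [co]; linarith
    | some j =>
      refine mul_nonneg ?_ (div_nonneg (D.root_sq_pos j).le two_pos.le)
      have h1 := D.rco_hi_sub_nonneg (D.P.reflectionPerm i i) j
      simp only [RootPairing.root_reflectionPerm, RootPairing.reflection_apply_self, sub_neg_eq_add,
        rco_add] at h1
      rw [rco_add, rco_smul, coroot_hi]
      nlinarith [D.rco_hi_nonneg j]
  obtain ⟨r, i, rfl⟩ := hx
  have hn : 0 < 2 / ⟪D.P.root i, D.P.root i⟫ := div_pos two_pos (D.root_sq_pos i)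
  simp only [← smul_neg, co_smul]
  rcases lt_trichotomy r 0 with hr | rfl | hr
  · right
    intro j
    have := key (-r) (D.P.reflectionPerm i i) (by omega) j
    refine mul_nonneg hn.le ?_
    simpa using this
  · rcases D.rco_root_nonneg_or i with h | h
    · left
      intro j
      refine mul_nonneg hn.le ?_
      cases j with
      | none => simp [co]
      | some j => simpa [co] using mul_nonneg (h.2 j) (div_nonneg (D.root_sq_pos j).le two_pos.le)
    · right
      intro j
      refine mul_nonneg hn.le ?_
      cases j with
      | none => simp [co]
      | some j =>
        simpa [co, rco_neg] using
          mul_nonneg (neg_nonneg.2 (h.2 j)) (div_nonneg (D.root_sq_pos j).le two_pos.le)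
  · left
    intro j
    exact mul_nonneg hn.le (key r i hr j)

theorem neg_mem_R {x : ℝ × V} (hx : x ∈ D.R) : -x ∈ D.R := by
  obtain ⟨r, i, rfl⟩ := hx
  exact ⟨-r, D.P.reflectionPerm i i, by simp⟩

theorem R_snd {x : ℝ × V} (hx : x ∈ D.R) : ∃ i, x.2 = D.P.coroot i := by
  obtain ⟨r, i, rfl⟩ := hx
  exact ⟨i, by rw [coroot_eq]; rfl⟩

theorem R_ne_zero {x : ℝ × V} (hx : x ∈ D.R) : x ≠ 0 := by
  obtain ⟨i, hi⟩ := D.R_snd hx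
  rintro rfl
  exact D.P.flip.ne_zero i hi.symm

/-- The affine root system is reduced. -/
theorem R_reduced {x y : ℝ × V} (hx : x ∈ D.R) (hy : y ∈ D.R) {t : ℝ} (ht : 0 < t)
    (h : x = t • y) : x = y := by
  obtain ⟨i, hi⟩ := D.R_snd hx
  obtain ⟨j, hj⟩ := D.R_snd hy
  have h2 : D.P.coroot i = t • D.P.coroot j := by rw [← hi, ← hj, h]; rfl
  have hni := (D.root_sq_pos i).ne'
  have hnj := (D.root_sq_pos j).ne'
  have hr : D.P.root i = (t * ⟪D.P.root i, D.P.root i⟫ / ⟪D.P.root j, D.P.root j⟫) • D.P.root j := by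
    rw [coroot_eq, coroot_eq] at h2
    have h3 := congrArg (fun z => (⟪D.P.root i, D.P.root i⟫ / 2) • z) h2
    simp only [smul_smul] at h3
    rw [show ⟪D.P.root i, D.P.root i⟫ / 2 * (2 / ⟪D.P.root i, D.P.root i⟫) = 1 by field_simp,
      one_smul] at h3
    conv_lhs => rw [h3]
    congr 1
    field_simp
  have hdep : ¬ LinearIndependent ℝ ![D.P.root i, D.P.root j] := by
    rw [LinearIndependent.pair_iff]
    intro hl
    have := hl 1 (-(t * ⟪D.P.root i, D.P.root i⟫ / ⟪D.P.root j, D.P.root j⟫))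
      (by rw [one_smul, neg_smul, ← hr, add_neg_cancel])
    exact one_ne_zero this.1
  have hpos : 0 < t * ⟪D.P.root i, D.P.root i⟫ / ⟪D.P.root j, D.P.root j⟫ :=
    div_pos (mul_pos ht (D.root_sq_pos i)) (D.root_sq_pos j)
  have hone : ∀ u : ℝ, D.P.coroot j = u • D.P.coroot j → u = 1 := by
    intro u hu
    have h3 : (1 - u) • D.P.coroot j = 0 := by rw [sub_smul, one_smul, ← hu, sub_self]
    rcases smul_eq_zero.1 h3 with h4 | h4
    · linarith
    · exact absurd h4 (D.P.flip.ne_zero j)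
  rcases RootPairing.IsReduced.eq_or_eq_neg i j hdep with he | he
  · have hij : i = j := D.P.root.injective he
    subst hij
    rw [h, hone t h2, one_smul]
  · exfalso
    rw [he] at hr
    have h3 : (1 + t * ⟪-D.P.root j, -D.P.root j⟫ / ⟪D.P.root j, D.P.root j⟫) • D.P.root j = 0 := by
      rw [add_smul, one_smul, ← hr, add_neg_cancel]
    rcases smul_eq_zero.1 h3 with h4 | h4
    · rw [he] at hpos; linarith
    · exact D.P.ne_zero j h4

end affine
end RootData
end DoubleAffine

namespace DoubleAffine
namespace RootData
variable {ι V : Type*} [Finite ι] [NormedAddCommGroup V] [InnerProductSpace ℝ V] (D : RootData ι V)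

section rankTwo

theorem cart_cases {i j : Option D.base.support} (h : i ≠ j) :
    (D.cart i j, D.cart j i) ∈
      ({(0, 0), (1, 1), (1, 2), (2, 1), (1, 3), (3, 1), (2, 2)} : Set (ℤ × ℤ)) := by
  have h1 := D.P.pairingIn_pairingIn_mem_set_of_isCrystal_of_isRed (D.gi i) (D.gi j)
  have h2 : ∀ l m : Option D.base.support, l ≠ m → ⟪D.P.root (D.gi l), D.P.root (D.gi m)⟫ ≤ 0 := by
    intro l m hlm
    rcases l with _ | l <;> rcases m with _ | m
    · exact absurd rfl hlm
    · simpa [gi, real_inner_comm] using D.hi_dominant m m.2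
    · simpa [gi] using D.hi_dominant l l.2
    · exact D.inner_base_nonpos l m (fun h' => hlm (by rw [h']))
  have h3 : ¬ 0 < D.P.pairingIn ℤ (D.gi i) (D.gi j) := fun h' =>
    absurd ((D.pairing_pos_iff _ _).1 h') (not_lt.2 (h2 i j h))
  have h4 : D.cart i j = -D.P.pairingIn ℤ (D.gi i) (D.gi j) := rfl
  have h5 : D.cart j i = -D.P.pairingIn ℤ (D.gi j) (D.gi i) := rfl
  generalize D.P.pairingIn ℤ (D.gi i) (D.gi j) = p at *
  generalize D.P.pairingIn ℤ (D.gi j) (D.gi i) = p' at *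
  simp only [Set.mem_insert_iff, Set.mem_singleton_iff, Prod.mk.injEq] at h1 ⊢
  omega

theorem sr_comb (i j) (x : ℝ × V) (u v : ℝ) :
    (D.sr i).1 (x + u • D.sa i + v • D.sa j) =
      x + (-u - ⟪x.2, D.P.root (D.gi i)⟫ + D.cart i j * v) • D.sa i + v • D.sa j := by
  rw [map_add, map_add, map_smul, map_smul, sr_sa_self, sr_sa, sr_apply]
  module

theorem sr_comb' (i j) (x : ℝ × V) (u v : ℝ) :
    (D.sr i).1 (x + v • D.sa j + u • D.sa i) =
      x + v • D.sa j + (-u - ⟪x.2, D.P.root (D.gi i)⟫ + D.cart i j * v) • D.sa i := by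
  rw [map_add, map_add, map_smul, map_smul, sr_sa_self, sr_sa, sr_apply]
  module

theorem W_mul_apply (v w : D.W) (x : ℝ × V) : (v * w).1 x = v.1 (w.1 x) := rfl

theorem W_one_apply (x : ℝ × V) : (1 : D.W).1 x = x := rfl

theorem sr_braid_aux (i j : Option D.base.support) (m : ℕ)
    (h : (D.cart i j, D.cart j i, m) ∈ ({(0, 0, 2), (1, 1, 3), (1, 2, 4), (2, 1, 4), (1, 3, 6),
      (3, 1, 6)} : Set (ℤ × ℤ × ℕ))) :
    altProd (D.sr i) (D.sr j) m = altProd (D.sr j) (D.sr i) m := by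
  refine D.W_ext fun x => ?_
  have hx : x = x + (0 : ℝ) • D.sa i + (0 : ℝ) • D.sa j := by module
  rw [hx]
  simp only [Set.mem_insert_iff, Set.mem_singleton_iff, Prod.mk.injEq] at h
  rcases h with ⟨h1, h2, rfl⟩ | ⟨h1, h2, rfl⟩ | ⟨h1, h2, rfl⟩ | ⟨h1, h2, rfl⟩ | ⟨h1, h2, rfl⟩ |
    ⟨h1, h2, rfl⟩ <;>
  · simp only [altProd, W_mul_apply, W_one_apply, sr_comb, sr_comb' _ j i, h1, h2]
    module

theorem sr_step (i j) (u v : ℝ) :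
    (D.sr i * D.sr j).1 (u • D.sa i + v • D.sa j) =
      (-u + D.cart i j * (-v + D.cart j i * u)) • D.sa i + (-v + D.cart j i * u) • D.sa j := by
  simp only [W_mul_apply, map_add, map_smul, map_neg, sr_sa_self, sr_sa]
  module

theorem sa_comb_inj {i j : Option D.base.support} (h : i ≠ j) {u v u' v' : ℝ}
    (h1 : u • D.sa i + v • D.sa j = u' • D.sa i + v' • D.sa j) : u = u' ∧ v = v' := by
  have h2 := congrArg (D.co i) h1
  have h3 := congrArg (D.co j) h1
  simp only [co_add, co_smul, co_sa, if_neg h, if_neg h.symm, if_true] at h2 h3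
  constructor <;> linarith

theorem pow_ne_one_of {i j : Option D.base.support} (h : i ≠ j) (n : ℕ) {u v : ℝ}
    (huv : ((D.sr i * D.sr j) ^ n).1 ((1 : ℝ) • D.sa i + (0 : ℝ) • D.sa j) =
      u • D.sa i + v • D.sa j) (hne : ¬ (u = 1 ∧ v = 0)) : (D.sr i * D.sr j) ^ n ≠ 1 := by
  intro h1
  rw [h1, W_one_apply] at huv
  have := D.sa_comb_inj h huv
  exact hne ⟨this.1.symm, this.2.symm⟩

theorem pow_one_apply (w : D.W) (x) : (w ^ 1).1 x = w.1 x := by rw [pow_one]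

theorem pow_two_apply (w : D.W) (x) : (w ^ 2).1 x = w.1 (w.1 x) := by rw [pow_two]; rfl

theorem pow_three_apply (w : D.W) (x) : (w ^ 3).1 x = w.1 (w.1 (w.1 x)) := by
  rw [pow_succ, pow_two]; rfl

theorem pow_eq_one_of_braid (i j : Option D.base.support) (m : ℕ)
    (h : (D.cart i j, D.cart j i, m) ∈ ({(0, 0, 2), (1, 1, 3), (1, 2, 4), (2, 1, 4), (1, 3, 6),
      (3, 1, 6)} : Set (ℤ × ℤ × ℕ))) : (D.sr i * D.sr j) ^ m = 1 := by
  refine D.W_ext fun x => ?_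
  have hx : x = x + (0 : ℝ) • D.sa i + (0 : ℝ) • D.sa j := by module
  rw [hx]
  simp only [Set.mem_insert_iff, Set.mem_singleton_iff, Prod.mk.injEq] at h
  rcases h with ⟨h1, h2, rfl⟩ | ⟨h1, h2, rfl⟩ | ⟨h1, h2, rfl⟩ | ⟨h1, h2, rfl⟩ | ⟨h1, h2, rfl⟩ |
    ⟨h1, h2, rfl⟩ <;>
  · simp only [pow_succ, pow_zero, one_mul, W_mul_apply, W_one_apply, sr_comb, sr_comb' _ j i, h1,
      h2]
    module

/-- The order of `s_i s_j` in terms of the Cartan integers. -/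
theorem orderOf_sr {i j : Option D.base.support} (h : i ≠ j) :
    (D.cart i j, D.cart j i, orderOf (D.sr i * D.sr j)) ∈
      ({(0, 0, 2), (1, 1, 3), (1, 2, 4), (2, 1, 4), (1, 3, 6), (3, 1, 6), (2, 2, 0)} :
        Set (ℤ × ℤ × ℕ)) := by
  have hc := D.cart_cases h
  have hp := D.pow_eq_one_of_braid i j
  have hne := fun n u v => D.pow_ne_one_of h n (u := u) (v := v)
  simp only [Set.mem_insert_iff, Set.mem_singleton_iff, Prod.mk.injEq] at hc hp ⊢
  have step := D.sr_step i j
  rcases hc with ⟨h1, h2⟩ | ⟨h1, h2⟩ | ⟨h1, h2⟩ | ⟨h1, h2⟩ | ⟨h1, h2⟩ | ⟨h1, h2⟩ | ⟨h1, h2⟩ <;>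
    simp only [h1, h2] at hp step ⊢
  · have : orderOf (D.sr i * D.sr j) = 2 := by
      refine orderOf_eq_of_pow_and_pow_div_prime two_pos (hp 2 (by norm_num)) ?_
      intro p hpr hd
      have hp2 : p = 2 := (Nat.prime_dvd_prime_iff_eq hpr Nat.prime_two).1 hd
      subst hp2
      exact hne 1 _ _ ((D.pow_one_apply _ _).trans (step _ _)) (by norm_num)
    simp [this]
  · have : orderOf (D.sr i * D.sr j) = 3 := by
      refine orderOf_eq_of_pow_and_pow_div_prime three_pos (hp 3 (by norm_num)) ?_
      intro p hpr hd
      have hp2 : p = 3 := (Nat.prime_dvd_prime_iff_eq hpr Nat.prime_three).1 hd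
      subst hp2
      exact hne 1 _ _ ((D.pow_one_apply _ _).trans (step _ _)) (by norm_num)
    simp [this]
  · have : orderOf (D.sr i * D.sr j) = 4 := by
      refine orderOf_eq_of_pow_and_pow_div_prime (by norm_num) (hp 4 (by norm_num)) ?_
      intro p hpr hd
      have hp2 : p = 2 := (Nat.prime_dvd_prime_iff_eq hpr Nat.prime_two).1
        (hpr.dvd_of_dvd_pow (show p ∣ 2 ^ 2 by simpa using hd))
      subst hp2
      exact hne 2 _ _ ((D.pow_two_apply _ _).trans (by rw [step, step])) (by norm_num)
    simp [this]
  · have : orderOf (D.sr i * D.sr j) = 4 := by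
      refine orderOf_eq_of_pow_and_pow_div_prime (by norm_num) (hp 4 (by norm_num)) ?_
      intro p hpr hd
      have hp2 : p = 2 := (Nat.prime_dvd_prime_iff_eq hpr Nat.prime_two).1
        (hpr.dvd_of_dvd_pow (show p ∣ 2 ^ 2 by simpa using hd))
      subst hp2
      exact hne 2 _ _ ((D.pow_two_apply _ _).trans (by rw [step, step])) (by norm_num)
    simp [this]
  · have : orderOf (D.sr i * D.sr j) = 6 := by
      refine orderOf_eq_of_pow_and_pow_div_prime (by norm_num) (hp 6 (by norm_num)) ?_
      intro p hpr hd
      have hp2 : p = 2 ∨ p = 3 := by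
        rcases (hpr.dvd_mul).1 (show p ∣ 2 * 3 from hd) with h | h
        · exact Or.inl ((Nat.prime_dvd_prime_iff_eq hpr Nat.prime_two).1 h)
        · exact Or.inr ((Nat.prime_dvd_prime_iff_eq hpr Nat.prime_three).1 h)
      rcases hp2 with rfl | rfl
      · exact hne 3 _ _ ((D.pow_three_apply _ _).trans (by rw [step, step, step])) (by norm_num)
      · exact hne 2 _ _ ((D.pow_two_apply _ _).trans (by rw [step, step])) (by norm_num)
    simp [this]
  · have : orderOf (D.sr i * D.sr j) = 6 := by
      refine orderOf_eq_of_pow_and_pow_div_prime (by norm_num) (hp 6 (by norm_num)) ?_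
      intro p hpr hd
      have hp2 : p = 2 ∨ p = 3 := by
        rcases (hpr.dvd_mul).1 (show p ∣ 2 * 3 from hd) with h | h
        · exact Or.inl ((Nat.prime_dvd_prime_iff_eq hpr Nat.prime_two).1 h)
        · exact Or.inr ((Nat.prime_dvd_prime_iff_eq hpr Nat.prime_three).1 h)
      rcases hp2 with rfl | rfl
      · exact hne 3 _ _ ((D.pow_three_apply _ _).trans (by rw [step, step, step])) (by norm_num)
      · exact hne 2 _ _ ((D.pow_two_apply _ _).trans (by rw [step, step])) (by norm_num)
    simp [this]
  · have : orderOf (D.sr i * D.sr j) = 0 := by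
      rw [orderOf_eq_zero_iff']
      intro n hn
      have key : ∀ n : ℕ, ((D.sr i * D.sr j) ^ n).1 ((1 : ℝ) • D.sa i + (0 : ℝ) • D.sa j) =
          (2 * n + 1 : ℝ) • D.sa i + (2 * n : ℝ) • D.sa j := by
        intro n
        induction n with
        | zero => simp
        | succ n ih =>
          rw [pow_succ', W_mul_apply, ih, step]
          push_cast; module
      refine hne n _ _ (key n) ?_
      rintro ⟨_, h⟩
      have : (0 : ℝ) < n := by exact_mod_cast hn
      linarith
    simp [this]

end rankTwo
end RootData
end DoubleAffine

namespace DoubleAffine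
namespace RootData
variable {ι V : Type*} [Finite ι] [NormedAddCommGroup V] [InnerProductSpace ℝ V] (D : RootData ι V)

section length

/-- The positive affine roots: the elements of `R` that are nonnegative combinations of the simple
affine roots. -/
def Pos (a : ℝ × V) : Prop :=
  a ∈ D.R ∧ ∃ c : Option D.base.support → ℝ, (∀ j, 0 ≤ c j) ∧ a = ∑ j, c j • D.sa j

theorem co_finsum (j) (c : Option D.base.support → ℝ) : D.co j (∑ l, c l • D.sa l) = c j := by
  classical
  have : ∀ s : Finset (Option D.base.support),
      D.co j (∑ l ∈ s, c l • D.sa l) = ∑ l ∈ s, c l * D.co j (D.sa l) := by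
    intro s
    induction s using Finset.induction_on with
    | empty => simp [co_zero]
    | insert l s hl ih => rw [Finset.sum_insert hl, Finset.sum_insert hl, co_add, co_smul, ih]
  rw [this]
  simp [co_sa]

theorem pos_iff {a : ℝ × V} : D.Pos a ↔ a ∈ D.R ∧ ∀ j, 0 ≤ D.co j a := by
  refine and_congr_right fun _ => ⟨?_, fun h => ⟨fun j => D.co j a, h, D.co_sum a⟩⟩
  rintro ⟨c, hc, rfl⟩ j
  rw [co_finsum]; exact hc j

theorem sa_pos (i) : D.Pos (D.sa i) := by
  classical
  refine D.pos_iff.2 ⟨D.sa_mem i, fun j => ?_⟩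
  rw [co_sa]; split_ifs <;> norm_num

theorem pos_or {a : ℝ × V} (ha : a ∈ D.R) : D.Pos a ∨ D.Pos (-a) := by
  rcases D.R_pos_or ha with h | h
  · exact Or.inl (D.pos_iff.2 ⟨ha, h⟩)
  · exact Or.inr (D.pos_iff.2 ⟨D.neg_mem_R ha, h⟩)

theorem not_pos_neg {a : ℝ × V} (ha : D.Pos a) : ¬ D.Pos (-a) := by
  intro h
  rw [pos_iff] at ha h
  refine D.R_ne_zero ha.1 (D.co_ext fun j => ?_)
  have h1 := ha.2 j
  have h2 := h.2 j
  rw [co_neg] at h2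
  rw [co_zero]; linarith

theorem sr_pos {a : ℝ × V} (i) (ha : D.Pos a) (hne : a ≠ D.sa i) : D.Pos ((D.sr i).1 a) := by
  rcases D.pos_or ((D.W_mem_R (D.sr i) a).2 ha.1) with h | h
  · exact h
  exfalso
  have ha' := D.pos_iff.1 ha
  have h' := D.pos_iff.1 h
  have h0 : ∀ j, j ≠ i → D.co j a = 0 := by
    intro j hj
    have h1 := h'.2 j
    have h2 := ha'.2 j
    rw [sr_apply, co_neg, co_sub, co_smul, co_sa, if_neg hj.symm] at h1
    linarith
  have h1 : a = D.co i a • D.sa i := by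
    refine D.co_ext fun j => ?_
    rw [co_smul, co_sa]
    split_ifs with hj
    · rw [hj, mul_one]
    · rw [mul_zero]; exact h0 j (Ne.symm hj)
  have h2 : 0 < D.co i a := by
    refine lt_of_le_of_ne (ha'.2 i) fun h3 => ?_
    rw [← h3, zero_smul] at h1
    exact D.R_ne_zero ha.1 h1
  exact hne (D.R_reduced ha.1 (D.sa_mem i) h2 h1)

/-- The set `R⁺ ∩ w⁻¹ R⁻` of positive affine roots sent to negative affine roots by `w`. -/
def inversions (w : D.W) : Set (ℝ × V) := {a | D.Pos a ∧ D.Pos (-(w.1 a))}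

theorem inversions_finite (w : D.W) : (D.inversions w).Finite := by
  refine Set.Finite.subset (Set.finite_iUnion fun i : ι =>
    (Set.finite_Icc (0 : ℤ) ⌊-(w.1 (0, D.P.root i)).1⌋).image
      fun r : ℤ => (2 / ⟪D.P.root i, D.P.root i⟫) • ((r : ℝ), D.P.root i)) ?_
  rintro a ⟨h1, h2⟩
  obtain ⟨r, i, rfl⟩ := h1.1
  have hn : 0 < 2 / ⟪D.P.root i, D.P.root i⟫ := div_pos two_pos (D.root_sq_pos i)
  have h3 := (D.pos_iff.1 h1).2 none
  have h4 := (D.pos_iff.1 h2).2 none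
  rw [map_smul, W_eq] at h4
  simp only [co, Prod.fst_neg, Prod.smul_fst, smul_eq_mul] at h3 h4
  have h5 : 0 ≤ (r : ℝ) := by
    by_contra h; push Not at h; nlinarith
  have h6 : (r : ℝ) + (w.1 (0, D.P.root i)).1 ≤ 0 := by
    by_contra h; push Not at h; nlinarith
  refine Set.mem_iUnion.2 ⟨i, r, ⟨by exact_mod_cast h5, Int.le_floor.2 (by linarith)⟩, rfl⟩

/-- The length function `l(w) = #(R⁺ ∩ w⁻¹ R⁻)` on `W`. -/
noncomputable def length (w : D.W) : ℕ := (D.inversions w).ncard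

theorem length_descent {w : D.W} {i} (h : ∀ j, D.co j (w.1 (D.sa i)) ≤ 0) :
    D.length w = D.length (w * D.sr i) + 1 := by
  have hneg : D.Pos (-(w.1 (D.sa i))) := by
    refine D.pos_iff.2 ⟨D.neg_mem_R ((D.W_mem_R w _).2 (D.sa_mem i)), fun j => ?_⟩
    rw [co_neg]; linarith [h j]
  have hne : ∀ b ∈ D.inversions (w * D.sr i), b ≠ D.sa i := by
    rintro b ⟨_, hb⟩ rfl
    rw [W_mul_apply, sr_sa_self, map_neg] at hb
    exact D.not_pos_neg hneg hb
  have heq : D.inversions w = insert (D.sa i) ((D.sr i).1 '' D.inversions (w * D.sr i)) := by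
    ext a
    simp only [Set.mem_insert_iff, Set.mem_image]
    constructor
    · rintro ⟨h1, h2⟩
      by_cases ha : a = D.sa i
      · exact Or.inl ha
      · refine Or.inr ⟨(D.sr i).1 a, ⟨D.sr_pos i h1 ha, ?_⟩, D.sr_sr_apply i a⟩
        rw [W_mul_apply, sr_sr_apply]; exact h2
    · rintro (rfl | ⟨b, hb, rfl⟩)
      · exact ⟨D.sa_pos i, hneg⟩
      · exact ⟨D.sr_pos i hb.1 (hne b hb), hb.2⟩
  unfold length
  rw [heq, Set.ncard_insert_of_notMem ?_ ((D.inversions_finite _).image _), Set.ncard_image_of_injective _ (LinearEquiv.injective _)]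
  rintro ⟨b, hb, hb2⟩
  have : b = -D.sa i := by
    rw [← D.sr_sa_self, ← hb2, sr_sr_apply]
  have h1 := hb.1
  rw [this] at h1
  exact D.not_pos_neg (D.sa_pos i) h1

theorem exists_descent {w : D.W} (h : D.length w ≠ 0) : ∃ i, ∀ j, D.co j (w.1 (D.sa i)) ≤ 0 := by
  by_contra hcon
  apply h
  have hpos : ∀ i, ∀ j, 0 ≤ D.co j (w.1 (D.sa i)) := by
    intro i
    rcases D.R_pos_or ((D.W_mem_R w _).2 (D.sa_mem i)) with h1 | h1
    · exact h1
    · refine absurd ⟨i, fun j => ?_⟩ hcon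
      have := h1 j
      rw [co_neg] at this; linarith
  unfold length
  rw [Set.ncard_eq_zero (D.inversions_finite w)]
  refine Set.eq_empty_of_forall_notMem ?_
  rintro a ⟨h1, h2⟩
  rw [pos_iff] at h1 h2
  refine D.R_ne_zero h2.1 (D.co_ext fun j => ?_)
  have h3 : 0 ≤ D.co j (w.1 a) := by
    have : w.1 a = ∑ i, D.co i a • w.1 (D.sa i) := by
      conv_lhs => rw [D.co_sum a, map_sum]
      simp only [map_smul]
    rw [this]
    have : ∀ s : Finset (Option D.base.support), 0 ≤ D.co j (∑ i ∈ s, D.co i a • w.1 (D.sa i)) := by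
      classical
      intro s
      induction s using Finset.induction_on with
      | empty => simp [co_zero]
      | insert l s hl ih =>
        rw [Finset.sum_insert hl, co_add, co_smul]
        exact add_nonneg (mul_nonneg (h1.2 l) (hpos l j)) ih
    exact this _
  have h4 := h2.2 j
  rw [co_neg] at h4 ⊢
  rw [co_zero]; linarith

theorem length_eq_zero_iff (w : D.W) : D.length w = 0 ↔ ∀ a, D.Pos a → D.Pos (w.1 a) := by
  unfold length
  rw [Set.ncard_eq_zero (D.inversions_finite w)]
  constructor
  · intro h a ha
    rcases D.pos_or ((D.W_mem_R w a).2 ha.1) with h1 | h1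
    · exact h1
    · exact absurd (show a ∈ D.inversions w from ⟨ha, h1⟩) (by rw [h]; exact Set.notMem_empty a)
  · intro h
    refine Set.eq_empty_of_forall_notMem ?_
    rintro a ⟨h1, h2⟩
    exact D.not_pos_neg (h a h1) h2

/-- The subgroup `Ω` of elements of length zero. -/
def Om : Subgroup D.W where
  carrier := {w | D.length w = 0}
  one_mem' := (D.length_eq_zero_iff 1).2 fun a ha => ha
  mul_mem' {v w} hv hw := (D.length_eq_zero_iff _).2 fun a ha =>
    (D.length_eq_zero_iff v).1 hv _ ((D.length_eq_zero_iff w).1 hw a ha)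
  inv_mem' {w} hw := by
    refine (D.length_eq_zero_iff _).2 fun a ha => ?_
    rcases D.pos_or ((D.W_mem_R w⁻¹ a).2 ha.1) with h | h
    · exact h
    · have h1 := (D.length_eq_zero_iff w).1 hw _ h
      have h2 : w.1 (-((w⁻¹).1 a)) = -a := by
        rw [map_neg]
        congr 1
        exact congrArg (fun v : D.W => v.1 a) (mul_inv_cancel w)
      rw [h2] at h1
      exact absurd h1 (D.not_pos_neg ha)

theorem Om_pos (w : D.Om) {a} (ha : D.Pos a) : D.Pos (w.1.1 a) :=
  (D.length_eq_zero_iff w.1).1 w.2 a ha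

theorem inv_apply_apply (w : D.W) (x) : (w⁻¹).1 (w.1 x) = x :=
  congrArg (fun v : D.W => v.1 x) (inv_mul_cancel w)

theorem apply_inv_apply (w : D.W) (x) : w.1 ((w⁻¹).1 x) = x :=
  congrArg (fun v : D.W => v.1 x) (mul_inv_cancel w)

/-- The group `Ω` permutes the simple affine roots. -/
theorem Om_sa (w : D.Om) (j) : ∃ i, w.1.1 (D.sa j) = D.sa i := by
  classical
  have h1 := D.pos_iff.1 (D.Om_pos w (D.sa_pos j))
  obtain ⟨l, hl⟩ : ∃ l, D.co l (w.1.1 (D.sa j)) ≠ 0 := by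
    by_contra h
    push Not at h
    exact D.R_ne_zero h1.1 (D.co_ext fun l => by rw [h, co_zero])
  have hl' : 0 < D.co l (w.1.1 (D.sa j)) := lt_of_le_of_ne (h1.2 l) hl.symm
  have hinv : ∀ i, D.Pos ((w⁻¹).1.1 (D.sa i)) := fun i => D.Om_pos w⁻¹ (D.sa_pos i)
  have hsum : D.sa j = ∑ i, D.co i (w.1.1 (D.sa j)) • (w⁻¹).1.1 (D.sa i) := by
    conv_lhs => rw [← D.inv_apply_apply w.1 (D.sa j), D.co_sum (w.1.1 (D.sa j)), map_sum]
    simp only [map_smul]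
    rfl
  have hco : ∀ i, D.co i (D.sa j) =
      ∑ k, D.co k (w.1.1 (D.sa j)) * D.co i ((w⁻¹).1.1 (D.sa k)) := by
    intro i
    have : ∀ (s : Finset (Option D.base.support)) (c : Option D.base.support → ℝ)
        (z : Option D.base.support → ℝ × V),
        D.co i (∑ l ∈ s, c l • z l) = ∑ l ∈ s, c l * D.co i (z l) := by
      intro s c z
      induction s using Finset.induction_on with
      | empty => simp [co_zero]
      | insert l s hl ih => rw [Finset.sum_insert hl, Finset.sum_insert hl, co_add, co_smul, ih]
    rw [← this, ← hsum]
  have hz : ∀ i, i ≠ j → D.co i ((w⁻¹).1.1 (D.sa l)) = 0 := by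
    intro i hi
    have h2 := hco i
    rw [co_sa, if_neg (Ne.symm hi)] at h2
    have h3 := (Finset.sum_eq_zero_iff_of_nonneg fun k _ =>
      mul_nonneg (h1.2 k) ((D.pos_iff.1 (hinv k)).2 i)).1 h2.symm l (Finset.mem_univ _)
    exact (mul_eq_zero.1 h3).resolve_left hl
  have heq : (w⁻¹).1.1 (D.sa l) = D.co j ((w⁻¹).1.1 (D.sa l)) • D.sa j := by
    refine D.co_ext fun i => ?_
    rw [co_smul, co_sa]
    split_ifs with hi
    · rw [hi, mul_one]
    · rw [mul_zero]; exact hz i (Ne.symm hi)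
  have hp : 0 < D.co j ((w⁻¹).1.1 (D.sa l)) := by
    refine lt_of_le_of_ne ((D.pos_iff.1 (hinv l)).2 j) fun h3 => ?_
    rw [← h3, zero_smul] at heq
    exact D.R_ne_zero (hinv l).1 heq
  have h4 := D.R_reduced (hinv l).1 (D.sa_mem j) hp heq
  refine ⟨l, ?_⟩
  rw [← h4]
  exact D.apply_inv_apply w.1 _

/-- If `w a_j = a_i` then `w s_j = s_i w`. -/
theorem conj_sr {w : D.W} {i j} (h : w.1 (D.sa j) = D.sa i) : w * D.sr j = D.sr i * w := by
  refine D.W_ext fun x => ?_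
  rw [W_mul_apply, W_mul_apply, sr_apply', sr_apply', map_sub, map_smul, ← h, D.W_inner w x,
    D.W_inner w (D.sa j)]

end length

section presentation

/-- The alternating product `⋯ a * b * a` with `n` factors, ending with `a`. -/
def revProd {M : Type*} [Monoid M] (a b : M) : ℕ → M
  | 0 => 1
  | n + 1 => revProd b a n * a

/-- Bookkeeping for chains of descents in rank two. -/
def Chain : ℕ → ℤ → ℤ → ℤ → ℤ → ℤ → ℤ → Prop
  | 0, _, _, _, _, _, _ => True
  | r + 1, p, p', u, v, u', v' => 0 ≤ u ∧ 0 ≤ v ∧ Chain r p' p (u' + p * u) (v' + p * v) (-u) (-v)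

theorem co_nonpos_comb {A B : ℝ × V} (hA : ∀ k, D.co k A ≤ 0) (hB : ∀ k, D.co k B ≤ 0) {u v : ℝ}
    (hu : 0 ≤ u) (hv : 0 ≤ v) (k) : D.co k (u • A + v • B) ≤ 0 := by
  rw [co_add, co_smul, co_smul]
  nlinarith [hA k, hB k]

theorem chain_peel {Y : Type*} [Monoid Y] (f : Option D.base.support → Y) (F : D.W → Y) (n : ℕ)
    (hF : ∀ x i, (∀ k, D.co k (x.1 (D.sa i)) ≤ 0) → D.length x < n → F x = F (x * D.sr i) * f i)
    {A B : ℝ × V} (hA : ∀ k, D.co k A ≤ 0) (hB : ∀ k, D.co k B ≤ 0) (r : ℕ) :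
    ∀ (i j : Option D.base.support) (x : D.W) (u v u' v' : ℤ),
      x.1 (D.sa i) = (u : ℝ) • A + (v : ℝ) • B → x.1 (D.sa j) = (u' : ℝ) • A + (v' : ℝ) • B →
      Chain r (D.cart i j) (D.cart j i) u v u' v' → D.length x < n →
      F x = F (x * altProd (D.sr i) (D.sr j) r) * revProd (f i) (f j) r := by
  induction r with
  | zero => intro i j x u v u' v' _ _ _ _; simp [altProd, revProd]
  | succ r ih =>
    intro i j x u v u' v' h1 h2 hc hlen
    obtain ⟨hu, hv, hc⟩ := hc
    have hd : ∀ k, D.co k (x.1 (D.sa i)) ≤ 0 := by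
      rw [h1]
      exact D.co_nonpos_comb hA hB (by exact_mod_cast hu) (by exact_mod_cast hv)
    have hl := D.length_descent hd
    rw [hF x i hd hlen, ih j i (x * D.sr i) _ _ _ _ ?_ ?_ hc (by omega)]
    · simp only [altProd, revProd, mul_assoc]
    · rw [W_mul_apply, sr_sa, map_add, map_smul, h1, h2]
      push_cast; module
    · rw [W_mul_apply, sr_sa_self, map_neg, h1]
      push_cast; module

theorem chain_infinite {A B : ℝ × V} (hA : ∀ k, D.co k A ≤ 0) (hB : ∀ k, D.co k B ≤ 0) (n : ℕ) :
    ∀ (i j : Option D.base.support) (x : D.W) (r : ℕ), D.cart i j = 2 → D.cart j i = 2 →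
      x.1 (D.sa i) = (r + 1 : ℝ) • A + (r : ℝ) • B →
      x.1 (D.sa j) = -((r : ℝ) • A + (r - 1 : ℝ) • B) → n ≤ D.length x := by
  induction n with
  | zero => intros; exact Nat.zero_le _
  | succ n ih =>
    intro i j x r hij hji h1 h2
    have hd : ∀ k, D.co k (x.1 (D.sa i)) ≤ 0 := by
      rw [h1]
      exact D.co_nonpos_comb hA hB (by positivity) (by positivity)
    rw [D.length_descent hd]
    refine Nat.succ_le_succ (ih j i _ (r + 1) hji hij ?_ ?_)
    · rw [W_mul_apply, sr_sa, hij, map_add, map_smul, h1, h2]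
      push_cast; module
    · rw [W_mul_apply, sr_sa_self, map_neg, h1]
      push_cast; module

open Classical in
/-- The extended affine Weyl group is presented by the simple reflections and the elements of
length zero: assignments compatible with the braid relations extend to homomorphisms. -/
theorem exists_monoidHom {Y : Type*} [Monoid Y] (f : Option D.base.support → Y) (g : D.Om →* Y)
    (hf : ∀ j, f j * f j = 1)
    (hbr : ∀ i j, i ≠ j → 0 < orderOf (D.sr i * D.sr j) →
      altProd (f i) (f j) (orderOf (D.sr i * D.sr j)) =
        altProd (f j) (f i) (orderOf (D.sr i * D.sr j)))
    (hg : ∀ (w : D.Om) i j, w.1.1 (D.sa j) = D.sa i → g w * f j = f i * g w) :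
    ∃ F : D.W →* Y, (∀ j, F (D.sr j) = f j) ∧ ∀ w : D.Om, F w.1 = g w := by
  let Neg : D.W → Option D.base.support → Prop := fun w i => ∀ j, D.co j (w.1 (D.sa i)) ≤ 0
  let F : D.W → Y := (measure D.length).wf.fix fun w rec =>
    if h : ∃ i, Neg w i then
      rec (w * D.sr h.choose) (by
        change D.length _ < D.length _
        have := D.length_descent h.choose_spec
        omega) * f h.choose
    else if h' : w ∈ D.Om then g ⟨w, h'⟩ else 1
  have hFeq : ∀ w, F w = if h : ∃ i, Neg w i then F (w * D.sr h.choose) * f h.choose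
      else if h' : w ∈ D.Om then g ⟨w, h'⟩ else 1 := by
    intro w
    exact WellFounded.fix_eq _ _ _
  have hF0 : ∀ w : D.Om, F w.1 = g w := by
    intro w
    have hn : ¬ ∃ i, Neg w.1 i := by
      rintro ⟨i, hi⟩
      have h1 := D.length_descent hi
      have h2 : D.length w.1 = 0 := w.2
      omega
    rw [hFeq, dif_neg hn, dif_pos w.2]
  have key : ∀ n, ∀ w i, Neg w i → D.length w < n → F w = F (w * D.sr i) * f i := by
    intro n
    induction n with
    | zero => intro w i _ h; exact absurd h (Nat.not_lt_zero _)
    | succ n ih =>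
      intro w i hi hlen
      have hex : ∃ i, Neg w i := ⟨i, hi⟩
      rw [hFeq, dif_pos hex]
      have hj : Neg w hex.choose := hex.choose_spec
      generalize hex.choose = j at hj
      by_cases hij : i = j
      · rw [hij]
      have step : ∀ (i j : Option D.base.support) (m : ℕ), Neg w i → Neg w j →
          Chain m (D.cart j i) (D.cart i j) (D.cart i j) 1 (-1) 0 →
          F (w * D.sr i) * f i =
            F (w * altProd (D.sr i) (D.sr j) (m + 1)) * revProd (f i) (f j) (m + 1) := by
        intro i j m hi hj hc
        have hl := D.length_descent hi
        rw [D.chain_peel f F n ih hi hj m j i (w * D.sr i) _ _ _ _ ?_ ?_ hc (by omega)]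
        · simp only [altProd, revProd, mul_assoc]
        · rw [W_mul_apply, sr_sa, map_add, map_smul]
          push_cast; module
        · rw [W_mul_apply, sr_sa_self, map_neg]
          push_cast; module
      have hord := D.orderOf_sr hij
      have hb := hbr i j hij
      have hs := D.sr_braid_aux i j
      simp only [Set.mem_insert_iff, Set.mem_singleton_iff, Prod.mk.injEq] at hord hs
      rcases hord with ⟨h1, h2, h3⟩ | ⟨h1, h2, h3⟩ | ⟨h1, h2, h3⟩ | ⟨h1, h2, h3⟩ | ⟨h1, h2, h3⟩ |
        ⟨h1, h2, h3⟩ | ⟨h1, h2, h3⟩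
      · rw [step i j 1 hi hj (by simp [Chain, h1, h2]), step j i 1 hj hi (by simp [Chain, h1, h2]),
          hs 2 (by simp [h1, h2])]
        rw [h3] at hb
        have hb := hb (by norm_num)
        simp only [altProd, revProd, one_mul, mul_one, mul_assoc] at hb ⊢
        rw [hb]
      · rw [step i j 2 hi hj (by simp [Chain, h1, h2]), step j i 2 hj hi (by simp [Chain, h1, h2]),
          hs 3 (by simp [h1, h2])]
        rw [h3] at hb
        have hb := hb (by norm_num)
        simp only [altProd, revProd, one_mul, mul_one, mul_assoc] at hb ⊢
        rw [hb]
      · rw [step i j 3 hi hj (by simp [Chain, h1, h2]), step j i 3 hj hi (by simp [Chain, h1, h2]),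
          hs 4 (by simp [h1, h2])]
        rw [h3] at hb
        have hb := hb (by norm_num)
        simp only [altProd, revProd, one_mul, mul_one, mul_assoc] at hb ⊢
        rw [hb]
      · rw [step i j 3 hi hj (by simp [Chain, h1, h2]), step j i 3 hj hi (by simp [Chain, h1, h2]),
          hs 4 (by simp [h1, h2])]
        rw [h3] at hb
        have hb := hb (by norm_num)
        simp only [altProd, revProd, one_mul, mul_one, mul_assoc] at hb ⊢
        rw [hb]
      · rw [step i j 5 hi hj (by simp [Chain, h1, h2]), step j i 5 hj hi (by simp [Chain, h1, h2]),
          hs 6 (by simp [h1, h2])]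
        rw [h3] at hb
        have hb := hb (by norm_num)
        simp only [altProd, revProd, one_mul, mul_one, mul_assoc] at hb ⊢
        rw [hb]
      · rw [step i j 5 hi hj (by simp [Chain, h1, h2]), step j i 5 hj hi (by simp [Chain, h1, h2]),
          hs 6 (by simp [h1, h2])]
        rw [h3] at hb
        have hb := hb (by norm_num)
        simp only [altProd, revProd, one_mul, mul_one, mul_assoc] at hb ⊢
        rw [hb]
      · exfalso
        have := D.chain_infinite hi hj (D.length w + 1) i j w 0 h1 h2 (by simp) (by simp)
        omega
  have keyA : ∀ w i, Neg w i → F w = F (w * D.sr i) * f i := fun w i h =>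
    key _ w i h (Nat.lt_succ_self _)
  have keyB : ∀ w i, F (w * D.sr i) = F w * f i := by
    intro w i
    rcases D.R_pos_or ((D.W_mem_R w _).2 (D.sa_mem i)) with h | h
    · rw [keyA (w * D.sr i) i, mul_assoc, sr_mul_self, mul_one]
      intro j
      rw [W_mul_apply, sr_sa_self, map_neg, co_neg]
      linarith [h j]
    · rw [keyA w i, mul_assoc, hf, mul_one]
      intro j
      have := h j
      rw [co_neg] at this; linarith
  have keyC : ∀ n, ∀ (w : D.W) (v : D.Om), D.length w = n → F (w * v.1) = F w * g v := by
    intro n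
    induction n with
    | zero =>
      intro w v hw
      have h1 := hF0 (⟨w, hw⟩ * v)
      rw [map_mul, ← hF0 ⟨w, hw⟩] at h1
      exact h1
    | succ n ih =>
      intro w v hw
      obtain ⟨i, hi⟩ := D.exists_descent (w := w) (by omega)
      obtain ⟨j, hj⟩ := D.Om_sa v⁻¹ i
      have hji : v.1.1 (D.sa j) = D.sa i := by rw [← hj]; exact D.apply_inv_apply v.1 _
      have hl := D.length_descent hi
      have h1 : w * v.1 = w * D.sr i * v.1 * D.sr j := by
        rw [mul_assoc (w * D.sr i), D.conj_sr hji, ← mul_assoc, mul_assoc w, sr_mul_self, mul_one]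
      rw [h1, keyB, ih (w * D.sr i) v (by omega), mul_assoc, hg v i j hji, ← mul_assoc,
        ← keyA w i hi]
  have hmul : ∀ n, ∀ v w : D.W, D.length w = n → F (v * w) = F v * F w := by
    intro n
    induction n with
    | zero =>
      intro v w hw
      rw [keyC _ v ⟨w, hw⟩ rfl, ← hF0 ⟨w, hw⟩]
    | succ n ih =>
      intro v w hw
      obtain ⟨i, hi⟩ := D.exists_descent (w := w) (by omega)
      have hl := D.length_descent hi
      have h1 := ih v (w * D.sr i) (by omega)
      rw [keyA w i hi, ← mul_assoc, ← h1, ← keyB, mul_assoc, mul_assoc, sr_mul_self, mul_one]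
  have hone : F 1 = 1 := by rw [← map_one g, ← hF0 1]; rfl
  refine ⟨⟨⟨F, hone⟩, fun v w => hmul _ v w rfl⟩, fun j => ?_, hF0⟩
  change F (D.sr j) = f j
  rw [← one_mul (D.sr j), keyB, hone, one_mul]

end presentation
end RootData
end DoubleAffine

namespace DoubleAffine

/-- A root system together with the positive integer `m` such that `m ⟨P^∨, P^∨⟩ = ℤ` and an
arbitrary choice of `q^{1/m} ∈ ℂˣ`. -/
structure QData (ι V : Type*) [Finite ι] [NormedAddCommGroup V] [InnerProductSpace ℝ V] extends
    RootData ι V where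
  m : ℕ
  m_pos : 0 < m
  m_spec : AddSubgroup.closure {x : ℝ | ∃ u ∈ coweightLattice P, ∃ v ∈ coweightLattice P,
    x = m * ⟪u, v⟫} = (Int.castAddHom ℝ).range
  /-- the number `q^{1/m}` -/
  qm : ℂˣ

namespace QData

variable {ι V : Type*} [Finite ι] [NormedAddCommGroup V] [InnerProductSpace ℝ V] (D : QData ι V)

section exponents

/-- The coweight lattice. -/
abbrev Pv : AddSubgroup V := coweightLattice D.P

/-- The lattice `(1/m) ℤ c + P^∨`. -/
def Phat : AddSubgroup (ℝ × V) where
  carrier := {x | (∃ z : ℤ, D.m * x.1 = z) ∧ x.2 ∈ D.Pv}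
  zero_mem' := ⟨⟨0, by simp⟩, zero_mem _⟩
  add_mem' := by
    rintro x y ⟨⟨a, ha⟩, hx⟩ ⟨⟨b, hb⟩, hy⟩
    exact ⟨⟨a + b, by rw [Prod.fst_add, mul_add, ha, hb]; push_cast; ring⟩, add_mem hx hy⟩
  neg_mem' := by
    rintro x ⟨⟨a, ha⟩, hx⟩
    exact ⟨⟨-a, by rw [Prod.fst_neg, mul_neg, ha]; push_cast; ring⟩, neg_mem hx⟩

theorem inner_Pv {u v : V} (hu : u ∈ D.Pv) (hv : v ∈ D.Pv) : ∃ z : ℤ, D.m * ⟪u, v⟫ = z := by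
  have : (D.m * ⟪u, v⟫ : ℝ) ∈ (Int.castAddHom ℝ).range := by
    rw [← D.m_spec]
    exact AddSubgroup.subset_closure ⟨u, hu, v, hv, rfl⟩
  obtain ⟨z, hz⟩ := this
  exact ⟨z, hz.symm⟩

theorem reflection_Pv (i : ι) {v : V} (hv : v ∈ D.Pv) : D.P.reflection i v ∈ D.Pv := by
  intro j
  obtain ⟨r, hr⟩ := hv (D.P.reflectionPerm i j)
  refine ⟨r, ?_⟩
  rw [← hr, RootPairing.root_reflectionPerm, ← D.inner_reflection i v]
  congr 1
  rw [← LinearEquiv.mul_apply]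
  simp

theorem Phat_finRefl (i : ι) {x : ℝ × V} (hx : x ∈ D.Phat) : D.finRefl i x ∈ D.Phat :=
  ⟨hx.1, D.reflection_Pv i hx.2⟩

theorem Phat_transl {v : V} (hv : v ∈ D.Pv) {x : ℝ × V} (hx : x ∈ D.Phat) :
    RootData.transl v x ∈ D.Phat := by
  obtain ⟨⟨a, ha⟩, hx2⟩ := hx
  obtain ⟨b, hb⟩ := D.inner_Pv hv hx2
  refine ⟨⟨a - b, ?_⟩, hx2⟩
  rw [RootData.transl_apply, mul_sub, ha, hb]
  push_cast; ring

theorem W_mem_Phat (w : D.W) : ∀ x : ℝ × V, w.1 x ∈ D.Phat ↔ x ∈ D.Phat := by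
  refine D.W_induction (p := fun w => ∀ x : ℝ × V, w x ∈ D.Phat ↔ x ∈ D.Phat) ?_ ?_ ?_ ?_ ?_ w
  · intro i x
    refine ⟨fun h => ?_, D.Phat_finRefl i⟩
    have := D.Phat_finRefl i h
    rwa [RootData.finRefl_finRefl] at this
  · intro v hv x
    refine ⟨fun h => ?_, D.Phat_transl hv⟩
    have := D.Phat_transl (neg_mem hv) h
    simpa [RootData.transl_apply] using this
  · intro x; rfl
  · intro f g hf hg x; exact (hf _).trans (hg _)
  · intro f hf x
    rw [← hf]
    change f (f.symm x) ∈ _ ↔ _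
    rw [LinearEquiv.apply_symm_apply]

theorem sa_mem_Phat (j) : D.sa j ∈ D.Phat := by
  cases j with
  | none => exact ⟨⟨D.m, by simp [RootData.sa]⟩, D.neg_coroot_mem _⟩
  | some i => exact ⟨⟨0, by simp [RootData.sa]⟩, D.coroot_mem _⟩

theorem Pv_mem_Phat {v : V} (hv : v ∈ D.Pv) : ((0, v) : ℝ × V) ∈ D.Phat := ⟨⟨0, by simp⟩, hv⟩

/-- `q^r = (q^{1/m})^{m r}` for `r ∈ (1/m) ℤ`. -/
noncomputable def qpow (r : ℝ) : ℂ := ((D.qm ^ ⌊D.m * r⌋ : ℂˣ) : ℂ)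

theorem qpow_add {r s : ℝ} (hr : ∃ z : ℤ, D.m * r = z) (hs : ∃ z : ℤ, D.m * s = z) :
    D.qpow (r + s) = D.qpow r * D.qpow s := by
  obtain ⟨a, ha⟩ := hr
  obtain ⟨b, hb⟩ := hs
  rw [qpow, qpow, qpow, mul_add, ha, hb, ← Int.cast_add, Int.floor_intCast, Int.floor_intCast,
    Int.floor_intCast, zpow_add, Units.val_mul]

theorem qpow_zero : D.qpow 0 = 1 := by simp [qpow]

instance : UniqueSums D.Pv := by
  let _ : Module ℚ V := Module.compHom V (algebraMap ℚ ℝ)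
  exact UniqueSums.of_injective_addHom (D.Pv.subtype : D.Pv →ₙ+ V) Subtype.val_injective
    inferInstance

/-- The algebra `ℂ[T]` of regular functions on the torus `T = Hom(P^∨, ℂˣ)`, i.e. the group algebra
of the coweight lattice. -/
abbrev CT : Type _ := AddMonoidAlgebra ℂ D.Pv

open Classical in
/-- `e_q^{r c + v} = q^r e^v` for `r c + v ∈ (1/m) ℤ c + P^∨`. -/
noncomputable def expo (x : ℝ × V) : D.CT :=
  if h : x.2 ∈ D.Pv then AddMonoidAlgebra.single ⟨x.2, h⟩ (D.qpow x.1) else 0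

theorem expo_eq {x : ℝ × V} (h : x.2 ∈ D.Pv) :
    D.expo x = AddMonoidAlgebra.single ⟨x.2, h⟩ (D.qpow x.1) := dif_pos h

theorem expo_add {x y : ℝ × V} (hx : x ∈ D.Phat) (hy : y ∈ D.Phat) :
    D.expo (x + y) = D.expo x * D.expo y := by
  rw [D.expo_eq hx.2, D.expo_eq hy.2, D.expo_eq (x := x + y) (add_mem hx.2 hy.2),
    AddMonoidAlgebra.single_mul_single, Prod.fst_add, D.qpow_add hx.1 hy.1]
  rfl

theorem expo_zero : D.expo 0 = 1 := by
  rw [D.expo_eq (x := 0) (zero_mem _), Prod.fst_zero, qpow_zero]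
  rfl

/-- The action of the extended affine Weyl group on `ℂ[T]`: `w_q e^μ = e_q^{w μ}`. In particular
`w_q e^μ = e^{w μ}` for `w ∈ W₀` and `τ(λ)_q e^μ = q^{-⟨λ, μ⟩} e^μ`. -/
noncomputable def actHom (w : D.W) : D.CT →ₐ[ℂ] D.CT :=
  AddMonoidAlgebra.lift ℂ D.CT D.Pv
    { toFun := fun μ => D.expo (w.1 (0, (μ.toAdd : V)))
      map_one' := by
        have : ((0 : ℝ), ((0 : D.Pv) : V)) = 0 := rfl
        rw [toAdd_one, this, map_zero, expo_zero]
      map_mul' := fun μ ν => by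
        have : ((0 : ℝ), ((μ.toAdd + ν.toAdd : D.Pv) : V)) = (0, (μ.toAdd : V)) + (0, (ν.toAdd : V)) := by
          ext <;> simp
        rw [toAdd_mul, this, map_add]
        exact D.expo_add ((D.W_mem_Phat w _).2 (D.Pv_mem_Phat μ.toAdd.2))
          ((D.W_mem_Phat w _).2 (D.Pv_mem_Phat ν.toAdd.2)) }

theorem actHom_single (w : D.W) (μ : D.Pv) (z : ℂ) :
    D.actHom w (AddMonoidAlgebra.single μ z) = z • D.expo (w.1 (0, (μ : V))) := by
  rw [actHom, AddMonoidAlgebra.lift_single]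
  rfl

theorem expo_const_add (r : ℝ) (hr : ∃ z : ℤ, D.m * r = z) {x : ℝ × V} (hx : x ∈ D.Phat) :
    D.expo ((r, 0) + x) = D.qpow r • D.expo x := by
  rw [D.expo_add ⟨hr, zero_mem _⟩ hx, D.expo_eq (x := ((r, 0) : ℝ × V)) (zero_mem _)]
  rw [show AddMonoidAlgebra.single (⟨(r, (0 : V)).2, zero_mem _⟩ : D.Pv) (D.qpow r) =
    algebraMap ℂ D.CT (D.qpow r) from rfl, Algebra.smul_def]

/-- `w_q(e_q^x) = e_q^{w x}`. -/
theorem actHom_expo (w : D.W) {x : ℝ × V} (hx : x ∈ D.Phat) :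
    D.actHom w (D.expo x) = D.expo (w.1 x) := by
  have h0 : ((0, x.2) : ℝ × V) ∈ D.Phat := D.Pv_mem_Phat hx.2
  have h : w.1 x = (x.1, 0) + w.1 (0, x.2) := by
    rw [D.W_eq w x]
    ext <;> simp
  rw [D.expo_eq hx.2, actHom_single, h, D.expo_const_add x.1 hx.1 ((D.W_mem_Phat w _).2 h0)]

theorem actHom_mul (v w : D.W) : D.actHom (v * w) = (D.actHom v).comp (D.actHom w) := by
  refine AddMonoidAlgebra.algHom_ext (fun μ => ?_) (by ext)
  rw [AlgHom.comp_apply, actHom_single, actHom_single, one_smul, one_smul,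
    D.actHom_expo v ((D.W_mem_Phat w _).2 (D.Pv_mem_Phat μ.2))]
  rfl

theorem actHom_one : D.actHom 1 = AlgHom.id ℂ D.CT := by
  refine AddMonoidAlgebra.algHom_ext (fun μ => ?_) (by ext)
  rw [actHom_single, one_smul, RootData.W_one_apply, D.expo_eq (x := (0, (μ : V))) μ.2, qpow_zero]
  rfl

/-- The action of `W` on `ℂ[T]` by algebra automorphisms. -/
noncomputable def actAut : D.W →* (D.CT ≃ₐ[ℂ] D.CT) :=
  (AlgEquiv.algHomUnitsEquiv ℂ D.CT).toMonoidHom.comp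
    (MonoidHom.toHomUnits
      { toFun := D.actHom, map_one' := D.actHom_one, map_mul' := D.actHom_mul })

theorem actAut_apply (w : D.W) (f : D.CT) : D.actAut w f = D.actHom w f := rfl

/-- The field `ℂ(T)` of rational functions on the torus `T`. -/
def CTfrac : Type _ := FractionRing D.CT

noncomputable instance : Field D.CTfrac := inferInstanceAs (Field (FractionRing D.CT))
noncomputable instance : Algebra D.CT D.CTfrac :=
  inferInstanceAs (Algebra D.CT (FractionRing D.CT))
noncomputable instance : Algebra ℂ D.CTfrac := inferInstanceAs (Algebra ℂ (FractionRing D.CT))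
instance : IsScalarTower ℂ D.CT D.CTfrac :=
  inferInstanceAs (IsScalarTower ℂ D.CT (FractionRing D.CT))
instance : IsFractionRing D.CT D.CTfrac :=
  inferInstanceAs (IsFractionRing D.CT (FractionRing D.CT))

/-- The action of `W` on `ℂ(T)` by field automorphisms. -/
noncomputable instance : MulSemiringAction D.W D.CTfrac :=
  MulSemiringAction.compHom D.CTfrac
    ((IsFractionRing.fieldEquivOfAlgEquivHom ℂ D.CTfrac).comp D.actAut)

theorem smul_algebraMap_CT (w : D.W) (f : D.CT) :
    w • (algebraMap D.CT D.CTfrac f) = algebraMap D.CT D.CTfrac (D.actHom w f) :=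
  IsFractionRing.fieldEquivOfAlgEquiv_algebraMap ℂ D.CTfrac D.CTfrac (D.actAut w) f

instance : SMulCommClass D.W ℂ D.CTfrac where
  smul_comm w z f :=
    map_smul (IsFractionRing.fieldEquivOfAlgEquivHom ℂ D.CTfrac (D.actAut w)) z f

/-- `e_q^x` as a rational function. -/
noncomputable def e (x : ℝ × V) : D.CTfrac := algebraMap D.CT D.CTfrac (D.expo x)

theorem smul_e (w : D.W) {x : ℝ × V} (hx : x ∈ D.Phat) : w • D.e x = D.e (w.1 x) := by
  rw [e, smul_algebraMap_CT, D.actHom_expo w hx, e]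

theorem e_add {x y : ℝ × V} (hx : x ∈ D.Phat) (hy : y ∈ D.Phat) :
    D.e (x + y) = D.e x * D.e y := by
  rw [e, D.expo_add hx hy, map_mul]; rfl

theorem e_zero : D.e 0 = 1 := by rw [e, expo_zero, map_one]

theorem e_ne_const {x : ℝ × V} (hx : x ∈ D.Phat) (h0 : x.2 ≠ 0) (z : ℂ) :
    D.e x ≠ algebraMap ℂ D.CTfrac z := by
  intro h
  rw [IsScalarTower.algebraMap_apply ℂ D.CT D.CTfrac, e] at h
  have h1 := IsFractionRing.injective D.CT D.CTfrac h
  rw [D.expo_eq hx.2] at h1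
  have h2 := congrArg (fun f : D.CT => f.coeff (⟨x.2, hx.2⟩ : D.Pv)) h1
  have h3 : (0 : D.Pv) ≠ ⟨x.2, hx.2⟩ := fun h => h0 (congrArg Subtype.val h).symm
  rw [show algebraMap ℂ D.CT z = AddMonoidAlgebra.single 0 z from rfl] at h2
  simp [AddMonoidAlgebra.coeff_single, Finsupp.single_apply, h3, qpow] at h2
  exact zpow_ne_zero _ D.qm.ne_zero h2

end exponents
end QData
end DoubleAffine

namespace DoubleAffine
/-- A multiplicity function: a `W`-invariant function `k : R → ℂˣ`. -/
structure RootData.Mult {ι V : Type*} [Finite ι] [NormedAddCommGroup V] [InnerProductSpace ℝ V]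
    (D : RootData ι V) where
  toFun : D.R → ℂˣ
  map_eq : ∀ (w : D.W) (a b : D.R), b.1 = w.1 a.1 → toFun b = toFun a

/-- The multiplicity function `k⁻¹`. -/
instance {ι V : Type*} [Finite ι] [NormedAddCommGroup V] [InnerProductSpace ℝ V]
    (D : RootData ι V) : Inv D.Mult where
  inv k := { toFun := fun a => (k.toFun a)⁻¹, map_eq := fun w a b h => by rw [k.map_eq w a b h] }

/-- The value `k_j = k_{a_j}` at a simple affine root. -/
noncomputable def RootData.Mult.kj {ι V : Type*} [Finite ι] [NormedAddCommGroup V]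
    [InnerProductSpace ℝ V] {D : RootData ι V} (k : D.Mult) (j : Option D.base.support) : ℂ :=
  (k.toFun ⟨D.sa j, D.sa_mem j⟩ : ℂ)

namespace RootData.Mult
variable {ι V : Type*} [Finite ι] [NormedAddCommGroup V] [InnerProductSpace ℝ V]
  {D : RootData ι V} (k : D.Mult)

theorem kj_ne_zero (j) : k.kj j ≠ 0 := Units.ne_zero _

theorem inv_kj (j) : (k⁻¹).kj j = (k.kj j)⁻¹ :=
  Units.val_inv_eq_inv_val (k.toFun ⟨D.sa j, D.sa_mem j⟩)

theorem kj_eq_of_map (w : D.W) {i j} (h : w.1 (D.sa j) = D.sa i) : k.kj i = k.kj j :=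
  congrArg Units.val (k.map_eq w ⟨D.sa j, D.sa_mem j⟩ ⟨D.sa i, D.sa_mem i⟩ h.symm)

theorem kj_eq_of_cart {i j} (h1 : D.cart i j = 1) (h2 : D.cart j i = 1) : k.kj i = k.kj j := by
  refine (k.kj_eq_of_map (D.sr i * D.sr j) ?_).symm
  rw [RootData.W_mul_apply, RootData.sr_sa, map_add, map_smul, RootData.sr_sa_self,
    RootData.sr_sa, h1, h2]
  push_cast; module

end RootData.Mult

namespace QData

variable {ι V : Type*} [Finite ι] [NormedAddCommGroup V] [InnerProductSpace ℝ V] (D : QData ι V)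

section cfunctions

/-- `(1 - e_q^x)⁻¹`. -/
noncomputable def u (x : ℝ × V) : D.CTfrac := (1 - D.e x)⁻¹

/-- `c_a^{k,q} = (k_a⁻¹ - k_a e_q^a) / (1 - e_q^a)`. -/
noncomputable def c (k : D.Mult) (a : D.R) : D.CTfrac :=
  (algebraMap ℂ D.CTfrac (k.toFun a : ℂ)⁻¹ - algebraMap ℂ D.CTfrac (k.toFun a : ℂ) * D.e a) /
    (1 - D.e a)

/-- `c_j^{k,q} = c_{a_j}^{k,q}`. -/
noncomputable def cj (k : D.Mult) (j : Option D.base.support) : D.CTfrac :=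
  D.c k ⟨D.sa j, D.sa_mem j⟩

/-- The constant `k_j - k_j⁻¹`. -/
noncomputable def hj (k : D.Mult) (j : Option D.base.support) : D.CTfrac :=
  algebraMap ℂ D.CTfrac (k.kj j - (k.kj j)⁻¹)

/-- The constant `k_j`. -/
noncomputable def kc (k : D.Mult) (j : Option D.base.support) : D.CTfrac :=
  algebraMap ℂ D.CTfrac (k.kj j)

theorem smul_u (w : D.W) {x : ℝ × V} (hx : x ∈ D.Phat) : w • D.u x = D.u (w.1 x) := by
  rw [u, smul_inv'', smul_sub, smul_one, D.smul_e w hx, u]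

theorem R_snd_ne {x : ℝ × V} (hx : x ∈ D.R) : x.2 ≠ 0 := by
  obtain ⟨i, hi⟩ := D.R_snd hx
  rw [hi]
  exact D.P.flip.ne_zero i

theorem one_sub_e_ne {x : ℝ × V} (hx : x ∈ D.Phat) (h : x ∈ D.R) : 1 - D.e x ≠ 0 := by
  intro h1
  refine D.e_ne_const hx (D.R_snd_ne h) 1 ?_
  rw [map_one]
  exact (sub_eq_zero.1 h1).symm

theorem u_neg {x : ℝ × V} (hx : x ∈ D.Phat) (h : x ∈ D.R) : D.u (-x) = 1 - D.u x := by
  have h1 := D.one_sub_e_ne hx h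
  have h2 := D.one_sub_e_ne (neg_mem hx) (D.neg_mem_R h)
  have h3 : D.e x * D.e (-x) = 1 := by rw [← D.e_add hx (neg_mem hx), add_neg_cancel, e_zero]
  rw [u, u]
  field_simp
  linear_combination -h3

theorem u_mul {x y : ℝ × V} (hx : x ∈ D.Phat) (hy : y ∈ D.Phat) (h1 : x ∈ D.R) (h2 : y ∈ D.R)
    (h3 : x + y ∈ D.R) : D.u x * D.u y = D.u (x + y) * (D.u x + D.u y - 1) := by
  have h1 := D.one_sub_e_ne hx h1
  have h2 := D.one_sub_e_ne hy h2
  have h3 := D.one_sub_e_ne (add_mem hx hy) h3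
  rw [u, u, u]
  rw [D.e_add hx hy] at h3 ⊢
  field_simp
  ring

theorem cj_eq (k : D.Mult) (j) : D.cj k j = D.kc k j - D.hj k j * D.u (D.sa j) := by
  have h := D.one_sub_e_ne (D.sa_mem_Phat j) (D.sa_mem j)
  rw [cj, c, kc, hj, u, map_sub]
  change (algebraMap ℂ D.CTfrac (k.kj j)⁻¹ - algebraMap ℂ D.CTfrac (k.kj j) * D.e (D.sa j)) /
    (1 - D.e (D.sa j)) = _
  field_simp
  ring

theorem cj_ne_zero (k : D.Mult) (j) : D.cj k j ≠ 0 := by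
  have h := D.one_sub_e_ne (D.sa_mem_Phat j) (D.sa_mem j)
  have hk : k.kj j ≠ 0 := k.kj_ne_zero j
  refine div_ne_zero ?_ h
  change algebraMap ℂ D.CTfrac (k.kj j)⁻¹ - algebraMap ℂ D.CTfrac (k.kj j) * D.e (D.sa j) ≠ 0
  intro h1
  refine D.e_ne_const (D.sa_mem_Phat j) (D.R_snd_ne (D.sa_mem j)) ((k.kj j)⁻¹ * (k.kj j)⁻¹) ?_
  have h2 : algebraMap ℂ D.CTfrac (k.kj j) ≠ 0 := by simpa using hk
  rw [map_mul]
  rw [map_inv₀] at h1 ⊢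
  field_simp at h1 ⊢
  linear_combination -h1

theorem smul_const (w : D.W) (z : ℂ) : w • algebraMap ℂ D.CTfrac z = algebraMap ℂ D.CTfrac z :=
  smul_algebraMap w z

theorem smul_hj (w : D.W) (k : D.Mult) (j) : w • D.hj k j = D.hj k j := D.smul_const w _

theorem smul_kc (w : D.W) (k : D.Mult) (j) : w • D.kc k j = D.kc k j := D.smul_const w _

theorem kc_mul (k : D.Mult) (j) : D.kc k j * (D.kc k j - D.hj k j) = 1 := by
  rw [kc, hj, ← map_sub, ← map_mul, ← map_one (algebraMap ℂ D.CTfrac)]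
  congr 1
  have := k.kj_ne_zero j
  field_simp
  ring

theorem smul_u_self (j) : D.sr j • D.u (D.sa j) = 1 - D.u (D.sa j) := by
  rw [D.smul_u _ (D.sa_mem_Phat j), RootData.sr_sa_self, D.u_neg (D.sa_mem_Phat j) (D.sa_mem j)]

theorem cj_smul_cj (k : D.Mult) (j) :
    D.cj k j * (D.sr j • D.cj k j) =
      1 + D.hj k j ^ 2 * (D.u (D.sa j) * (1 - D.u (D.sa j))) := by
  rw [cj_eq, smul_sub, smul_mul', smul_kc, smul_hj, smul_u_self]
  linear_combination D.kc_mul k j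

/-- An affine root lying in the lattice `(1/m) ℤ c + P^∨`. -/
def IsRoot (x : ℝ × V) : Prop := x ∈ D.Phat ∧ x ∈ D.R

theorem IsRoot.map {x : ℝ × V} (w : D.W) (h : D.IsRoot x) : D.IsRoot (w.1 x) :=
  ⟨(D.W_mem_Phat w x).2 h.1, (D.W_mem_R w x).2 h.2⟩

theorem isRoot_sa (j) : D.IsRoot (D.sa j) := ⟨D.sa_mem_Phat j, D.sa_mem j⟩

theorem sr_smul_u {i j} {x y : ℝ × V} (hx : D.IsRoot x) {r s r' s' : ℝ}
    (h : x = r • D.sa i + s • D.sa j) (h' : y = r' • D.sa i + s' • D.sa j)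
    (h1 : r' = -r + D.cart i j * s) (h2 : s' = s) : D.sr i • D.u x = D.u y ∧ D.IsRoot y := by
  have : (D.sr i).1 x = y := by
    rw [h, h', h1, h2, map_add, map_smul, map_smul, RootData.sr_sa_self, RootData.sr_sa]
    module
  rw [D.smul_u _ hx.1, this]
  exact ⟨rfl, this ▸ hx.map D (D.sr i)⟩

theorem u_mul' {x y z : ℝ × V} (hx : D.IsRoot x) (hy : D.IsRoot y) (hz : D.IsRoot z)
    (h : z = x + y) : D.u x * D.u y = D.u z * (D.u x + D.u y - 1) := by
  subst h
  exact D.u_mul hx.1 hy.1 hx.2 hy.2 hz.2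

variable {D} in
theorem rk2 {i j} (h1 : D.cart i j = 0) (h2 : D.cart j i = 0) :
    D.sr i • D.u (D.sa j) = D.u (D.sa j) ∧ D.sr j • D.u (D.sa i) = D.u (D.sa i) := by
  constructor
  · exact (D.sr_smul_u (i := i) (j := j) (D.isRoot_sa j) (r := 0) (s := 1) (r' := 0) (s' := 1)
      (by module) (by module) (by simp [h1]) rfl).1
  · exact (D.sr_smul_u (i := j) (j := i) (D.isRoot_sa i) (r := 0) (s := 1) (r' := 0) (s' := 1)
      (by module) (by module) (by simp [h2]) rfl).1

variable {D} in
theorem rk3 {i j} (h1 : D.cart i j = 1) (h2 : D.cart j i = 1) :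
    ∃ c : D.CTfrac, D.sr i • D.u (D.sa j) = c ∧ D.sr i • c = D.u (D.sa j) ∧
      D.sr j • D.u (D.sa i) = c ∧ D.sr j • c = D.u (D.sa i) ∧
      D.u (D.sa i) * D.u (D.sa j) = c * (D.u (D.sa i) + D.u (D.sa j) - 1) := by
  have hi := D.isRoot_sa i
  have hj := D.isRoot_sa j
  have e1 := D.sr_smul_u (i := i) (j := j) (x := D.sa j) (y := D.sa i + D.sa j) hj
    (r := 0) (s := 1) (r' := 1) (s' := 1) (by module) (by module) (by simp [h1]) rfl
  have hc := e1.2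
  have e2 := D.sr_smul_u (i := i) (j := j) (x := D.sa i + D.sa j) (y := D.sa j) hc
    (r := 1) (s := 1) (r' := 0) (s' := 1) (by module) (by module) (by norm_num [h1]) rfl
  have e3 := D.sr_smul_u (i := j) (j := i) (x := D.sa i) (y := D.sa i + D.sa j) hi
    (r := 0) (s := 1) (r' := 1) (s' := 1) (by module) (by module) (by simp [h2]) rfl
  have e4 := D.sr_smul_u (i := j) (j := i) (x := D.sa i + D.sa j) (y := D.sa i) hc
    (r := 1) (s := 1) (r' := 0) (s' := 1) (by module) (by module) (by norm_num [h2]) rfl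
  exact ⟨_, e1.1, e2.1, e3.1, e4.1, D.u_mul' hi hj hc rfl⟩

variable {D} in
theorem rk4 {i j} (h1 : D.cart i j = 1) (h2 : D.cart j i = 2) :
    ∃ c d : D.CTfrac, (D.sr i • D.u (D.sa j) = c ∧ D.sr i • c = D.u (D.sa j) ∧ D.sr i • d = d) ∧
      (D.sr j • D.u (D.sa i) = d ∧ D.sr j • d = D.u (D.sa i) ∧ D.sr j • c = c) ∧
      D.u (D.sa i) * D.u (D.sa j) = c * (D.u (D.sa i) + D.u (D.sa j) - 1) ∧
      c * D.u (D.sa j) = d * (c + D.u (D.sa j) - 1) := by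
  have hi := D.isRoot_sa i
  have hj := D.isRoot_sa j
  have e1 := D.sr_smul_u (i := i) (j := j) (x := D.sa j) (y := D.sa i + D.sa j) hj
    (r := 0) (s := 1) (r' := 1) (s' := 1) (by module) (by module) (by simp [h1]) rfl
  have hc := e1.2
  have e2 := D.sr_smul_u (i := i) (j := j) (x := D.sa i + D.sa j) (y := D.sa j) hc
    (r := 1) (s := 1) (r' := 0) (s' := 1) (by module) (by module) (by norm_num [h1]) rfl
  have e3 := D.sr_smul_u (i := j) (j := i) (x := D.sa i) (y := D.sa i + (2 : ℝ) • D.sa j) hi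
    (r := 0) (s := 1) (r' := 2) (s' := 1) (by module) (by module) (by simp [h2]) rfl
  have hd := e3.2
  have e4 := D.sr_smul_u (i := j) (j := i) (x := D.sa i + (2 : ℝ) • D.sa j) (y := D.sa i) hd
    (r := 2) (s := 1) (r' := 0) (s' := 1) (by module) (by module) (by norm_num [h2]) rfl
  have e5 := D.sr_smul_u (i := i) (j := j) (x := D.sa i + (2 : ℝ) • D.sa j)
    (y := D.sa i + (2 : ℝ) • D.sa j) hd
    (r := 1) (s := 2) (r' := 1) (s' := 2) (by module) (by module) (by norm_num [h1]) rfl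
  have e6 := D.sr_smul_u (i := j) (j := i) (x := D.sa i + D.sa j) (y := D.sa i + D.sa j) hc
    (r := 1) (s := 1) (r' := 1) (s' := 1) (by module) (by module) (by norm_num [h2]) rfl
  exact ⟨_, _, ⟨e1.1, e2.1, e5.1⟩, ⟨e3.1, e4.1, e6.1⟩, D.u_mul' hi hj hc rfl,
    D.u_mul' hc hj hd (by module)⟩

variable {D} in
theorem rk6 {i j} (h1 : D.cart i j = 1) (h2 : D.cart j i = 3) :
    ∃ c d e f : D.CTfrac,
      (D.sr i • D.u (D.sa j) = c ∧ D.sr i • c = D.u (D.sa j) ∧ D.sr i • d = d ∧ D.sr i • e = f ∧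
        D.sr i • f = e) ∧
      (D.sr j • D.u (D.sa i) = e ∧ D.sr j • e = D.u (D.sa i) ∧ D.sr j • c = d ∧ D.sr j • d = c ∧
        D.sr j • f = f) ∧
      D.u (D.sa i) * D.u (D.sa j) = c * (D.u (D.sa i) + D.u (D.sa j) - 1) ∧
      c * D.u (D.sa j) = d * (c + D.u (D.sa j) - 1) ∧
      d * D.u (D.sa j) = e * (d + D.u (D.sa j) - 1) ∧
      e * D.u (D.sa i) = f * (e + D.u (D.sa i) - 1) ∧
      c * d = f * (c + d - 1) := by
  have hi := D.isRoot_sa i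
  have hj := D.isRoot_sa j
  have e1 := D.sr_smul_u (i := i) (j := j) (x := D.sa j) (y := D.sa i + D.sa j) hj
    (r := 0) (s := 1) (r' := 1) (s' := 1) (by module) (by module) (by simp [h1]) rfl
  have hc := e1.2
  have e2 := D.sr_smul_u (i := i) (j := j) (x := D.sa i + D.sa j) (y := D.sa j) hc
    (r := 1) (s := 1) (r' := 0) (s' := 1) (by module) (by module) (by norm_num [h1]) rfl
  have e3 := D.sr_smul_u (i := j) (j := i) (x := D.sa i) (y := D.sa i + (3 : ℝ) • D.sa j) hi
    (r := 0) (s := 1) (r' := 3) (s' := 1) (by module) (by module) (by simp [h2]) rfl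
  have he := e3.2
  have e4 := D.sr_smul_u (i := j) (j := i) (x := D.sa i + (3 : ℝ) • D.sa j) (y := D.sa i) he
    (r := 3) (s := 1) (r' := 0) (s' := 1) (by module) (by module) (by norm_num [h2]) rfl
  have e5 := D.sr_smul_u (i := j) (j := i) (x := D.sa i + D.sa j)
    (y := D.sa i + (2 : ℝ) • D.sa j) hc
    (r := 1) (s := 1) (r' := 2) (s' := 1) (by module) (by module) (by norm_num [h2]) rfl
  have hd := e5.2
  have e6 := D.sr_smul_u (i := j) (j := i) (x := D.sa i + (2 : ℝ) • D.sa j)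
    (y := D.sa i + D.sa j) hd
    (r := 2) (s := 1) (r' := 1) (s' := 1) (by module) (by module) (by norm_num [h2]) rfl
  have e7 := D.sr_smul_u (i := i) (j := j) (x := D.sa i + (2 : ℝ) • D.sa j)
    (y := D.sa i + (2 : ℝ) • D.sa j) hd
    (r := 1) (s := 2) (r' := 1) (s' := 2) (by module) (by module) (by norm_num [h1]) rfl
  have e8 := D.sr_smul_u (i := i) (j := j) (x := D.sa i + (3 : ℝ) • D.sa j)
    (y := (2 : ℝ) • D.sa i + (3 : ℝ) • D.sa j) he
    (r := 1) (s := 3) (r' := 2) (s' := 3) (by module) (by module) (by norm_num [h1]) rfl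
  have hf := e8.2
  have e9 := D.sr_smul_u (i := i) (j := j) (x := (2 : ℝ) • D.sa i + (3 : ℝ) • D.sa j)
    (y := D.sa i + (3 : ℝ) • D.sa j) hf
    (r := 2) (s := 3) (r' := 1) (s' := 3) (by module) (by module) (by norm_num [h1]) rfl
  have e10 := D.sr_smul_u (i := j) (j := i) (x := (2 : ℝ) • D.sa i + (3 : ℝ) • D.sa j)
    (y := (2 : ℝ) • D.sa i + (3 : ℝ) • D.sa j) hf
    (r := 3) (s := 2) (r' := 3) (s' := 2) (by module) (by module) (by norm_num [h2]) rfl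
  exact ⟨_, _, _, _, ⟨e1.1, e2.1, e7.1, e8.1, e9.1⟩, ⟨e3.1, e4.1, e5.1, e6.1, e10.1⟩,
    D.u_mul' hi hj hc rfl, D.u_mul' hc hj hd (by module), D.u_mul' hd hj he (by module),
    D.u_mul' he hi hf (by module), D.u_mul' hc hd hf (by module)⟩

end cfunctions
end QData
end DoubleAffine

namespace DoubleAffine

theorem map_altProd {M N F : Type*} [Monoid M] [Monoid N] [FunLike F M N] [MonoidHomClass F M N]
    (φ : F) (a b : M) (n : ℕ) : φ (altProd a b n) = altProd (φ a) (φ b) n := by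
  induction n generalizing a b with
  | zero => exact map_one φ
  | succ n ih => rw [altProd, altProd, map_mul, ih]

section Hecke

variable {ι V : Type*} [Finite ι] [NormedAddCommGroup V] [InnerProductSpace ℝ V]

/-- The generators `T_0, …, T_n` and `T_ω` for `ω ∈ Ω` of the extended affine Hecke algebra. -/
abbrev RootData.HGen (D : RootData ι V) : Type _ := Option D.base.support ⊕ D.Om

/-- The defining relations of the extended affine Hecke algebra `H(k) = Hᵃ(k) # Ω`. -/
inductive RootData.HRel (D : RootData ι V) (k : D.Mult) :
    FreeAlgebra ℂ D.HGen → FreeAlgebra ℂ D.HGen → Prop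
  | braid (i j : Option D.base.support) : i ≠ j → 0 < orderOf (D.sr i * D.sr j) →
      RootData.HRel D k
        (altProd (FreeAlgebra.ι ℂ (Sum.inl i)) (FreeAlgebra.ι ℂ (Sum.inl j))
          (orderOf (D.sr i * D.sr j)))
        (altProd (FreeAlgebra.ι ℂ (Sum.inl j)) (FreeAlgebra.ι ℂ (Sum.inl i))
          (orderOf (D.sr i * D.sr j)))
  | quadratic (j : Option D.base.support) :
      RootData.HRel D k ((FreeAlgebra.ι ℂ (Sum.inl j) - algebraMap ℂ _ (k.kj j)) *
        (FreeAlgebra.ι ℂ (Sum.inl j) + algebraMap ℂ _ (k.kj j)⁻¹)) 0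
  | one : RootData.HRel D k (FreeAlgebra.ι ℂ (Sum.inr 1)) 1
  | mul (v w : D.Om) : RootData.HRel D k (FreeAlgebra.ι ℂ (Sum.inr (v * w)))
      (FreeAlgebra.ι ℂ (Sum.inr v) * FreeAlgebra.ι ℂ (Sum.inr w))
  | conj (w : D.Om) (i j : Option D.base.support) : w.1.1 (D.sa j) = D.sa i →
      RootData.HRel D k (FreeAlgebra.ι ℂ (Sum.inr w) * FreeAlgebra.ι ℂ (Sum.inl j))
        (FreeAlgebra.ι ℂ (Sum.inl i) * FreeAlgebra.ι ℂ (Sum.inr w))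

/-- The extended affine Hecke algebra `H(k)`. -/
def RootData.Mult.H {D : RootData ι V} (k : D.Mult) : Type _ := RingQuot (D.HRel k)

namespace RootData.Mult

variable {D : RootData ι V} (k : D.Mult)

noncomputable instance : Ring k.H := inferInstanceAs (Ring (RingQuot (D.HRel k)))
noncomputable instance : Algebra ℂ k.H := inferInstanceAs (Algebra ℂ (RingQuot (D.HRel k)))

/-- The quotient map onto `H(k)`. -/
noncomputable def toH : FreeAlgebra ℂ D.HGen →ₐ[ℂ] k.H := RingQuot.mkAlgHom ℂ (D.HRel k)

theorem toH_rel {x y} (h : D.HRel k x y) : k.toH x = k.toH y := RingQuot.mkAlgHom_rel ℂ h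

/-- The generator `T_j` of `H(k)`. -/
noncomputable def T (j : Option D.base.support) : k.H :=
  k.toH (FreeAlgebra.ι ℂ (Sum.inl j))

/-- The elements `T_ω` of `H(k)` for `ω ∈ Ω`. -/
noncomputable def Tom : D.Om →* k.H where
  toFun w := k.toH (FreeAlgebra.ι ℂ (Sum.inr w))
  map_one' := by rw [k.toH_rel (HRel.one (k := k)), map_one]
  map_mul' v w := by rw [k.toH_rel (HRel.mul (k := k) v w), map_mul]

/-- The finite Hecke algebra `H₀(k)`, the subalgebra of `H(k)` generated by `T_1, …, T_n`. -/
noncomputable def H₀ : Subalgebra ℂ k.H :=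
  Algebra.adjoin ℂ (Set.range fun i : D.base.support => k.T (some i))

theorem T_braid {i j : Option D.base.support} (h : i ≠ j) (h' : 0 < orderOf (D.sr i * D.sr j)) :
    altProd (k.T i) (k.T j) (orderOf (D.sr i * D.sr j)) =
      altProd (k.T j) (k.T i) (orderOf (D.sr i * D.sr j)) := by
  have := k.toH_rel (HRel.braid (k := k) i j h h')
  rwa [map_altProd, map_altProd] at this

theorem T_quadratic (j : Option D.base.support) :
    (k.T j - algebraMap ℂ _ (k.kj j)) * (k.T j + algebraMap ℂ _ (k.kj j)⁻¹) = 0 := by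
  have := k.toH_rel (HRel.quadratic (k := k) j)
  rwa [map_mul, map_sub, map_add, AlgHom.commutes, AlgHom.commutes, map_zero] at this

theorem T_conj {w : D.Om} {i j : Option D.base.support} (h : w.1.1 (D.sa j) = D.sa i) :
    k.Tom w * k.T j = k.T i * k.Tom w := by
  have := k.toH_rel (HRel.conj (k := k) w i j h)
  rwa [map_mul, map_mul] at this

variable {B : Type*} [Ring B] [Algebra ℂ B]

/-- The universal property of `H(k)`. -/
noncomputable def lift (t : Option D.base.support → B) (o : D.Om →* B)
    (h1 : ∀ i j, i ≠ j → 0 < orderOf (D.sr i * D.sr j) →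
      altProd (t i) (t j) (orderOf (D.sr i * D.sr j)) =
        altProd (t j) (t i) (orderOf (D.sr i * D.sr j)))
    (h2 : ∀ j, (t j - algebraMap ℂ _ (k.kj j)) * (t j + algebraMap ℂ _ (k.kj j)⁻¹) = 0)
    (h3 : ∀ (w : D.Om) i j, w.1.1 (D.sa j) = D.sa i → o w * t j = t i * o w) : k.H →ₐ[ℂ] B :=
  RingQuot.liftAlgHom ℂ ⟨FreeAlgebra.lift ℂ (Sum.elim t o), by
    intro x y h
    induction h with
    | braid i j h h' =>
      rw [map_altProd, map_altProd]
      simpa using h1 i j h h'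
    | quadratic j => simpa using h2 j
    | one => simp
    | mul v w => simp
    | conj w i j h => simpa using h3 w i j h⟩

section
variable (t : Option D.base.support → B) (o : D.Om →* B)
    (h1 : ∀ i j, i ≠ j → 0 < orderOf (D.sr i * D.sr j) →
      altProd (t i) (t j) (orderOf (D.sr i * D.sr j)) =
        altProd (t j) (t i) (orderOf (D.sr i * D.sr j)))
    (h2 : ∀ j, (t j - algebraMap ℂ _ (k.kj j)) * (t j + algebraMap ℂ _ (k.kj j)⁻¹) = 0)
    (h3 : ∀ (w : D.Om) i j, w.1.1 (D.sa j) = D.sa i → o w * t j = t i * o w)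

theorem lift_T (j) : k.lift t o h1 h2 h3 (k.T j) = t j := by
  change RingQuot.liftAlgHom ℂ _ (RingQuot.mkAlgHom ℂ _ _) = _
  rw [RingQuot.liftAlgHom_mkAlgHom_apply]; simp

theorem lift_Tom (w) : k.lift t o h1 h2 h3 (k.Tom w) = o w := by
  change RingQuot.liftAlgHom ℂ _ (RingQuot.mkAlgHom ℂ _ _) = _
  rw [RingQuot.liftAlgHom_mkAlgHom_apply]; simp

end

/-- A subalgebra containing the images of the generators contains the image of `H(k)`. -/
theorem map_mem (φ : k.H →ₐ[ℂ] B) (S : Subalgebra ℂ B) (h1 : ∀ j, φ (k.T j) ∈ S)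
    (h2 : ∀ w, φ (k.Tom w) ∈ S) (h : k.H) : φ h ∈ S := by
  obtain ⟨x, hx⟩ := RingQuot.mkAlgHom_surjective ℂ (D.HRel k) h
  replace hx : k.toH x = h := hx
  subst hx
  induction x using FreeAlgebra.induction with
  | grade0 z => rw [AlgHom.commutes, AlgHom.commutes]; exact S.algebraMap_mem z
  | grade1 x =>
    rcases x with j | w
    · exact h1 j
    · exact h2 w
  | mul a b ha hb => rw [map_mul, map_mul]; exact S.mul_mem ha hb
  | add a b ha hb => rw [map_add, map_add]; exact S.add_mem ha hb

/-- The trivial character `ε_+^k` of `H(k)`, with `T_j ↦ k_j` and `T_ω ↦ 1`. -/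
noncomputable def eps : k.H →ₐ[ℂ] ℂ :=
  k.lift k.kj 1
    (by
      intro i j h _
      have ho := D.orderOf_sr h
      simp only [Set.mem_insert_iff, Set.mem_singleton_iff, Prod.mk.injEq] at ho
      rcases ho with ⟨h1, h2, h3⟩ | ⟨h1, h2, h3⟩ | ⟨h1, h2, h3⟩ | ⟨h1, h2, h3⟩ | ⟨h1, h2, h3⟩ |
        ⟨h1, h2, h3⟩ | ⟨h1, h2, h3⟩ <;> rw [h3] <;> simp only [altProd]
      · ring
      · rw [k.kj_eq_of_cart h1 h2]
      all_goals ring)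
    (by intro j; simp)
    (by
      intro w i j h
      rw [k.kj_eq_of_map w.1 h]
      simp)

theorem eps_T (j) : k.eps (k.T j) = k.kj j := k.lift_T ..

theorem eps_Tom (w) : k.eps (k.Tom w) = 1 := k.lift_Tom ..

/-- The inverse `T_j⁻¹ = T_j - (k_j - k_j⁻¹)` of `T_j`. -/
noncomputable def Tinv (j : Option D.base.support) : k.H :=
  k.T j - algebraMap ℂ _ (k.kj j - (k.kj j)⁻¹)

theorem T_sq (j) : k.T j * k.T j = (k.kj j - (k.kj j)⁻¹) • k.T j + 1 := by
  have h := k.T_quadratic j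
  have h0 := k.kj_ne_zero j
  simp only [sub_mul, mul_add, smul_sub, Algebra.algebraMap_eq_smul_one, smul_mul_assoc, mul_smul_comm,
    one_mul, mul_one, smul_smul, inv_mul_cancel₀ h0, one_smul] at h
  rw [sub_smul]
  rw [← sub_eq_zero]
  rw [← h]
  abel

theorem T_mul_Tinv (j) : k.T j * k.Tinv j = 1 := by
  rw [Tinv, mul_sub, T_sq, Algebra.algebraMap_eq_smul_one, mul_smul_comm, mul_one]
  abel

theorem Tinv_mul_T (j) : k.Tinv j * k.T j = 1 := by
  rw [Tinv, sub_mul, T_sq, Algebra.algebraMap_eq_smul_one, smul_mul_assoc, one_mul]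
  abel

/-- `T_j` as a unit of `H(k)`. -/
noncomputable def Tunit (j : Option D.base.support) : (k.H)ˣ :=
  ⟨k.T j, k.Tinv j, k.T_mul_Tinv j, k.Tinv_mul_T j⟩

/-- The anti-automorphism `u ↦ u⁻¹` of the unit group. -/
noncomputable def unitInv {B : Type*} [Ring B] : Bˣ →* Bᵐᵒᵖ where
  toFun x := MulOpposite.op ((x⁻¹ : Bˣ) : B)
  map_one' := by simp
  map_mul' x y := by simp

/-- The algebra anti-isomorphism `J_k : H(k⁻¹) → H(k)` with `T_j ↦ T_j⁻¹` and
`T_ω ↦ T_{ω⁻¹}`, as an algebra homomorphism to the opposite algebra. -/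
noncomputable def J : (k⁻¹).H →ₐ[ℂ] (k.H)ᵐᵒᵖ :=
  (k⁻¹).lift (fun j => MulOpposite.op (k.Tinv j))
    { toFun := fun w => MulOpposite.op (k.Tom w⁻¹)
      map_one' := by simp
      map_mul' := fun v w => by rw [mul_inv_rev, map_mul, MulOpposite.op_mul] }
    (by
      intro i j h h'
      have hu : altProd (k.Tunit i) (k.Tunit j) (orderOf (D.sr i * D.sr j)) =
          altProd (k.Tunit j) (k.Tunit i) (orderOf (D.sr i * D.sr j)) := by
        apply Units.ext
        have := map_altProd (Units.coeHom k.H) (k.Tunit i) (k.Tunit j) (orderOf (D.sr i * D.sr j))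
        have h2 := map_altProd (Units.coeHom k.H) (k.Tunit j) (k.Tunit i)
          (orderOf (D.sr i * D.sr j))
        exact this.trans ((k.T_braid h h').trans h2.symm)
      have h3 := congrArg unitInv hu
      rwa [map_altProd, map_altProd] at h3)
    (by
      intro j
      rw [inv_kj, inv_inv, MulOpposite.algebraMap_apply, MulOpposite.algebraMap_apply,
        ← MulOpposite.op_sub, ← MulOpposite.op_add, ← MulOpposite.op_mul, MulOpposite.op_eq_zero_iff]
      have h := k.T_quadratic j
      rw [← h, Tinv, map_sub]
      have e1 : k.T j - (algebraMap ℂ k.H (k.kj j) - algebraMap ℂ k.H (k.kj j)⁻¹) +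
        algebraMap ℂ k.H (k.kj j) = k.T j + algebraMap ℂ k.H (k.kj j)⁻¹ := by abel
      have e2 : k.T j - (algebraMap ℂ k.H (k.kj j) - algebraMap ℂ k.H (k.kj j)⁻¹) -
        algebraMap ℂ k.H (k.kj j)⁻¹ = k.T j - algebraMap ℂ k.H (k.kj j) := by abel
      rw [e1, e2]
      have hc : Commute (k.T j + algebraMap ℂ k.H (k.kj j)⁻¹)
          (k.T j - algebraMap ℂ k.H (k.kj j)) :=
        ((Commute.refl _).sub_right (Algebra.commute_algebraMap_right _ _)).add_left
          (Algebra.commute_algebraMap_left _ _)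
      exact hc)
    (by
      intro w i j h
      change MulOpposite.op _ * MulOpposite.op _ = MulOpposite.op _ * MulOpposite.op _
      rw [← MulOpposite.op_mul, ← MulOpposite.op_mul]
      congr 1
      have h1 := k.T_conj h
      have h2 : k.Tom w⁻¹ * k.Tom w = 1 := by rw [← map_mul, inv_mul_cancel, map_one]
      have h3 : k.Tom w * k.Tom w⁻¹ = 1 := by rw [← map_mul, mul_inv_cancel, map_one]
      calc k.Tinv j * k.Tom w⁻¹ = k.Tom w⁻¹ * (k.Tom w * k.Tinv j) * k.Tom w⁻¹ := by
            rw [← mul_assoc, h2, one_mul]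
        _ = k.Tom w⁻¹ * (k.Tinv i * (k.T i * k.Tom w) * k.Tinv j) * k.Tom w⁻¹ := by
            rw [← mul_assoc (k.Tinv i), Tinv_mul_T, one_mul]
        _ = k.Tom w⁻¹ * k.Tinv i * k.Tom w * (k.T j * k.Tinv j) * k.Tom w⁻¹ := by
            rw [← h1]; simp only [mul_assoc]
        _ = k.Tom w⁻¹ * k.Tinv i := by
            rw [T_mul_Tinv, mul_one, mul_assoc, h3, mul_one])

theorem J_T (j) : k.J ((k⁻¹).T j) = MulOpposite.op (k.Tinv j) := (k⁻¹).lift_T ..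

theorem J_Tom (w) : k.J ((k⁻¹).Tom w) = MulOpposite.op (k.Tom w⁻¹) := (k⁻¹).lift_Tom ..

end RootData.Mult

end Hecke
end DoubleAffine

namespace DoubleAffine
namespace QData
variable {ι V : Type*} [Finite ι] [NormedAddCommGroup V] [InnerProductSpace ℝ V] (D : QData ι V)

section smash

/-- The smash product algebra `ℂ(T) #_q W` of `q`-difference reflection operators. -/
abbrev S : Type _ := SkewMonoidAlgebra D.CTfrac D.W

/-- The embedding `ℂ(T) → ℂ(T) #_q W`. -/
noncomputable def SK : D.CTfrac →ₐ[ℂ] D.S :=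
  { (SkewMonoidAlgebra.singleOneRingHom : D.CTfrac →+* D.S) with commutes' := fun _ => rfl }

/-- The embedding `W → ℂ(T) #_q W`. -/
noncomputable def SW : D.W →* D.S := SkewMonoidAlgebra.of D.CTfrac D.W

theorem SK_apply (f : D.CTfrac) : D.SK f = SkewMonoidAlgebra.single 1 f := rfl

theorem SW_apply (w : D.W) : D.SW w = SkewMonoidAlgebra.single w 1 := rfl

theorem SW_mul_SK (w : D.W) (f : D.CTfrac) : D.SW w * D.SK f = D.SK (w • f) * D.SW w := by
  rw [SK_apply, SK_apply, SW_apply, SkewMonoidAlgebra.single_mul_single,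
    SkewMonoidAlgebra.single_mul_single]
  simp

theorem single_eq (w : D.W) (f : D.CTfrac) : SkewMonoidAlgebra.single w f = D.SK f * D.SW w := by
  rw [SK_apply, SW_apply, SkewMonoidAlgebra.single_mul_single]
  simp

theorem smul_eq_SK (f : D.CTfrac) (x : D.S) : f • x = D.SK f * x := by
  rw [← smul_one_mul f x]
  congr 1
  rw [SK_apply, SkewMonoidAlgebra.one_def, SkewMonoidAlgebra.smul_single, smul_eq_mul, mul_one]

variable (k : D.Mult)

/-- The element `c_j s_j`. -/
noncomputable def cs (j : Option D.base.support) : D.S :=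
  SkewMonoidAlgebra.single (D.sr j) (D.cj k j)

theorem cs_smul (j) (f : D.CTfrac) (x : D.S) :
    D.cs k j * (f • x) = MulSemiringAction.toRingHom D.W D.CTfrac (D.sr j) f • (D.cs k j * x) := by
  rw [smul_eq_SK, smul_eq_SK, cs, single_eq, MulSemiringAction.toRingHom_apply]
  calc D.SK (D.cj k j) * D.SW (D.sr j) * (D.SK f * x)
      = D.SK (D.cj k j) * (D.SW (D.sr j) * D.SK f) * x := by simp only [mul_assoc]
    _ = (D.SK (D.cj k j) * D.SK (D.sr j • f)) * D.SW (D.sr j) * x := by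
        rw [SW_mul_SK]; simp only [mul_assoc]
    _ = (D.SK (D.sr j • f) * D.SK (D.cj k j)) * D.SW (D.sr j) * x := by
        rw [← map_mul, mul_comm, map_mul]
    _ = _ := by simp only [mul_assoc]

theorem cs_cs (j) (x : D.S) : D.cs k j * (D.cs k j * x) =
    (1 + D.hj k j ^ 2 * (D.u (D.sa j) * (1 - D.u (D.sa j)))) • x := by
  rw [← mul_assoc, ← cj_smul_cj, smul_eq_SK]
  congr 1
  rw [cs, SkewMonoidAlgebra.single_mul_single, RootData.sr_mul_self, SK_apply]

/-- The element `k_j + c_j (s_j - 1)`. -/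
noncomputable def piT (j : Option D.base.support) : D.S :=
  algebraMap ℂ D.S (k.kj j) + D.SK (D.cj k j) * (D.SW (D.sr j) - 1)

theorem piT_eq (j) : D.piT k j = (D.hj k j * D.u (D.sa j)) • 1 + D.cs k j := by
  rw [piT, cs, single_eq, smul_eq_SK, mul_sub, mul_one, mul_one,
    show algebraMap ℂ D.S (k.kj j) = D.SK (D.kc k j) from (D.SK.commutes _).symm]
  have h : D.hj k j * D.u (D.sa j) = D.kc k j - D.cj k j := by rw [cj_eq]; ring
  rw [h, map_sub]
  abel

set_option maxHeartbeats 1000000 in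
theorem cs_braid (i j : Option D.base.support) (m : ℕ) (hi : i ≠ j)
    (h : (D.cart i j, D.cart j i, m) ∈ ({(0, 0, 2), (1, 1, 3), (1, 2, 4), (1, 3, 6)} :
      Set (ℤ × ℤ × ℕ))) : altProd (D.cs k i) (D.cs k j) m = altProd (D.cs k j) (D.cs k i) m := by
  have hb := D.sr_braid_aux i j m (by
    simp only [Set.mem_insert_iff, Set.mem_singleton_iff, Prod.mk.injEq] at h ⊢
    tauto)
  simp only [Set.mem_insert_iff, Set.mem_singleton_iff, Prod.mk.injEq] at h
  rcases h with ⟨h1, h2, rfl⟩ | ⟨h1, h2, rfl⟩ | ⟨h1, h2, rfl⟩ | ⟨h1, h2, rfl⟩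
  · obtain ⟨e1, e2⟩ := rk2 h1 h2
    simp only [altProd, mul_one, cs, SkewMonoidAlgebra.single_mul_single] at hb ⊢
    rw [hb]
    refine congrArg (SkewMonoidAlgebra.single _) ?_
    simp only [cj_eq, smul_sub, smul_mul', smul_hj, smul_kc, e1, e2]
    ring
  · obtain ⟨c, e1, e2, e3, e4, -⟩ := rk3 h1 h2
    simp only [altProd, mul_one, cs, SkewMonoidAlgebra.single_mul_single] at hb ⊢
    rw [hb]
    refine congrArg (SkewMonoidAlgebra.single _) ?_
    have h3 : D.hj k i = D.hj k j := by rw [hj, hj, k.kj_eq_of_cart h1 h2]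
    have h4 : D.kc k i = D.kc k j := by rw [kc, kc, k.kj_eq_of_cart h1 h2]
    simp only [cj_eq, smul_sub, smul_mul', smul_hj, smul_kc, e1, e2, e3, e4, h3, h4]
    ring
  · obtain ⟨c, d, ⟨e1, e2, e3⟩, ⟨e4, e5, e6⟩, -⟩ := rk4 h1 h2
    simp only [altProd, mul_one, cs, SkewMonoidAlgebra.single_mul_single] at hb ⊢
    rw [hb]
    refine congrArg (SkewMonoidAlgebra.single _) ?_
    simp only [cj_eq, smul_sub, smul_mul', smul_hj, smul_kc, e1, e2, e3, e4, e5, e6]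
    ring
  · obtain ⟨c, d, e, f, ⟨e1, e2, e3, e4, e5⟩, ⟨e6, e7, e8, e9, e10⟩, -⟩ := rk6 h1 h2
    simp only [altProd, mul_one, cs, SkewMonoidAlgebra.single_mul_single] at hb ⊢
    rw [hb]
    refine congrArg (SkewMonoidAlgebra.single _) ?_
    simp only [cj_eq, smul_sub, smul_mul', smul_hj, smul_kc, e1, e2, e3, e4, e5, e6, e7, e8, e9,
      e10]
    ring

theorem piT_braid_aux (i j : Option D.base.support) (m : ℕ) (hi : i ≠ j)
    (h : (D.cart i j, D.cart j i, m) ∈ ({(0, 0, 2), (1, 1, 3), (1, 2, 4), (1, 3, 6)} :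
      Set (ℤ × ℤ × ℕ))) : altProd (D.piT k i) (D.piT k j) m = altProd (D.piT k j) (D.piT k i) m := by
  have hb := D.cs_braid k i j m hi h
  rw [piT_eq, piT_eq]
  simp only [Set.mem_insert_iff, Set.mem_singleton_iff, Prod.mk.injEq] at h
  have hc : ∀ (w : D.W) l, MulSemiringAction.toRingHom D.W D.CTfrac w (D.hj k l) = D.hj k l :=
    fun w l => D.smul_hj w k l
  have hu : ∀ l, MulSemiringAction.toRingHom D.W D.CTfrac (D.sr l) (D.u (D.sa l)) =
    1 - D.u (D.sa l) := fun l => D.smul_u_self l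
  rcases h with ⟨h1, h2, rfl⟩ | ⟨h1, h2, rfl⟩ | ⟨h1, h2, rfl⟩ | ⟨h1, h2, rfl⟩
  · obtain ⟨e1, e2⟩ := rk2 h1 h2
    simp only [altProd, mul_one] at hb ⊢
    simp only [mul_add, add_mul, smul_mul_assoc, one_mul, cs_smul, mul_one, hb, map_mul, hc,
      MulSemiringAction.toRingHom_apply, e1, e2, smul_hj, smul_smul]
    rw [mul_comm (D.hj k j * D.u (D.sa j))]
    abel
  · obtain ⟨c, e1, e2, e3, e4, r1⟩ := rk3 h1 h2
    have h3 : D.hj k j = D.hj k i := by rw [hj, hj, k.kj_eq_of_cart h1 h2]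
    have hjj := D.cs_cs k j
    rw [h3] at hjj ⊢
    exact braid_demazure_3 _ _ _ _ _ _ _ _ (D.cs_smul k i) (D.cs_smul k j) (hc _ _) (hc _ _)
      (hu i) e1 e2 (hu j) e3 e4 r1 (D.cs_cs k i) hjj hb
  · obtain ⟨c, d, ⟨e1, e2, e3⟩, ⟨e4, e5, e6⟩, r1, r2⟩ := rk4 h1 h2
    exact braid_demazure_4 _ _ _ _ _ _ _ _ _ _ (D.cs_smul k i) (D.cs_smul k j) (hc _ _) (hc _ _)
      (hc _ _) (hc _ _) (hu i) e1 e2 e3 (hu j) e4 e5 e6 r1 r2 (D.cs_cs k i) (D.cs_cs k j) hb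
  · obtain ⟨c, d, e, f, ⟨e1, e2, e3, e4, e5⟩, ⟨e6, e7, e8, e9, e10⟩, r1, r2, r3, r4, r5⟩ :=
      rk6 h1 h2
    exact braid_demazure_6 _ _ _ _ _ _ _ _ _ _ _ _ (D.cs_smul k i) (D.cs_smul k j) (hc _ _)
      (hc _ _) (hc _ _) (hc _ _) (hu i) e1 e2 e3 e4 e5 (hu j) e6 e7 e8 e9 e10 r1 r2 r3 r4 r5
      (D.cs_cs k i) (D.cs_cs k j) hb

/-- Reduction of braid relations to four of the rank two cases. -/
theorem braid_of_cases {M : Type*} [Monoid M] (t : Option D.base.support → M)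
    (h : ∀ i j m, i ≠ j → (D.cart i j, D.cart j i, m) ∈
      ({(0, 0, 2), (1, 1, 3), (1, 2, 4), (1, 3, 6)} : Set (ℤ × ℤ × ℕ)) →
      altProd (t i) (t j) m = altProd (t j) (t i) m) (i j) (hij : i ≠ j)
    (hpos : 0 < orderOf (D.sr i * D.sr j)) :
    altProd (t i) (t j) (orderOf (D.sr i * D.sr j)) =
      altProd (t j) (t i) (orderOf (D.sr i * D.sr j)) := by
  have ho := D.orderOf_sr hij
  have ha := h i j (orderOf (D.sr i * D.sr j)) hij
  have hb := h j i (orderOf (D.sr i * D.sr j)) hij.symm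
  simp only [Set.mem_insert_iff, Set.mem_singleton_iff, Prod.mk.injEq] at ho ha hb
  rcases ho with ⟨h1, h2, h3⟩ | ⟨h1, h2, h3⟩ | ⟨h1, h2, h3⟩ | ⟨h1, h2, h3⟩ | ⟨h1, h2, h3⟩ |
    ⟨h1, h2, h3⟩ | ⟨h1, h2, h3⟩
  · exact ha (by simp [h1, h2, h3])
  · exact ha (by simp [h1, h2, h3])
  · exact ha (by simp [h1, h2, h3])
  · exact (hb (by simp [h1, h2, h3])).symm
  · exact ha (by simp [h1, h2, h3])
  · exact (hb (by simp [h1, h2, h3])).symm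
  · omega

theorem piT_quadratic (j) :
    (D.piT k j - algebraMap ℂ _ (k.kj j)) * (D.piT k j + algebraMap ℂ _ (k.kj j)⁻¹) = 0 := by
  have h0 : algebraMap ℂ D.S (k.kj j) = D.SK (D.kc k j) := (D.SK.commutes _).symm
  have h0' : algebraMap ℂ D.S (k.kj j)⁻¹ = D.SK (D.kc k j - D.hj k j) := by
    rw [kc, hj, ← map_sub, sub_sub_cancel]; exact (D.SK.commutes _).symm
  have h1 := D.cs_cs k j 1
  rw [piT_eq, h0, h0']
  rw [← mul_one (D.SK (D.kc k j)), ← mul_one (D.SK (D.kc k j - _)), ← smul_eq_SK, ← smul_eq_SK]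
  set u := D.u (D.sa j)
  have hu : MulSemiringAction.toRingHom D.W D.CTfrac (D.sr j) u = 1 - u := D.smul_u_self j
  have hh : MulSemiringAction.toRingHom D.W D.CTfrac (D.sr j) (D.hj k j) = D.hj k j :=
    D.smul_hj _ k j
  have hk : MulSemiringAction.toRingHom D.W D.CTfrac (D.sr j) (D.kc k j) = D.kc k j :=
    D.smul_kc _ k j
  have hkk := D.kc_mul k j
  have hcs : D.cs k j * D.cs k j = (1 + D.hj k j ^ 2 * (u * (1 - u))) • 1 := by simpa using h1
  have hc1 : ∀ f, D.cs k j * (f • 1) =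
      MulSemiringAction.toRingHom D.W D.CTfrac (D.sr j) f • D.cs k j := by
    intro f; simpa using D.cs_smul k j f 1
  simp only [mul_add, add_mul, sub_mul, smul_mul_assoc, one_mul, hc1, map_mul, map_sub, hu, hh, hk,
    hcs, smul_smul]
  match_scalars
  · linear_combination -hkk
  · ring

theorem SW_conj (w : D.Om) {i j} (h : w.1.1 (D.sa j) = D.sa i) :
    D.SW w.1 * D.piT k j = D.piT k i * D.SW w.1 := by
  have hc : w.1 • D.cj k j = D.cj k i := by
    rw [cj_eq, cj_eq, smul_sub, smul_mul', smul_kc, smul_hj, D.smul_u _ (D.sa_mem_Phat j), h, kc,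
      kc, hj, hj, k.kj_eq_of_map w.1 h]
  rw [piT, piT, mul_add, add_mul, ← mul_assoc, SW_mul_SK, hc, mul_assoc, mul_sub, mul_one,
    ← map_mul, D.conj_sr h, map_mul, mul_assoc, sub_mul, one_mul, k.kj_eq_of_map w.1 h]
  rw [Algebra.commutes]

/-- The algebra homomorphism `π^{k,q} : H(k) → ℂ(T) #_q W`, with
`π(T_j) = k_j + c_j (s_j - 1)` and `π(T_ω) = ω`. -/
noncomputable def pi : k.H →ₐ[ℂ] D.S :=
  k.lift (D.piT k) (D.SW.comp D.Om.subtype)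
    (D.braid_of_cases (D.piT k) (D.piT_braid_aux k))
    (D.piT_quadratic k)
    (fun w _ _ h => D.SW_conj k w h)

theorem pi_T (j) : D.pi k (k.T j) =
    algebraMap ℂ D.S (k.kj j) + D.SK (D.cj k j) * (D.SW (D.sr j) - 1) := k.lift_T ..

theorem pi_Tom (w : D.Om) : D.pi k (k.Tom w) = D.SW w.1 := k.lift_Tom ..

end smash
end QData
end DoubleAffine

namespace DoubleAffine
namespace RootData
variable {ι V : Type*} [Finite ι] [NormedAddCommGroup V] [InnerProductSpace ℝ V] (D : RootData ι V)

/-- The group `W` is generated by `Ω` and the simple reflections. -/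
theorem W_induction_sr {p : D.W → Prop} (h1 : ∀ w : D.Om, p w.1)
    (h2 : ∀ w j, p w → p (w * D.sr j)) (w : D.W) : p w := by
  obtain ⟨n, hn⟩ : ∃ n, D.length w = n := ⟨_, rfl⟩
  induction n generalizing w with
  | zero => exact h1 ⟨w, hn⟩
  | succ n ih =>
    obtain ⟨i, hi⟩ := D.exists_descent (w := w) (by omega)
    have h := h2 _ i (ih (w * D.sr i) (by have := D.length_descent hi; omega))
    rwa [mul_assoc, sr_mul_self, mul_one] at h

end RootData

namespace QData
variable {ι V : Type*} [Finite ι] [NormedAddCommGroup V] [InnerProductSpace ℝ V] (D : QData ι V)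
variable (k : D.Mult)

section coefficients

/-- The algebra `ℂ(T) ⊗ H(k)` of `H(k)`-valued rational functions. -/
abbrev KH : Type _ := D.CTfrac ⊗[ℂ] k.H

/-- The action of `W` on `ℂ(T) ⊗ H(k)` through the first factor. -/
noncomputable def wKH (w : D.W) : D.KH k →ₐ[ℂ] D.KH k :=
  Algebra.TensorProduct.map (MulSemiringAction.toAlgHom ℂ D.CTfrac w) (AlgHom.id ℂ k.H)

theorem smul_KH (f : D.CTfrac) (b : D.KH k) : f • b = (f ⊗ₜ[ℂ] (1 : k.H)) * b := by
  rw [Algebra.smul_def, Algebra.TensorProduct.algebraMap_apply]; rfl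

theorem wKH_smul (w : D.W) (f : D.CTfrac) (b : D.KH k) :
    D.wKH k w (f • b) = (w • f) • D.wKH k w b := by
  rw [smul_KH, map_mul, smul_KH, wKH, Algebra.TensorProduct.map_tmul, map_one]; rfl

/-- The image of `T_j` in `ℂ(T) ⊗ H(k)`. -/
noncomputable def TK (j : Option D.base.support) : D.KH k := 1 ⊗ₜ k.T j

theorem wKH_TK (w : D.W) (j) : D.wKH k w (D.TK k j) = D.TK k j := by
  rw [TK, wKH, Algebra.TensorProduct.map_tmul, map_one]; rfl

/-- The elements `(k_j - h_j x)⁻¹ (T_j - h_j x)` with `h_j = k_j - k_j⁻¹`. -/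
noncomputable def NK (j : Option D.base.support) (x : D.CTfrac) : D.KH k :=
  (D.kc k j - D.hj k j * x)⁻¹ • (D.TK k j - (D.hj k j * x) • 1)

theorem wKH_NK (w : D.W) (j) (x : D.CTfrac) : D.wKH k w (D.NK k j x) = D.NK k j (w • x) := by
  rw [NK, wKH_smul, smul_inv'', smul_sub, smul_mul', smul_kc, smul_hj, map_sub, wKH_TK, wKH_smul,
    map_one, smul_mul', smul_hj, NK]

theorem TK_sq (j) : D.TK k j * D.TK k j = D.hj k j • D.TK k j + 1 := by
  rw [TK, Algebra.TensorProduct.tmul_mul_tmul, k.T_sq, TensorProduct.tmul_add, one_mul, hj,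
    smul_KH, Algebra.TensorProduct.tmul_mul_tmul, one_mul, mul_one,
    Algebra.algebraMap_eq_smul_one, TensorProduct.smul_tmul, Algebra.TensorProduct.one_def]

theorem altProd_TK {i j : Option D.base.support} (h : i ≠ j) {m : ℕ} (h' : 0 < m)
    (hm : orderOf (D.sr i * D.sr j) = m) :
    altProd (D.TK k i) (D.TK k j) m = altProd (D.TK k j) (D.TK k i) m := by
  subst hm
  have := congrArg (Algebra.TensorProduct.includeRight : k.H →ₐ[ℂ] D.KH k) (k.T_braid h h')
  rwa [map_altProd, map_altProd] at this

end coefficients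

section nabla

/-- The algebra `𝒜 = ℂ(T) #_q W ⊗ H(k)`. -/
abbrev A : Type _ := D.S ⊗[ℂ] k.H

/-- The embedding of `ℂ(T) ⊗ H(k)` into `𝒜`. -/
noncomputable def emb : D.KH k →ₐ[ℂ] D.A k :=
  Algebra.TensorProduct.map D.SK (AlgHom.id ℂ k.H)

/-- The embedding of `W` into `𝒜`. -/
noncomputable def WA : D.W →* D.A k :=
  ((Algebra.TensorProduct.includeLeft : D.S →ₐ[ℂ] D.A k) : D.S →* D.A k).comp D.SW

theorem WA_apply (w : D.W) : D.WA k w = D.SW w ⊗ₜ 1 := rfl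

theorem WA_emb (w : D.W) (b : D.KH k) :
    D.WA k w * D.emb k b = D.emb k (D.wKH k w b) * D.WA k w := by
  induction b using TensorProduct.induction_on with
  | zero => simp
  | add x y hx hy => rw [map_add, mul_add, hx, hy, map_add, map_add, add_mul]
  | tmul f h =>
    rw [WA_apply, emb, wKH, Algebra.TensorProduct.map_tmul, Algebra.TensorProduct.map_tmul,
      Algebra.TensorProduct.map_tmul, Algebra.TensorProduct.tmul_mul_tmul,
      Algebra.TensorProduct.tmul_mul_tmul, SW_mul_SK, one_mul, mul_one]
    rfl

theorem emb_mul (b b' : D.KH k) (w w' : D.W) :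
    D.emb k b * D.WA k w * (D.emb k b' * D.WA k w') =
      D.emb k (b * D.wKH k w b') * D.WA k (w * w') := by
  rw [map_mul, map_mul, mul_assoc, ← mul_assoc (D.WA k w), WA_emb]
  simp only [mul_assoc]

/-- The element `c_j⁻¹ s_j T_j + ((c_j - k_j) / c_j) s_j` of `𝒜`. -/
noncomputable def nablaS (j : Option D.base.support) : D.A k :=
  (D.SK (D.cj k j)⁻¹ * D.SW (D.sr j)) ⊗ₜ k.T j +
    (D.SK ((D.cj k j - D.kc k j) / D.cj k j) * D.SW (D.sr j)) ⊗ₜ 1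

theorem nablaS_eq (j) :
    D.nablaS k j = D.emb k (D.NK k j (D.u (D.sa j))) * D.WA k (D.sr j) := by
  have h1 : D.NK k j (D.u (D.sa j)) = (D.cj k j)⁻¹ ⊗ₜ k.T j +
      ((D.cj k j - D.kc k j) / D.cj k j) ⊗ₜ 1 := by
    rw [NK, ← cj_eq, smul_sub, smul_smul, sub_eq_add_neg, ← neg_smul, smul_KH, smul_KH, TK,
      Algebra.TensorProduct.tmul_mul_tmul, mul_one, one_mul, mul_one]
    congr 2
    rw [cj_eq]
    ring
  rw [h1, map_add, add_mul, nablaS, emb, Algebra.TensorProduct.map_tmul,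
    Algebra.TensorProduct.map_tmul, WA_apply, Algebra.TensorProduct.tmul_mul_tmul,
    Algebra.TensorProduct.tmul_mul_tmul]
  simp

theorem nablaS_sq (j) : D.nablaS k j * D.nablaS k j = 1 := by
  have hk := D.kc_mul k j
  have hu := D.smul_u_self j
  have h0 := D.cj_ne_zero k j
  have h1 : D.sr j • D.cj k j ≠ 0 := by
    intro h; exact h0 ((smul_eq_zero_iff_eq (D.sr j)).1 h)
  rw [cj_eq, smul_sub, smul_mul', smul_kc, smul_hj, hu] at h1
  rw [cj_eq] at h0
  rw [nablaS_eq, emb_mul, RootData.sr_mul_self, map_one, mul_one, wKH_NK, hu, NK, NK,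
    smul_mul_smul_comm]
  have h2 : (D.TK k j - (D.hj k j * D.u (D.sa j)) • 1) *
      (D.TK k j - (D.hj k j * (1 - D.u (D.sa j))) • 1) =
      ((D.kc k j - D.hj k j * D.u (D.sa j)) * (D.kc k j - D.hj k j * (1 - D.u (D.sa j)))) •
        (1 : D.KH k) := by
    simp only [mul_sub, sub_mul, smul_mul_assoc, mul_smul_comm, mul_one, one_mul, TK_sq]
    match_scalars
    · ring
    · linear_combination -hk
  rw [h2, smul_smul, ← mul_inv, inv_mul_cancel₀ (mul_ne_zero h0 h1), one_smul, map_one]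

theorem nablaS_braid_aux (i j : Option D.base.support) (m : ℕ) (hij : i ≠ j)
    (h : (D.cart i j, D.cart j i, m) ∈ ({(0, 0, 2), (1, 1, 3), (1, 2, 4), (1, 3, 6)} :
      Set (ℤ × ℤ × ℕ))) :
    altProd (D.nablaS k i) (D.nablaS k j) m = altProd (D.nablaS k j) (D.nablaS k i) m := by
  have hb := D.sr_braid_aux i j m (by
    simp only [Set.mem_insert_iff, Set.mem_singleton_iff, Prod.mk.injEq] at h ⊢
    tauto)
  have ho := D.orderOf_sr hij
  have hi := D.TK_sq k i
  have hj := D.TK_sq k j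
  simp only [Set.mem_insert_iff, Set.mem_singleton_iff, Prod.mk.injEq] at h ho
  have hm : orderOf (D.sr i * D.sr j) = m := by omega
  have hT := D.altProd_TK k hij (m := m) (by omega) hm
  rw [nablaS_eq, nablaS_eq]
  rcases h with ⟨h1, h2, rfl⟩ | ⟨h1, h2, rfl⟩ | ⟨h1, h2, rfl⟩ | ⟨h1, h2, rfl⟩
  · obtain ⟨e1, e2⟩ := rk2 h1 h2
    simp only [altProd, mul_one] at hb hT ⊢
    rw [emb_mul, emb_mul, hb, wKH_NK, wKH_NK, e1, e2, NK, NK, smul_mul_smul_comm,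
      smul_mul_smul_comm, mul_comm (D.kc k i - _)⁻¹]
    congr 3
    simp only [mul_sub, sub_mul, smul_mul_assoc, mul_smul_comm, mul_one, one_mul, hT, smul_smul,
      smul_sub]
    rw [mul_comm (D.hj k j * D.u (D.sa j))]
    abel
  · obtain ⟨c, e1, e2, e3, e4, r1⟩ := rk3 h1 h2
    have h3 : D.hj k j = D.hj k i := by rw [QData.hj, QData.hj, k.kj_eq_of_cart h1 h2]
    have h4 : D.kc k j = D.kc k i := by rw [kc, kc, k.kj_eq_of_cart h1 h2]
    rw [h3] at hj
    have key := yangBaxter_3 _ _ _ _ c _ r1 hi hj hT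
    simp only [altProd, mul_one] at hb ⊢
    simp only [emb_mul]
    rw [hb]
    congr 2
    simp only [map_mul, wKH_NK, e1, e2, e3, e4]
    simp only [NK, h3, h4, smul_mul_smul_comm, ← mul_assoc]
    rw [key]
    congr 1
    ring
  · obtain ⟨c, d, ⟨e1, e2, e3⟩, ⟨e4, e5, e6⟩, r1, r2⟩ := rk4 h1 h2
    have key := yangBaxter_4 _ _ _ _ c d _ _ r1 r2 hi hj hT
    simp only [altProd, mul_one] at hb ⊢
    simp only [emb_mul]
    rw [hb]
    congr 2
    simp only [map_mul, wKH_NK, e1, e2, e3, e4, e5, e6]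
    simp only [NK, smul_mul_smul_comm, ← mul_assoc]
    rw [key]
    congr 1
    ring
  · obtain ⟨c, d, e, f, ⟨e1, e2, e3, e4, e5⟩, ⟨e6, e7, e8, e9, e10⟩, r1, r2, r3, r4, r5⟩ :=
      rk6 h1 h2
    have key := yangBaxter_6 _ _ _ _ c d e f _ _ r1 r2 r3 r4 r5 hi hj hT
    simp only [altProd, mul_one] at hb ⊢
    simp only [emb_mul]
    rw [hb]
    congr 2
    simp only [map_mul, wKH_NK, e1, e2, e3, e4, e5, e6, e7, e8, e9, e10]
    simp only [NK, smul_mul_smul_comm, ← mul_assoc]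
    rw [key]
    congr 1
    ring

/-- The elements `ω T_ω` of `𝒜`. -/
noncomputable def nablaOm : D.Om →* D.A k where
  toFun w := D.SW w.1 ⊗ₜ k.Tom w
  map_one' := by rw [OneMemClass.coe_one, map_one, map_one, Algebra.TensorProduct.one_def]
  map_mul' v w := by
    rw [Algebra.TensorProduct.tmul_mul_tmul, Subgroup.coe_mul, map_mul, map_mul]

theorem smul_cj (w : D.Om) {i j} (h : w.1.1 (D.sa j) = D.sa i) : w.1 • D.cj k j = D.cj k i := by
  rw [cj_eq, cj_eq, smul_sub, smul_mul', smul_kc, smul_hj, D.smul_u _ (D.sa_mem_Phat j), h, kc,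
    kc, hj, hj, k.kj_eq_of_map w.1 h]

theorem nablaS_conj (w : D.Om) (i j) (h : w.1.1 (D.sa j) = D.sa i) :
    D.nablaOm k w * D.nablaS k j = D.nablaS k i * D.nablaOm k w := by
  have hk : D.kc k j = D.kc k i := by rw [kc, kc, k.kj_eq_of_map w.1 h]
  change D.SW w.1 ⊗ₜ k.Tom w * _ = _ * D.SW w.1 ⊗ₜ k.Tom w
  rw [nablaS, nablaS, mul_add, add_mul]
  simp only [Algebra.TensorProduct.tmul_mul_tmul, mul_one, one_mul, k.T_conj h]
  simp only [← mul_assoc, SW_mul_SK, div_eq_mul_inv, smul_mul', smul_inv'', smul_sub, smul_kc,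
    D.smul_cj k w h]
  simp only [mul_assoc, ← map_mul, D.conj_sr h, hk]

theorem exists_nablaW : ∃ F : D.W →* D.A k, (∀ j, F (D.sr j) = D.nablaS k j) ∧
    ∀ w : D.Om, F w.1 = D.nablaOm k w :=
  D.exists_monoidHom (D.nablaS k) (D.nablaOm k) (D.nablaS_sq k)
    (D.braid_of_cases (D.nablaS k) (D.nablaS_braid_aux k)) (D.nablaS_conj k)

/-- The restriction of `∇^{k,q}` to `W`. -/
noncomputable def nablaW : D.W →* D.A k := (D.exists_nablaW k).choose

theorem nablaW_sr (j) : D.nablaW k (D.sr j) = D.nablaS k j := (D.exists_nablaW k).choose_spec.1 j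

theorem nablaW_Om (w : D.Om) : D.nablaW k w.1 = D.nablaOm k w :=
  (D.exists_nablaW k).choose_spec.2 w

theorem nablaW_comm (w : D.W) : ∀ f : D.CTfrac,
    D.SK (w • f) ⊗ₜ[ℂ] (1 : k.H) * D.nablaW k w = D.nablaW k w * D.SK f ⊗ₜ[ℂ] (1 : k.H) := by
  induction w using D.W_induction_sr with
  | h1 w =>
    intro f
    rw [nablaW_Om]
    change _ * D.SW w.1 ⊗ₜ k.Tom w = D.SW w.1 ⊗ₜ k.Tom w * _
    simp only [Algebra.TensorProduct.tmul_mul_tmul, mul_one, one_mul, SW_mul_SK]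
  | h2 w j ih =>
    intro f
    rw [map_mul, mul_smul, ← mul_assoc, ih, mul_assoc, mul_assoc]
    congr 1
    rw [nablaW_sr, nablaS, mul_add, add_mul]
    simp only [Algebra.TensorProduct.tmul_mul_tmul, mul_one, one_mul, mul_assoc, SW_mul_SK]
    simp only [← mul_assoc, ← map_mul]
    rw [mul_comm (D.sr j • f), mul_comm (D.sr j • f)]

/-- The algebra homomorphism `∇^{k,q} : ℂ(T) #_q W → 𝒜`. -/
noncomputable def nabla : D.S →ₐ[ℂ] D.A k :=
  { SkewMonoidAlgebra.liftNCRingHom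
      (((Algebra.TensorProduct.includeLeft : D.S →ₐ[ℂ] D.A k).comp D.SK : D.CTfrac →ₐ[ℂ] D.A k) :
        D.CTfrac →+* D.A k) (D.nablaW k) (fun {f w} => D.nablaW_comm k w f) with
    commutes' := fun z => by
      change SkewMonoidAlgebra.liftNC _ _ (SkewMonoidAlgebra.single 1 (algebraMap ℂ D.CTfrac z)) = _
      rw [SkewMonoidAlgebra.liftNC_single, map_one, mul_one]
      exact AlgHom.commutes ((Algebra.TensorProduct.includeLeft : D.S →ₐ[ℂ] D.A k).comp D.SK) z }

theorem nabla_single (w : D.W) (f : D.CTfrac) : D.nabla k (SkewMonoidAlgebra.single w f) =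
    D.SK f ⊗ₜ 1 * D.nablaW k w := SkewMonoidAlgebra.liftNC_single ..

theorem nabla_SK (f : D.CTfrac) : D.nabla k (D.SK f) = D.SK f ⊗ₜ 1 := by
  rw [SK_apply, nabla_single, map_one, mul_one, SK_apply]

theorem nabla_SW (w : D.W) : D.nabla k (D.SW w) = D.nablaW k w := by
  rw [SW_apply, nabla_single, map_one, ← Algebra.TensorProduct.one_def, one_mul]

/-- `∇(s_j) = c_j⁻¹ s_j T_j + ((c_j - k_j) / c_j) s_j`. -/
theorem nabla_sr (j) : D.nabla k (D.SW (D.sr j)) =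
    (D.SK (D.cj k j)⁻¹ * D.SW (D.sr j)) ⊗ₜ k.T j +
    (D.SK ((D.cj k j - algebraMap ℂ _ (k.kj j)) / D.cj k j) * D.SW (D.sr j)) ⊗ₜ 1 := by
  rw [nabla_SW, nablaW_sr]; rfl

/-- `∇(ω) = ω T_ω`. -/
theorem nabla_Om (w : D.Om) : D.nabla k (D.SW w.1) = D.SW w.1 ⊗ₜ k.Tom w := by
  rw [nabla_SW, nablaW_Om]; rfl

end nabla

section sigma

/-- The element `s_j T_j + (c_j - k_j) (s_j - 1)` of `𝒜`. -/
noncomputable def sigmaT (j : Option D.base.support) : D.A k :=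
  D.SW (D.sr j) ⊗ₜ k.T j +
    (D.SK (D.cj k j - algebraMap ℂ _ (k.kj j)) * (D.SW (D.sr j) - 1)) ⊗ₜ 1

theorem nabla_piT (j) : D.nabla k (D.piT k j) = D.sigmaT k j := by
  have h0 := D.cj_ne_zero k j
  have hk : algebraMap ℂ (D.A k) (k.kj j) = D.SK (algebraMap ℂ D.CTfrac (k.kj j)) ⊗ₜ 1 := by
    rw [AlgHom.commutes, Algebra.TensorProduct.algebraMap_apply]
  rw [piT, map_add, AlgHom.commutes, map_mul, map_sub, map_one, nabla_SK, nabla_sr, mul_sub, mul_add,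
    Algebra.TensorProduct.tmul_mul_tmul, Algebra.TensorProduct.tmul_mul_tmul, ← mul_assoc,
    ← mul_assoc, ← map_mul, ← map_mul, mul_inv_cancel₀ h0, mul_div_cancel₀ _ h0, map_one, hk,
    sigmaT, mul_sub, TensorProduct.sub_tmul, map_sub]
  simp only [one_mul, mul_one, TensorProduct.sub_tmul, sub_mul]
  abel

/-- The restriction to `H(k)` of the algebra homomorphism `σ^{k,q}`, with
`σ(T_j) = s_j T_j + (c_j - k_j) (s_j - 1)` and `σ(T_ω) = ω T_ω`. -/
noncomputable def sigma : k.H →ₐ[ℂ] D.A k :=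
  k.lift (D.sigmaT k) (D.nablaOm k)
    (by
      intro i j h h'
      have := congrArg (D.nabla k) (D.braid_of_cases (D.piT k) (D.piT_braid_aux k) i j h h')
      rwa [map_altProd, map_altProd, nabla_piT, nabla_piT] at this)
    (by
      intro j
      have := congrArg (D.nabla k) (D.piT_quadratic k j)
      rwa [map_mul, map_sub, map_add, AlgHom.commutes, AlgHom.commutes, map_zero, nabla_piT] at this)
    (by
      intro w i j h
      have := congrArg (D.nabla k) (D.SW_conj k w h)
      rwa [map_mul, map_mul, nabla_piT, nabla_piT, nabla_Om] at this)

theorem sigma_T (j) : D.sigma k (k.T j) = D.SW (D.sr j) ⊗ₜ k.T j +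
    (D.SK (D.cj k j - algebraMap ℂ _ (k.kj j)) * (D.SW (D.sr j) - 1)) ⊗ₜ 1 := k.lift_T ..

theorem sigma_Tom (w : D.Om) : D.sigma k (k.Tom w) = D.SW w.1 ⊗ₜ k.Tom w := k.lift_Tom ..

end sigma
end QData
end DoubleAffine

namespace DoubleAffine
namespace QData
variable {ι V : Type*} [Finite ι] [NormedAddCommGroup V] [InnerProductSpace ℝ V] (D : QData ι V)

section subalgebras

/-- The subalgebra `ℂ_σ^q[T]` of `ℂ(T)`, generated by `ℂ[T]` and `(1 - e_q^a)⁻¹` for `a ∈ R`. -/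
noncomputable def Csigma : Subalgebra ℂ D.CTfrac :=
  Algebra.adjoin ℂ (Set.range (algebraMap D.CT D.CTfrac) ∪
    Set.range fun a : D.R => (1 - D.e a)⁻¹)

variable (k : D.Mult)

/-- The subalgebra `ℂ_∇^{k,q}[T]` of `ℂ(T)`, generated by `ℂ[T]` and
`(k_a⁻¹ - k_a e_q^a)⁻¹` for `a ∈ R`. -/
noncomputable def Cnabla : Subalgebra ℂ D.CTfrac :=
  Algebra.adjoin ℂ (Set.range (algebraMap D.CT D.CTfrac) ∪ Set.range fun a : D.R =>
    (algebraMap ℂ D.CTfrac (k.toFun a : ℂ)⁻¹ - algebraMap ℂ D.CTfrac (k.toFun a : ℂ) * D.e a)⁻¹)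

/-- The subalgebra `C #_q W` of `ℂ(T) #_q W` for a (`W`-stable) subalgebra `C` of `ℂ(T)`. -/
noncomputable def smash (C : Subalgebra ℂ D.CTfrac) : Subalgebra ℂ D.S :=
  Algebra.adjoin ℂ (D.SK '' C ∪ Set.range D.SW)

/-- The subalgebra `C #_q W ⊗ H(k)` of `𝒜`. -/
noncomputable def tensorH (C : Subalgebra ℂ D.CTfrac) : Subalgebra ℂ (D.A k) :=
  (Algebra.TensorProduct.map (D.smash C).val (AlgHom.id ℂ k.H)).range

/-- The algebra `𝒜_σ^{k,q} = ℂ_σ^q[T] #_q W ⊗ H(k)`. -/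
noncomputable def Asigma : Subalgebra ℂ (D.A k) := D.tensorH k D.Csigma

/-- The algebra `𝒜_∇^{k,q} = ℂ_∇^{k,q}[T] #_q W ⊗ H(k)`. -/
noncomputable def Anabla : Subalgebra ℂ (D.A k) := D.tensorH k (D.Cnabla k)

/-- The algebra `𝒜_{σ,∇}^{k,q}`, generated by `𝒜_σ^{k,q}` and `𝒜_∇^{k,q}`. -/
noncomputable def Asn : Subalgebra ℂ (D.A k) := D.Asigma k ⊔ D.Anabla k

theorem tmul_mem {C : Subalgebra ℂ D.CTfrac} {x : D.S} (hx : x ∈ D.smash C) (h : k.H) :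
    x ⊗ₜ h ∈ D.tensorH k C :=
  ⟨(⟨x, hx⟩ : D.smash C) ⊗ₜ h, by simp⟩

theorem SK_mem_smash {C : Subalgebra ℂ D.CTfrac} {f : D.CTfrac} (hf : f ∈ C) :
    D.SK f ∈ D.smash C := Algebra.subset_adjoin (Or.inl ⟨f, hf, rfl⟩)

theorem SW_mem_smash (C : Subalgebra ℂ D.CTfrac) (w : D.W) : D.SW w ∈ D.smash C :=
  Algebra.subset_adjoin (Or.inr ⟨w, rfl⟩)

theorem e_mem_CT (x : ℝ × V) : D.e x ∈ Set.range (algebraMap D.CT D.CTfrac) := ⟨D.expo x, rfl⟩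

theorem cj_mem (j) : D.cj k j ∈ D.Csigma := by
  rw [cj, c, div_eq_mul_inv]
  refine mul_mem (sub_mem (algebraMap_mem _ _) (mul_mem (algebraMap_mem _ _) ?_)) ?_
  · exact Algebra.subset_adjoin (Or.inl (D.e_mem_CT _))
  · exact Algebra.subset_adjoin (Or.inr ⟨_, rfl⟩)

theorem inv_cj_mem (j) : (D.cj k j)⁻¹ ∈ D.Cnabla k := by
  rw [cj, c, inv_div, div_eq_mul_inv]
  refine mul_mem (sub_mem (one_mem _) ?_) ?_
  · exact Algebra.subset_adjoin (Or.inl (D.e_mem_CT _))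
  · exact Algebra.subset_adjoin (Or.inr ⟨_, rfl⟩)

theorem pi_mem (h : k.H) : D.pi k h ∈ D.smash D.Csigma := by
  refine k.map_mem (D.pi k) _ (fun j => ?_) (fun w => ?_) h
  · rw [pi_T]
    exact add_mem (algebraMap_mem _ _) (mul_mem (D.SK_mem_smash (D.cj_mem k j))
      (sub_mem (D.SW_mem_smash _ _) (one_mem _)))
  · rw [pi_Tom]
    exact D.SW_mem_smash _ _

theorem sigma_mem (h : k.H) : D.sigma k h ∈ D.Asigma k := by
  refine k.map_mem (D.sigma k) _ (fun j => ?_) (fun w => ?_) h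
  · rw [sigma_T]
    exact add_mem (D.tmul_mem k (D.SW_mem_smash _ _) _) (D.tmul_mem k
      (mul_mem (D.SK_mem_smash (sub_mem (D.cj_mem k j) (algebraMap_mem _ _)))
        (sub_mem (D.SW_mem_smash _ _) (one_mem _))) _)
  · rw [sigma_Tom]
    exact D.tmul_mem k (D.SW_mem_smash _ _) _

theorem nabla_mem (w : D.W) : D.nabla k (D.SW w) ∈ D.Anabla k := by
  induction w using D.W_induction_sr with
  | h1 w =>
    rw [nabla_Om]
    exact D.tmul_mem k (D.SW_mem_smash _ _) _
  | h2 w j ih =>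
    rw [map_mul, map_mul, nabla_sr, sub_div, div_self (D.cj_ne_zero k j), div_eq_mul_inv]
    exact mul_mem ih (add_mem
      (D.tmul_mem k (mul_mem (D.SK_mem_smash (D.inv_cj_mem k j)) (D.SW_mem_smash _ _)) _)
      (D.tmul_mem k (mul_mem (D.SK_mem_smash (sub_mem (one_mem _)
        (mul_mem (algebraMap_mem _ _) (D.inv_cj_mem k j)))) (D.SW_mem_smash _ _)) _))

/-- The element `σ^{k,q}(h)` of `𝒜_{σ,∇}^{k,q}`. -/
noncomputable def sigmaEl (h : k.H) : D.Asn k :=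
  ⟨D.sigma k h, (le_sup_left : D.Asigma k ≤ D.Asn k) (D.sigma_mem k h)⟩

/-- The element `∇^{k,q}(w)` of `𝒜_{σ,∇}^{k,q}`. -/
noncomputable def nablaEl (w : D.W) : D.Asn k :=
  ⟨D.nabla k (D.SW w), (le_sup_right : D.Anabla k ≤ D.Asn k) (D.nabla_mem k w)⟩

/-- The element `π^{k⁻¹,q}(h)` of `𝒜_{σ,∇}^{k,q}`, for `h ∈ H(k⁻¹)`. -/
noncomputable def piEl (h : (k⁻¹).H) : D.Asn k :=
  ⟨D.pi k⁻¹ h ⊗ₜ 1, (le_sup_left : D.Asigma k ≤ D.Asn k) (D.tmul_mem k (D.pi_mem k⁻¹ h) 1)⟩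

/-- The element `h ∈ H(k)` of `𝒜_{σ,∇}^{k,q}`. -/
noncomputable def heckeEl (h : k.H) : D.Asn k :=
  ⟨1 ⊗ₜ h, (le_sup_left : D.Asigma k ≤ D.Asn k) (D.tmul_mem k (one_mem _) h)⟩

end subalgebras

section invariants

variable (k : D.Mult) (M : Type*) [AddCommGroup M] [Module (D.Asn k) M]

/-- The space `M_σ^B` for a subalgebra `B` of `H(k)`. -/
def sigmaInv (B : Subalgebra ℂ k.H) : Set M :=
  {m | ∀ h ∈ B, D.sigmaEl k h • m = algebraMap ℂ (D.Asn k) (k.eps h) • m}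

/-- The space `M_∇^G` for a subgroup `G` of `W`. -/
def nablaInv (G : Subgroup D.W) : Set M := {m | ∀ g ∈ G, D.nablaEl k g • m = m}

/-- The space of `m ∈ M` with `π^{k⁻¹,q}(h) m = J_k(h) m` for all `h` in a subalgebra `B` of
`H(k⁻¹)`. -/
def piInv (B : Subalgebra ℂ (k⁻¹).H) : Set M :=
  {m | ∀ h ∈ B, D.piEl k h • m = D.heckeEl k (k.J h).unop • m}

end invariants

end QData
end DoubleAffine

/-! Each of the three conditions on `m` needs to be tested only on generators, and on a given
generator the three conditions say the same thing.

For a simple reflection the link is a pair of identities in 𝒜. By its formula, π^{k,q}(T_j) - k_j =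
c_j (s_j - 1). The homomorphism ∇ fixes rational functions and carries π^{k,q}(T_j) to σ^{k,q}(T_j),
so σ(T_j) - k_j = c_j (∇(s_j) - 1), which is `sigma_T_sub`. Multiply this on the left by s_j. Since
s_j sends c_j for k to c_j for k⁻¹, the left side becomes T_j⁻¹ - π^{k⁻¹,q}(T_j), and therefore
T_j⁻¹ - π^{k⁻¹,q}(T_j) = s_j c_j (∇(s_j) - 1), which is `Tinv_sub_pi_T`. This is where the inverse
parameter k⁻¹ and the inverse generator T_j⁻¹ = J_k(T_j) come from.

The factors c_j and s_j c_j can be cancelled: c_j lies in 𝒜_σ, its inverse lies in 𝒜_∇, and s_j is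
its own inverse. Here c_j is nonzero because e_q^{a_j} is a nonconstant monomial, the finite part of
a_j being a coroot. This is true for every q, so roots of unity cause no trouble. Hence σ(T_j) m =
k_j m, ∇(s_j) m = m and π^{k⁻¹,q}(T_j) m = T_j⁻¹ m are equivalent for each single j, the affine
index 0 included. For ω in Ω one has σ(T_ω) = ω T_ω = ∇(ω), and this element is also T_ω
π^{k⁻¹,q}(T_ω); as J_k(T_ω) is the inverse of T_ω, the three conditions agree again. These
equivalences are `sigmaHom_T_smul_eq_iff`, `piHom_T_smul_eq_iff`, `sigmaHom_Tom_smul_eq_iff` and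
`piHom_Tom_smul_eq_iff`.

To pass from generators to everything, fix `m` and collect the elements for which the respective
condition holds, in `sigmaStab`, `nablaStab` and `piStab`. The first is a subalgebra because ε_+ is
a character with scalar values, the second is a subgroup, and the third is a subalgebra because
π^{k⁻¹,q}(H(k⁻¹)) commutes with H(k) while J_k reverses products. Invariance under a subalgebra or
subgroup is therefore containment in such a stabilizer. Both parts then come down to generation: of
H₀ by T_1, …, T_n and of W₀ by s_1, …, s_n for (i), of H by all T_j and T_ω and of W by all s_j and
Ω for (ii). -/

namespace DoubleAffine
-- Generators of W₀, W and the Hecke algebras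
namespace RootData
variable {ι V : Type*} [Finite ι] [NormedAddCommGroup V] [InnerProductSpace ℝ V] (D : RootData ι V)

/-- The finite Weyl group `W₀` is generated by the simple reflections `s_1, …, s_n`. -/
theorem W₀_le_of_sr_mem {G : Subgroup D.W} (h : ∀ i, D.sr (some i) ∈ G) : D.W₀ ≤ G := by
  have key : ∀ i, (⟨D.finRefl i, D.finRefl_mem i⟩ : D.W) ∈ G := by
    intro i
    -- Every root arises from a simple root by sign changes and simple reflections. A sign change
    -- leaves the reflection unchanged, and applying s_j to the root conjugates its reflection by
    -- s_j.
    induction i using D.base.induction_reflect with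
    | h₀ i hi =>
      convert hi using 1
      refine D.W_ext fun x => ?_
      change D.finRefl _ x = D.finRefl _ x
      rw [finRefl_apply, finRefl_apply, RootPairing.reflection_reflectionPerm]
      simp [RootPairing.reflection_same]
    | h₁ i hi => exact h ⟨i, hi⟩
    | h₂ i j hi hj =>
      convert G.mul_mem (G.mul_mem (h ⟨j, hj⟩) hi) (h ⟨j, hj⟩) using 1
      refine D.W_ext fun x => ?_
      change D.finRefl _ x = D.finRefl j (D.finRefl i (D.finRefl j x))
      simp only [finRefl_apply, RootPairing.reflection_reflectionPerm]
      rfl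
  -- `W₀` is cut out inside `W` from a closure taken in the group of all linear automorphisms of ℝ c
  -- ⊕ V₀, so `G` is pushed forward to that group before the two are compared.
  have hle : Subgroup.closure (Set.range D.finRefl) ≤ G.map D.W.subtype := by
    rw [Subgroup.closure_le]
    rintro _ ⟨i, rfl⟩
    exact ⟨_, key i, rfl⟩
  intro w hw
  obtain ⟨v, hv, hvw⟩ := hle (Subgroup.mem_subgroupOf.1 hw)
  rwa [← Subtype.ext hvw]

theorem sr_some_mem_W₀ (i : D.base.support) : D.sr (some i) ∈ D.W₀ :=
  Subgroup.mem_subgroupOf.2 (Subgroup.subset_closure ⟨i, rfl⟩)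

/-- Induction on the length: an element of positive length has a right descent s_j, stripping it
lowers the length by one, and an element of length zero belongs to Ω by definition. -/
theorem eq_top_of_sr_mem {G : Subgroup D.W} (h : ∀ j, D.sr j ∈ G) (h' : ∀ w : D.Om, w.1 ∈ G) :
    G = ⊤ := by
  rw [eq_top_iff]
  rintro w -
  induction w using D.W_induction_sr with
  | h1 w => exact h' w
  | h2 w j ih => exact G.mul_mem ih (h j)

/-- H(k) is a quotient of the free algebra on the symbols T_j and T_ω, so `map_mem` for the identity
homomorphism gives the generation statement. -/
theorem Mult.eq_top_of_T_mem {D : RootData ι V} (k : D.Mult) {B : Subalgebra ℂ k.H}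
    (h : ∀ j, k.T j ∈ B) (h' : ∀ w, k.Tom w ∈ B) : B = ⊤ :=
  eq_top_iff.2 fun x _ => k.map_mem (AlgHom.id ℂ k.H) B h h' x

theorem Mult.H₀_le {D : RootData ι V} (k : D.Mult) {B : Subalgebra ℂ k.H}
    (h : ∀ i, k.T (some i) ∈ B) : k.H₀ ≤ B :=
  Algebra.adjoin_le (by rintro _ ⟨i, rfl⟩; exact h i)

theorem Mult.T_some_mem_H₀ {D : RootData ι V} (k : D.Mult) (i) : k.T (some i) ∈ k.H₀ :=
  Algebra.subset_adjoin ⟨i, rfl⟩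

end RootData

namespace QData
variable {ι V : Type*} [Finite ι] [NormedAddCommGroup V] [InnerProductSpace ℝ V] (D : QData ι V)
variable (k : D.Mult)

/-! ### The two identities relating σ, π and ∇ on a simple generator -/

section identities

/-- `σ(T_j) - k_j = c_j (∇(s_j) - 1)`. -/
theorem sigma_T_sub (j) : D.sigma k (k.T j) - algebraMap ℂ (D.A k) (k.kj j) =
    D.SK (D.cj k j) ⊗ₜ 1 * (D.nabla k (D.SW (D.sr j)) - 1) := by
  rw [sigma_T]
  change D.sigmaT k j - _ = _
  -- σ(T_j) is the image under ∇ of k_j + c_j (s_j - 1). Since ∇ fixes the scalar k_j and the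
  -- function c_j, only s_j is replaced, by ∇(s_j).
  rw [← nabla_piT, piT, map_add, AlgHom.commutes, add_sub_cancel_left, map_mul, map_sub, map_one,
    nabla_SK]

/-- `s_j(c_j^k) = c_j^{k⁻¹}`. -/
theorem sr_smul_cj (j) : D.sr j • D.cj k j = D.cj k⁻¹ j := by
  -- With u = (1 - e_q^{a_j})⁻¹ and h = k_j - k_j⁻¹ one has c_j = k_j - h u, and s_j exchanges u
  -- with 1 - u. This gives k_j⁻¹ + h u, which is k_j - h u with k_j inverted, as inversion changes
  -- the sign of h.
  rw [cj_eq, cj_eq, smul_sub, smul_mul', smul_kc, smul_hj, smul_u_self, kc, kc, hj, hj,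
    RootData.Mult.inv_kj, inv_inv, map_sub, map_sub]
  ring

/-- `T_j⁻¹ - π^{k⁻¹}(T_j) = s_j c_j (∇(s_j) - 1)`. -/
theorem Tinv_sub_pi_T (j) : (1 : D.S) ⊗ₜ[ℂ] k.Tinv j - D.pi k⁻¹ ((k⁻¹).T j) ⊗ₜ[ℂ] (1 : k.H) =
    D.SW (D.sr j) ⊗ₜ 1 * (D.SK (D.cj k j) ⊗ₜ 1 * (D.nabla k (D.SW (D.sr j)) - 1)) := by
  have hs : D.SW (D.sr j) * D.SW (D.sr j) = 1 := by
    rw [← map_mul, RootData.sr_mul_self, map_one]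
  -- This is s_j times the part of σ(T_j) whose Hecke factor is 1. Moving s_j to the right turns c_j
  -- into its k⁻¹ version c' and s_j - 1 into 1 - s_j, with result (c' - k_j)(1 - s_j). The right
  -- side is arranged so that s_j k_j cancels against the term -k_j of σ(T_j) - k_j, the scalar k_j
  -- - k_j⁻¹ joins T_j to form T_j⁻¹, and the last bracket is π^{k⁻¹,q}(T_j).
  have hY : D.SW (D.sr j) * (D.SK (D.cj k j - algebraMap ℂ _ (k.kj j)) * (D.SW (D.sr j) - 1)) =
      D.SW (D.sr j) * algebraMap ℂ D.S (k.kj j) - algebraMap ℂ D.S (k.kj j - (k.kj j)⁻¹) -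
        (algebraMap ℂ D.S (k.kj j)⁻¹ + D.SK (D.cj k⁻¹ j) * (D.SW (D.sr j) - 1)) := by
    rw [← mul_assoc, SW_mul_SK, smul_sub, smul_const, sr_smul_cj, mul_assoc, mul_sub (D.SW _), hs,
      mul_one, map_sub D.SK, AlgHom.commutes, ← Algebra.commutes, map_sub]
    noncomm_ring
  -- The scalar in T_j⁻¹ = T_j - (k_j - k_j⁻¹) sits in the Hecke factor, the same scalar in `hY`
  -- sits in the smash product factor; the tensor product over ℂ identifies them.
  have hc : (1 : D.S) ⊗ₜ[ℂ] algebraMap ℂ k.H (k.kj j - (k.kj j)⁻¹) =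
      algebraMap ℂ D.S (k.kj j - (k.kj j)⁻¹) ⊗ₜ 1 := by
    rw [Algebra.algebraMap_eq_smul_one, Algebra.algebraMap_eq_smul_one, TensorProduct.smul_tmul]
  -- Reading the first identity backwards turns the right side into s_j (σ(T_j) - k_j), which
  -- involves neither ∇ nor the inverse of c_j. The leading term s_j · s_j T_j is T_j.
  rw [← sigma_T_sub, sigma_T, mul_sub, mul_add, Algebra.TensorProduct.algebraMap_apply,
    Algebra.TensorProduct.tmul_mul_tmul, Algebra.TensorProduct.tmul_mul_tmul,
    Algebra.TensorProduct.tmul_mul_tmul, hs, hY, pi_T, RootData.Mult.inv_kj, RootData.Mult.Tinv,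
    TensorProduct.tmul_sub, hc, TensorProduct.sub_tmul, TensorProduct.sub_tmul, one_mul, mul_one]
  abel

end identities

/-! ### The maps and coefficients as elements of 𝒜_{σ,∇} -/

section elements

/-- `h ↦ σ^{k,q}(h)` as a homomorphism to `𝒜_{σ,∇}^{k,q}`. -/
noncomputable def sigmaHom : k.H →ₐ[ℂ] D.Asn k :=
  (D.sigma k).codRestrict _ fun h => (D.sigmaEl k h).2

/-- `w ↦ ∇^{k,q}(w)` as a homomorphism to `𝒜_{σ,∇}^{k,q}`. -/
noncomputable def nablaHom : D.W →* D.Asn k where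
  toFun := D.nablaEl k
  map_one' := Subtype.ext (by simp [nablaEl])
  map_mul' v w := Subtype.ext (by simp [nablaEl])

/-- `h ↦ π^{k⁻¹,q}(h)` as a homomorphism to `𝒜_{σ,∇}^{k,q}`. -/
noncomputable def piHom : (k⁻¹).H →ₐ[ℂ] D.Asn k :=
  ((Algebra.TensorProduct.includeLeft : D.S →ₐ[ℂ] D.A k).comp (D.pi k⁻¹)).codRestrict _
    fun h => (D.piEl k h).2

/-- The embedding of `H(k)` into `𝒜_{σ,∇}^{k,q}`. -/
noncomputable def heckeHom : k.H →ₐ[ℂ] D.Asn k :=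
  (Algebra.TensorProduct.includeRight : k.H →ₐ[ℂ] D.A k).codRestrict _ fun h => (D.heckeEl k h).2

/-- The two elements live in different tensor factors of 𝒜. This commutation lets the homomorphism π
be compared with the anti-homomorphism J_k on products. -/
theorem piHom_mul_heckeHom (h : (k⁻¹).H) (h' : k.H) :
    D.piHom k h * D.heckeHom k h' = D.heckeHom k h' * D.piHom k h := by
  refine Subtype.ext ?_
  change (D.pi k⁻¹ h ⊗ₜ[ℂ] (1 : k.H)) * ((1 : D.S) ⊗ₜ[ℂ] h') =
    ((1 : D.S) ⊗ₜ[ℂ] h') * (D.pi k⁻¹ h ⊗ₜ[ℂ] (1 : k.H))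
  simp only [Algebra.TensorProduct.tmul_mul_tmul, one_mul, mul_one]

/-- The embedding of `W` into `𝒜_{σ,∇}^{k,q}`. -/
noncomputable def WEl : D.W →* D.Asn k where
  toFun w := ⟨D.SW w ⊗ₜ 1,
    (le_sup_left : D.Asigma k ≤ D.Asn k) (D.tmul_mem k (D.SW_mem_smash _ w) 1)⟩
  map_one' := Subtype.ext (by simp [Algebra.TensorProduct.one_def])
  map_mul' v w := Subtype.ext (by simp)

/-- The element `c_j` of `𝒜_{σ,∇}^{k,q}`. -/
noncomputable def cEl (j : Option D.base.support) : D.Asn k :=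
  ⟨D.SK (D.cj k j) ⊗ₜ 1,
    -- The denominator 1 - e_q^{a_j} of c_j is inverted in ℂ_σ[T].
    (le_sup_left : D.Asigma k ≤ D.Asn k) (D.tmul_mem k (D.SK_mem_smash (D.cj_mem k j)) 1)⟩

/-- The element `c_j⁻¹` of `𝒜_{σ,∇}^{k,q}`. -/
noncomputable def cInv (j : Option D.base.support) : D.Asn k :=
  ⟨D.SK (D.cj k j)⁻¹ ⊗ₜ 1,
    -- The denominator of c_j⁻¹ is the numerator k_j⁻¹ - k_j e_q^{a_j} of c_j, which is inverted in
    -- ℂ_∇[T].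
    (le_sup_right : D.Anabla k ≤ D.Asn k) (D.tmul_mem k (D.SK_mem_smash (D.inv_cj_mem k j)) 1)⟩

/-- The rational function c_j is nonzero for every q. Its two factors here come from 𝒜_σ and 𝒜_∇
respectively, which is why `M` is taken to be a module over the algebra generated by both. -/
theorem cInv_mul_cEl (j) : D.cInv k j * D.cEl k j = 1 := by
  refine Subtype.ext ?_
  change D.SK (D.cj k j)⁻¹ ⊗ₜ[ℂ] (1 : k.H) * D.SK (D.cj k j) ⊗ₜ[ℂ] (1 : k.H) = 1
  rw [Algebra.TensorProduct.tmul_mul_tmul, ← map_mul, inv_mul_cancel₀ (D.cj_ne_zero k j), map_one,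
    one_mul, Algebra.TensorProduct.one_def]

/-- The first identity with its subtractions moved across, so that it reads a + u = b + u c with u =
c_j, the shape used in `smul_eq_smul_iff_of_add_eq`. It holds in 𝒜 and passes to the subalgebra
because the inclusion is injective. -/
theorem sigmaHom_T_add (j) : D.sigmaHom k (k.T j) + D.cEl k j =
    algebraMap ℂ (D.Asn k) (k.kj j) + D.cEl k j * D.nablaHom k (D.sr j) := by
  have h := D.sigma_T_sub k j
  rw [mul_sub, mul_one, sub_eq_sub_iff_add_eq_add, add_comm (_ * _)] at h
  exact Subtype.ext h

/-- The second identity in the same shape a + u = b + u c, now with u = s_j c_j and with T_j⁻¹, not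
π(T_j), in the role of a. -/
theorem heckeHom_Tinv_add (j) :
    D.heckeHom k (k.Tinv j) + D.WEl k (D.sr j) * D.cEl k j =
      D.piHom k ((k⁻¹).T j) + D.WEl k (D.sr j) * D.cEl k j * D.nablaHom k (D.sr j) := by
  have h := D.Tinv_sub_pi_T k j
  rw [← mul_assoc, mul_sub, mul_one, sub_eq_sub_iff_add_eq_add, add_comm (_ * D.nabla k _)] at h
  exact Subtype.ext h

/-- Both σ and ∇ were prescribed to give ω T_ω, so no correction factor appears for elements of
length zero. -/
theorem sigmaHom_Tom (w : D.Om) : D.sigmaHom k (k.Tom w) = D.nablaHom k w.1 :=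
  Subtype.ext ((D.sigma_Tom k w).trans (D.nabla_Om k w).symm)

/-- The value ω T_ω of ∇ splits along the tensor product, and its first factor ω is π(T_ω) for every
multiplicity function, in particular for k⁻¹. -/
theorem nablaHom_Om (w : D.Om) :
    D.nablaHom k w.1 = D.heckeHom k (k.Tom w) * D.piHom k ((k⁻¹).Tom w) := by
  refine Subtype.ext ?_
  change D.nabla k (D.SW w.1) = 1 ⊗ₜ k.Tom w * D.pi k⁻¹ ((k⁻¹).Tom w) ⊗ₜ 1
  rw [nabla_Om, pi_Tom, Algebra.TensorProduct.tmul_mul_tmul, one_mul, mul_one]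

end elements

/-! ### Equivalence of the three conditions on a single generator -/

section generators

/-- If `a - b = u (c - 1)` with `u` left invertible, then `a n = b n` is equivalent to `c n = n`. -/
theorem smul_eq_smul_iff_of_add_eq {R N : Type*} [Semiring R] [AddCommGroup N] [Module R N]
    {a b c u v : R} (hv : v * u = 1) (h : a + u = b + u * c) (n : N) :
    a • n = b • n ↔ c • n = n := by
  -- If the first terms agree, cancelling them leaves u n = u c n, and v removes u. If c n = n, the
  -- second terms agree and are cancelled instead. Only a left inverse of u is needed.
  have h' : a • n + u • n = b • n + u • c • n := by
    rw [← add_smul, h, add_smul, mul_smul]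
  constructor
  · intro hab
    rw [hab, add_right_inj] at h'
    rw [← one_smul R (c • n), ← hv, mul_smul, ← h', ← mul_smul, hv, one_smul]
  · intro hc
    rwa [hc, add_left_inj] at h'

variable {M : Type*} [AddCommGroup M] [Module (D.Asn k) M] (m : M)

/-- Since ε_+(T_j) = k_j, the difference of the two sides on the left is c_j (∇(s_j) - 1) m, and c_j
can be cancelled. The index j may be the affine one. -/
theorem sigmaHom_T_smul_eq_iff (j) :
    D.sigmaHom k (k.T j) • m = algebraMap ℂ (D.Asn k) (k.eps (k.T j)) • m ↔
      D.nablaHom k (D.sr j) • m = m := by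
  rw [RootData.Mult.eps_T]
  exact smul_eq_smul_iff_of_add_eq (D.cInv_mul_cEl k j) (D.sigmaHom_T_add k j) m

/-- Since J_k(T_j) = T_j⁻¹, the two sides differ by s_j c_j (∇(s_j) - 1) m up to sign, and s_j c_j
can be cancelled. -/
theorem piHom_T_smul_eq_iff (j) :
    D.piHom k ((k⁻¹).T j) • m = D.heckeHom k (k.J ((k⁻¹).T j)).unop • m ↔
      D.nablaHom k (D.sr j) • m = m := by
  -- The left inverse of s_j c_j is c_j⁻¹ s_j; the two reflections in the middle cancel.
  have hv : D.cInv k j * D.WEl k (D.sr j) * (D.WEl k (D.sr j) * D.cEl k j) = 1 := by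
    rw [mul_assoc, ← mul_assoc (D.WEl k _), ← map_mul, RootData.sr_mul_self, map_one, one_mul,
      cInv_mul_cEl]
  -- The equation is turned round because T_j⁻¹ stands first in `heckeHom_Tinv_add`.
  rw [eq_comm, RootData.Mult.J_T, MulOpposite.unop_op]
  exact smul_eq_smul_iff_of_add_eq hv (D.heckeHom_Tinv_add k j) m

theorem sigmaHom_Tom_smul_eq_iff (w : D.Om) :
    D.sigmaHom k (k.Tom w) • m = algebraMap ℂ (D.Asn k) (k.eps (k.Tom w)) • m ↔
      D.nablaHom k w.1 • m = m := by
  rw [sigmaHom_Tom, RootData.Mult.eps_Tom, map_one, one_smul]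

/-- Here ∇(ω) m = T_ω π(T_ω) m, while J_k(T_ω) is T_{ω⁻¹}, the inverse of T_ω. Multiplying by T_ω or
by its inverse passes between the two conditions. -/
theorem piHom_Tom_smul_eq_iff (w : D.Om) :
    D.piHom k ((k⁻¹).Tom w) • m = D.heckeHom k (k.J ((k⁻¹).Tom w)).unop • m ↔
      D.nablaHom k w.1 • m = m := by
  rw [RootData.Mult.J_Tom, MulOpposite.unop_op, nablaHom_Om, mul_smul]
  constructor <;> intro h
  · rw [h, ← mul_smul, ← map_mul, ← map_mul, mul_inv_cancel, map_one, map_one, one_smul]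
  -- Only the `m` on the right side is replaced by T_ω π(T_ω) m; T_{ω⁻¹} then cancels T_ω and leaves
  -- π(T_ω) m.
  · nth_rw 2 [← h]
    rw [← mul_smul, ← map_mul, ← map_mul, inv_mul_cancel, map_one, map_one, one_smul]

end generators

/-! ### Stabilizers of a vector, and reduction to generators -/

section stabilizers

variable {M : Type*} [AddCommGroup M] [Module (D.Asn k) M] (m : M)

/-- The subalgebra of the `h ∈ H(k)` with `σ(h) m = ε_+(h) m`. -/
noncomputable def sigmaStab : Subalgebra ℂ k.H where
  carrier := {h | D.sigmaHom k h • m = algebraMap ℂ (D.Asn k) (k.eps h) • m}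
  mul_mem' {a b} ha hb := by
    simp only [Set.mem_ofPred_eq] at ha hb ⊢
    -- The chain is σ(a) σ(b) m = σ(a) ε(b) m = ε(b) σ(a) m = ε(b) ε(a) m. The scalar ε(b) is
    -- central, and ε(b) ε(a) = ε(a b) because ε takes values in a commutative ring.
    rw [map_mul, mul_smul, hb, ← mul_smul, ← Algebra.commutes, mul_smul, ha, ← mul_smul,
      ← map_mul, map_mul k.eps, mul_comm]
  add_mem' {a b} ha hb := by
    simp only [Set.mem_ofPred_eq] at ha hb ⊢
    rw [map_add, add_smul, ha, hb, map_add k.eps, RingHom.map_add, add_smul]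
  algebraMap_mem' z := by
    simp only [Set.mem_ofPred_eq, AlgHom.commutes]
    rfl

/-- The subgroup of the `w ∈ W` with `∇(w) m = m`. -/
noncomputable def nablaStab : Subgroup D.W where
  carrier := {w | D.nablaHom k w • m = m}
  one_mem' := by simp
  mul_mem' {a b} ha hb := by
    simp only [Set.mem_ofPred_eq] at ha hb ⊢
    rw [map_mul, mul_smul, hb, ha]
  inv_mem' {a} ha := by
    simp only [Set.mem_ofPred_eq] at ha ⊢
    -- Only the `m` acted on by ∇(a⁻¹) is written as ∇(a) m.
    nth_rw 1 [← ha]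
    rw [← mul_smul, ← map_mul, inv_mul_cancel, map_one, one_smul]

/-- The subalgebra of the `h ∈ H(k⁻¹)` with `π^{k⁻¹}(h) m = J_k(h) m`. -/
noncomputable def piStab : Subalgebra ℂ (k⁻¹).H where
  carrier := {h | D.piHom k h • m = D.heckeHom k (k.J h).unop • m}
  mul_mem' {a b} ha hb := by
    simp only [Set.mem_ofPred_eq] at ha hb ⊢
    -- The chain is π(a) π(b) m = π(a) J(b) m = J(b) π(a) m = J(b) J(a) m = J(a b) m. The middle
    -- step uses that the two Hecke algebras commute in 𝒜, the last that J reverses products;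
    -- neither would do without the other.
    rw [map_mul, mul_smul, hb, ← mul_smul, piHom_mul_heckeHom, mul_smul, ha, ← mul_smul,
      ← map_mul, map_mul k.J, MulOpposite.unop_mul]
  add_mem' {a b} ha hb := by
    simp only [Set.mem_ofPred_eq] at ha hb ⊢
    rw [map_add, add_smul, ha, hb, map_add k.J, MulOpposite.unop_add, map_add, add_smul]
  algebraMap_mem' z := by
    simp only [Set.mem_ofPred_eq, AlgHom.commutes, MulOpposite.algebraMap_apply,
      MulOpposite.unop_op]

/-- True by unfolding, since `sigmaHom` has the elements `sigmaEl` as its values. The gain is that a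
containment of subalgebras can be checked on generators; the analogues for ∇ and π serve the same
purpose. -/
theorem mem_sigmaInv_iff (B : Subalgebra ℂ k.H) : m ∈ D.sigmaInv k M B ↔ B ≤ D.sigmaStab k m :=
  Iff.rfl

theorem mem_nablaInv_iff (G : Subgroup D.W) : m ∈ D.nablaInv k M G ↔ G ≤ D.nablaStab k m :=
  Iff.rfl

theorem mem_piInv_iff (B : Subalgebra ℂ (k⁻¹).H) : m ∈ D.piInv k M B ↔ B ≤ D.piStab k m :=
  Iff.rfl

/-- The criterion on the right involves only ∇ at the finite simple reflections. It recurs verbatim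
for `nablaStab` and `piStab`, and this makes the three spaces of part (i) equal. -/
theorem H₀_le_sigmaStab_iff :
    k.H₀ ≤ D.sigmaStab k m ↔ ∀ i, D.nablaHom k (D.sr (some i)) • m = m :=
  ⟨fun h i => (D.sigmaHom_T_smul_eq_iff k m _).1 (h (k.T_some_mem_H₀ i)),
    fun h => k.H₀_le fun i => (D.sigmaHom_T_smul_eq_iff k m _).2 (h i)⟩

/-- `W₀` is defined by the reflections in all finite roots, so the backward direction rests on its
generation by the simple ones. -/
theorem W₀_le_nablaStab_iff :
    D.W₀ ≤ D.nablaStab k m ↔ ∀ i, D.nablaHom k (D.sr (some i)) • m = m :=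
  ⟨fun h i => h (D.sr_some_mem_W₀ i), fun h => D.W₀_le_of_sr_mem h⟩

theorem H₀_le_piStab_iff :
    (k⁻¹).H₀ ≤ D.piStab k m ↔ ∀ i, D.nablaHom k (D.sr (some i)) • m = m :=
  ⟨fun h i => (D.piHom_T_smul_eq_iff k m _).1 (h ((k⁻¹).T_some_mem_H₀ i)),
    fun h => (k⁻¹).H₀_le fun i => (D.piHom_T_smul_eq_iff k m _).2 (h i)⟩

/-- The full Hecke algebra needs two further kinds of generators: the affine T_0, covered by letting
j run over all indices including `none`, and the T_ω. The resulting criterion, again in terms of ∇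
alone, is the common one for part (ii). -/
theorem top_le_sigmaStab_iff : ⊤ ≤ D.sigmaStab k m ↔
    (∀ j, D.nablaHom k (D.sr j) • m = m) ∧ ∀ w : D.Om, D.nablaHom k w.1 • m = m :=
  ⟨fun h => ⟨fun _ => (D.sigmaHom_T_smul_eq_iff k m _).1 (h trivial),
      fun _ => (D.sigmaHom_Tom_smul_eq_iff k m _).1 (h trivial)⟩,
    fun h => (k.eq_top_of_T_mem (fun j => (D.sigmaHom_T_smul_eq_iff k m j).2 (h.1 j))
      fun w => (D.sigmaHom_Tom_smul_eq_iff k m w).2 (h.2 w)).ge⟩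

/-- Here the criterion is just generation of W by Ω and the simple affine reflections. -/
theorem top_le_nablaStab_iff : ⊤ ≤ D.nablaStab k m ↔
    (∀ j, D.nablaHom k (D.sr j) • m = m) ∧ ∀ w : D.Om, D.nablaHom k w.1 • m = m :=
  ⟨fun h => ⟨fun _ => h trivial, fun _ => h trivial⟩,
    fun h => (D.eq_top_of_sr_mem h.1 h.2).ge⟩

theorem top_le_piStab_iff : ⊤ ≤ D.piStab k m ↔
    (∀ j, D.nablaHom k (D.sr j) • m = m) ∧ ∀ w : D.Om, D.nablaHom k w.1 • m = m :=
  ⟨fun h => ⟨fun _ => (D.piHom_T_smul_eq_iff k m _).1 (h trivial),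
      fun _ => (D.piHom_Tom_smul_eq_iff k m _).1 (h trivial)⟩,
    fun h => ((k⁻¹).eq_top_of_T_mem (fun j => (D.piHom_T_smul_eq_iff k m j).2 (h.1 j))
      fun w => (D.piHom_Tom_smul_eq_iff k m w).2 (h.2 w)).ge⟩

end stabilizers

end QData
end DoubleAffine

/-! ### Equality of the three invariant spaces -/

theorem mainTheorem8 {ι V : Type*} [Finite ι] [NormedAddCommGroup V] [InnerProductSpace ℝ V]
    (D : DoubleAffine.QData ι V) (k : D.Mult) (M : Type*) [AddCommGroup M] [Module (D.Asn k) M] :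
    (D.sigmaInv k M k.H₀ = D.nablaInv k M D.W₀ ∧
      D.nablaInv k M D.W₀ = D.piInv k M (k⁻¹).H₀) ∧
    (D.sigmaInv k M ⊤ = D.nablaInv k M ⊤ ∧ D.nablaInv k M ⊤ = D.piInv k M ⊤) := by
  -- Membership in each set is rewritten as the common criterion on ∇ at generators, after which
  -- every equivalence has identical sides.
  simp only [Set.ext_iff, D.mem_sigmaInv_iff, D.mem_nablaInv_iff, D.mem_piInv_iff,
    D.H₀_le_sigmaStab_iff, D.W₀_le_nablaStab_iff, D.H₀_le_piStab_iff, D.top_le_sigmaStab_iff,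
    D.top_le_nablaStab_iff, D.top_le_piStab_iff, implies_true, and_self]
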